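/- There is a universal constant $C>0$ with the following property. Let $n\ge 3$, let $d_1,\dots,d_{n-1}\ge 1$ be integers with $d:=\max_i d_i\ge 2$, and set $N_i:=\binom{n+d_i-1}{d_i}$ and $N:=\sum_{i=1}^{n-1}N_i$. Let $P=(p_1,\dots,p_{n-1})$ be the random system of homogeneous polynomials in $n$ variables $$p_i(x)=\sum_{\alpha_1+\cdots+\alpha_n=d_i}\sqrt{\tbinom{d_i}{\alpha}}\;c_{i,\alpha}\,x^\alpha ,\qquad \tbinom{d_i}{\alpha}=\frac{d_i!}{\alpha_1!\cdots\alpha_n!},$$ where the random vectors $C_i=(c_{i,\alpha})_\alpha\in\mathbb R^{N_i}$, $1\le i\le n-1$, are independent and, for some $K,c_0>0$ and every $i$, satisfy * (Sub-Gaussian) $\mathrm{Prob}(|\langle C_i,\theta\rangle|\ge t)\le 2e^{-t^2/K^2}$ for all unit vectors $\theta\in\mathbb R^{N_i}$ and all $t>0$; * (Small Ball) $\mathrm{Prob}(|\langle a,C_i\rangle|\le\varepsilon\|a\|_2)\le c_0\varepsilon$ for all nonzero $a\in\mathbb R^{N_i}$ and all $\varepsilon>0$. For a system $P$ of homogeneous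 polynomials of degrees $d_1,\dots,d_{n-1}$ let $\|P\|_W=\big(\sum_i\sum_{|\alpha|=d_i}|\mathrm{coeff}_\alpha(p_i)|^2/\binom{d_i}{\alpha}\big)^{1/2}$ be its Weyl-Bombieri norm. For $x\in S^{n-1}$ set $$L(P,x)=\sqrt{\sigma_{\min}\big(\Delta^{-1}DP(x)|_{T_xS^{n-1}}\big)^2+\|P(x)\|_2^2},\qquad \Delta=\mathrm{diag}(\sqrt{d_1},\dots,\sqrt{d_{n-1}}),$$ where $DP(x)$ is the Jacobian matrix, $T_xS^{n-1}=x^\perp$, and $\sigma_{\min}$ is the smallest singular value. Let $\tilde\kappa(P)=\sup_{x\in S^{n-1}}\|P\|_W/L(P,x)\in[0,\infty]$, a quotient with $L(P,x)=0$ being $\infty$. Put $$M:=\sqrt N\,(Kc_0C)^{2(n-1)}\,(3d^2\log(ed))^{2n-3}\,\sqrt n .$$ Then $$\mathrm{Prob}(\tilde\kappa(P)\ge tM)\le\begin{cases}3t^{-1/2}&\text{if }1\le t\le e^{2(n-1)\log(ed)},\\[4pt] 3t^{-1/2}\left(\dfrac{\log t}{2(n-1)\log(ed)}\right)^{\frac{n-3/2}{2}}&\text{if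 }e^{2(n-1)\log(ed)}\le t\le e^{2N},\\[8pt] 3t^{-1/2}\left(\dfrac{\log t}{2N}\right)^{1/4}\left(\dfrac{\log t}{2(n-1)\log(ed)}\right)^{\frac{n-3/2}{2}}&\text{if }t\ge e^{2N}.\end{cases}$$ For every $q\in\left(0,\frac12-\frac1{4\log(ed)}\right]$ we have $\big(\mathbb E\,\tilde\kappa(P)^q\big)^{1/q}\le M e^{1/q}$. Finally, $0<\tilde\kappa(P)<\infty$ almost surely, $\log\tilde\kappa(P)$ is integrable, and $\mathbb E\log\tilde\kappa(P)\le 1+\log M$. -/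

import Mathlib

open MeasureTheory ProbabilityTheory
open scoped ENNReal

noncomputable section

namespace RandomSystem

/-- The multi-indices `α = (α₁, …, αₙ)` of natural numbers with `α₁ + ⋯ + αₙ = k`;
there are `(n + k - 1).choose k` of them. -/
abbrev MultiIndex (n k : ℕ) : Type :=
  ↥(Finset.finsuppAntidiag (Finset.univ : Finset (Fin n)) k)

/-- The homogeneous polynomial `∑_{|α| = k} √(k! / (α₁! ⋯ αₙ!)) c_α x^α` of degree `k` in `n`
variables with (scaled) coefficient vector `c`. -/
def formOfCoeffs {n k : ℕ} (c : EuclideanSpace ℝ (MultiIndex n k)) : MvPolynomial (Fin n) ℝ :=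
  ∑ α : MultiIndex n k,
    MvPolynomial.monomial (α : Fin n →₀ ℕ) (√((α : Fin n →₀ ℕ).multinomial : ℝ) * c α)

/-- The squared Weyl-Bombieri norm `∑_{|α| = k} |coeff_α p|² / (k! / (α₁! ⋯ αₙ!))` of a
homogeneous polynomial `p` of degree `k`. -/
def weylSq {n : ℕ} (k : ℕ) (p : MvPolynomial (Fin n) ℝ) : ℝ :=
  ∑ α : MultiIndex n k, p.coeff (α : Fin n →₀ ℕ) ^ 2 / ((α : Fin n →₀ ℕ).multinomial : ℝ)

/-- The Weyl-Bombieri norm of a system `P = (p₁, …, pₘ)` of homogeneous polynomials of degrees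
`deg 1, …, deg m`. -/
def weylNorm {n m : ℕ} (deg : Fin m → ℕ) (P : Fin m → MvPolynomial (Fin n) ℝ) : ℝ :=
  √(∑ i, weylSq (deg i) (P i))

/-- The value `P(x) = (p₁(x), …, pₘ(x))`. -/
def evalSystem {n m : ℕ} (P : Fin m → MvPolynomial (Fin n) ℝ) (x : EuclideanSpace ℝ (Fin n)) :
    EuclideanSpace ℝ (Fin m) :=
  WithLp.toLp 2 fun i => MvPolynomial.eval (fun j => x j) (P i)

/-- The `m × n` Jacobian matrix `DP(x)`. -/
def jacobian {n m : ℕ} (P : Fin m → MvPolynomial (Fin n) ℝ) (x : EuclideanSpace ℝ (Fin n)) :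
    Matrix (Fin m) (Fin n) ℝ :=
  Matrix.of fun i j => MvPolynomial.eval (fun l => x l) (MvPolynomial.pderiv j (P i))

/-- `Δₘ`, the diagonal matrix with diagonal entries `√(deg 1), …, √(deg m)`. -/
def degMatrix {m : ℕ} (deg : Fin m → ℕ) : Matrix (Fin m) (Fin m) ℝ :=
  Matrix.diagonal fun i => √(deg i : ℝ)

/-- The linear map `Δₘ⁻¹ DP(x)` restricted to `T_x Sⁿ⁻¹`, where the tangent space of the unit
sphere at `x` is the orthogonal complement of `x`, with the induced inner product. -/
def scaledTangentDeriv {n m : ℕ} (deg : Fin m → ℕ) (P : Fin m → MvPolynomial (Fin n) ℝ)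
    (x : EuclideanSpace ℝ (Fin n)) : ↥((ℝ ∙ x)ᗮ) →ₗ[ℝ] EuclideanSpace ℝ (Fin m) :=
  (Matrix.toEuclideanLin ((degMatrix deg)⁻¹ * jacobian P x)).comp ((ℝ ∙ x)ᗮ).subtype

/-- The smallest singular value of a linear map `T` on `E`, i.e. the least of the `dim E` square
roots of the eigenvalues of `T† T` (Mathlib lists them in decreasing order, starting at index 0). -/
def minSingularValue {E F : Type*} [NormedAddCommGroup E] [InnerProductSpace ℝ E]
    [FiniteDimensional ℝ E] [NormedAddCommGroup F] [InnerProductSpace ℝ F]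
    [FiniteDimensional ℝ F] (T : E →ₗ[ℝ] F) : ℝ :=
  T.singularValues (Module.finrank ℝ E - 1)

/-- `L(P, x) = √(σ_min(Δₘ⁻¹ DP(x)|_{T_x Sⁿ⁻¹})² + ‖P(x)‖₂²)`. -/
def localL {n m : ℕ} (deg : Fin m → ℕ) (P : Fin m → MvPolynomial (Fin n) ℝ)
    (x : EuclideanSpace ℝ (Fin n)) : ℝ :=
  √(minSingularValue (scaledTangentDeriv deg P x) ^ 2 + ‖evalSystem P x‖ ^ 2)

/-- The local condition number `‖P‖_W / L(P, x)`, which is `∞` where `L(P, x) = 0`. -/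
def localKappa {n m : ℕ} (deg : Fin m → ℕ) (P : Fin m → MvPolynomial (Fin n) ℝ)
    (x : EuclideanSpace ℝ (Fin n)) : ℝ≥0∞ :=
  if localL deg P x = 0 then ∞ else ENNReal.ofReal (weylNorm deg P / localL deg P x)

/-- The global condition number: the supremum of the local one over the unit sphere. -/
def kappa {n m : ℕ} (deg : Fin m → ℕ) (P : Fin m → MvPolynomial (Fin n) ℝ) : ℝ≥0∞ :=
  ⨆ x ∈ Metric.sphere (0 : EuclideanSpace ℝ (Fin n)) 1, localKappa deg P x

/-- The Sub-Gaussian assumption with constant `K` for a random vector `X` in `ℝ^ι`. -/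
def SubGaussianWith {Ω ι : Type*} [MeasurableSpace Ω] [Fintype ι] (μ : Measure Ω)
    (X : Ω → EuclideanSpace ℝ ι) (K : ℝ) : Prop :=
  ∀ θ : EuclideanSpace ℝ ι, ‖θ‖ = 1 → ∀ t : ℝ, 0 < t →
    μ.real {ω | t ≤ |inner ℝ (X ω) θ|} ≤ 2 * Real.exp (-t ^ 2 / K ^ 2)

/-- The Small Ball assumption with constant `c₀` for a random vector `X` in `ℝ^ι`. -/
def SmallBallWith {Ω ι : Type*} [MeasurableSpace Ω] [Fintype ι] (μ : Measure Ω)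
    (X : Ω → EuclideanSpace ℝ ι) (c₀ : ℝ) : Prop :=
  ∀ a : EuclideanSpace ℝ ι, a ≠ 0 → ∀ ε : ℝ, 0 < ε →
    μ.real {ω | |inner ℝ a (X ω)| ≤ ε * ‖a‖} ≤ c₀ * ε

end RandomSystem

end

/-
If `κ̃(P) ≥ t M`, then either `‖P‖_W` is large, or `‖P‖` exceeds some `γ` on the sphere, or `P` is
nearly singular: there are orthonormal `x`, `y` with `‖P(x)‖ ≤ ρ² γ` and `‖DP(x) y‖ ≤ d ρ² γ`.

The first two events are unlikely by the exponential moments of sub-Gaussian vectors. The maximum of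
`‖P‖` over the sphere is handled by averaging instead of a net: by Bernstein's inequality on great
circles, `‖P‖` stays at least half as large as its maximum on a box of side about `1 / d` around a
maximizer.

If `P` is nearly singular at `x`, `y` and bounded by `γ` on the sphere, then Bernstein's inequality
also gives `‖P‖ ≤ 4 ρ² γ` on a whole box around `x`, with side about `ρ / d` in the direction `y`
and `ρ² / d` in the remaining `n - 2` tangent directions, so of volume about `ρ ^ (2 n - 3)`. At a
fixed point this bound has probability at most `(c ρ² γ / √(n - 1)) ^ (n - 1)` by the small ball
assumption. Markov's inequality for the average over the box leaves a single factor `ρ`, and the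
choice `ρ ~ t ^ (-1 / 2)` gives the tail bound. Moments follow by integrating the tail, and the
logarithm by `log y ≤ (y ^ q - 1) / q`.
-/

namespace RandomSystem

/-- The Bernstein class: entire functions of exponential type at most `d` along the imaginary
direction which are bounded by `Γ` on the real line. -/
structure BernsteinClass (d Γ : ℝ) (f : ℂ → ℂ) : Prop where
  differentiable : Differentiable ℂ f
  exists_norm_le : ∃ A : ℝ, ∀ ζ, ‖f ζ‖ ≤ A * Real.exp (d * |ζ.im|)
  norm_ofReal_le : ∀ t : ℝ, ‖f t‖ ≤ Γ

namespace BernsteinClass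

variable {d Γ : ℝ} {f : ℂ → ℂ}

lemma bound_nonneg (hf : BernsteinClass d Γ f) : 0 ≤ Γ :=
  (norm_nonneg _).trans (hf.norm_ofReal_le 0)

lemma comp_neg (hf : BernsteinClass d Γ f) : BernsteinClass d Γ fun ζ => f (-ζ) where
  differentiable := hf.differentiable.comp differentiable_neg
  exists_norm_le := by
    obtain ⟨A, hA⟩ := hf.exists_norm_le
    exact ⟨A, fun ζ => by simpa using hA (-ζ)⟩
  norm_ofReal_le t := by simpa using hf.norm_ofReal_le (-t)

-- Phragmén-Lindelöf in the right half plane, applied to `f (I w) exp (-d w)`.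
lemma norm_I_mul_le (hf : BernsteinClass d Γ f) {z : ℂ} (hz : 0 ≤ z.re) :
    ‖f (Complex.I * z)‖ ≤ Γ * Real.exp (d * z.re) := by
  obtain ⟨A, hA⟩ := hf.exists_norm_le
  have hnorm (w : ℂ) : ‖f (Complex.I * w) * Complex.exp (-d * w)‖
      = ‖f (Complex.I * w)‖ / Real.exp (d * w.re) := by
    have hre : (-(d : ℂ) * w).re = -(d * w.re) := by simp
    rw [norm_mul, Complex.norm_exp, hre, Real.exp_neg, div_eq_mul_inv]
  have hbdd (w : ℂ) (hw : 0 ≤ w.re) : ‖f (Complex.I * w) * Complex.exp (-d * w)‖ ≤ A := by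
    rw [hnorm, div_le_iff₀ (Real.exp_pos _)]
    simpa [abs_of_nonneg hw] using hA (Complex.I * w)
  have hPL := PhragmenLindelof.right_half_plane_of_bounded_on_real (C := Γ)
    (f := fun w => f (Complex.I * w) * Complex.exp (-d * w)) ?_ ⟨0, by norm_num, 0, ?_⟩ ?_ ?_ hz
  · rwa [hnorm, div_le_iff₀ (Real.exp_pos _)] at hPL
  · have := hf.differentiable
    exact Differentiable.diffContOnCl (by fun_prop)
  · refine Asymptotics.IsBigO.of_bound A (Filter.mem_inf_of_right fun w hw => ?_)
    simpa using hbdd w (le_of_lt hw)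
  · refine ⟨A, Filter.eventually_map.2 ?_⟩
    filter_upwards [Filter.eventually_ge_atTop 0] with x hx
    exact hbdd x (by simpa using hx)
  · intro x
    have hreal : Complex.I * ((x : ℂ) * Complex.I) = ((-x : ℝ) : ℂ) := by
      push_cast
      linear_combination (x : ℂ) * Complex.I_mul_I
    rw [hnorm, hreal]
    simpa using hf.norm_ofReal_le (-x)

lemma norm_le (hf : BernsteinClass d Γ f) (ζ : ℂ) : ‖f ζ‖ ≤ Γ * Real.exp (d * |ζ.im|) := by
  rcases le_total 0 ζ.im with h | h
  · have hI : Complex.I * (-Complex.I * ζ) = ζ := by linear_combination (-ζ) * Complex.I_mul_I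
    have hbound := hf.norm_I_mul_le (z := -Complex.I * ζ) (by simpa using h)
    rw [hI] at hbound
    simpa [abs_of_nonneg h] using hbound
  · have hI : -(Complex.I * (Complex.I * ζ)) = ζ := by
      linear_combination (-ζ) * Complex.I_mul_I
    have hbound := hf.comp_neg.norm_I_mul_le (z := Complex.I * ζ) (by simpa using h)
    rw [hI] at hbound
    simpa [abs_of_nonpos h] using hbound

/- Bernstein's inequality up to the factor `e`: Cauchy's estimate on circles of radius `1 / d`
changes the bound of `norm_le` by no more than `d e`. -/
protected lemma deriv (hd : 0 < d) (hf : BernsteinClass d Γ f) :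
    BernsteinClass d (Real.exp 1 * d * Γ) (deriv f) := by
  have hbound (ζ : ℂ) : ‖deriv f ζ‖ ≤ Real.exp 1 * d * Γ * Real.exp (d * |ζ.im|) := by
    have hcircle (w : ℂ) (hw : w ∈ Metric.sphere ζ (1 / d)) :
        ‖f w‖ ≤ Γ * Real.exp (d * |ζ.im| + 1) := by
      have him : |w.im| ≤ |ζ.im| + 1 / d :=
        calc |w.im| = |ζ.im + (w - ζ).im| := by simp
          _ ≤ |ζ.im| + ‖w - ζ‖ := (abs_add_le _ _).trans (by gcongr; exact Complex.abs_im_le_norm _)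
          _ = |ζ.im| + 1 / d := by rw [mem_sphere_iff_norm.1 hw]
      refine (hf.norm_le w).trans (mul_le_mul_of_nonneg_left ?_ hf.bound_nonneg)
      calc Real.exp (d * |w.im|) ≤ Real.exp (d * (|ζ.im| + 1 / d)) := by gcongr
        _ = Real.exp (d * |ζ.im| + 1) := by rw [mul_add, mul_one_div_cancel hd.ne']
    refine (Complex.norm_deriv_le_of_forall_mem_sphere_norm_le (by positivity)
      hf.differentiable.diffContOnCl hcircle).trans_eq ?_
    rw [Real.exp_add]
    field_simp
  exact ⟨(hf.differentiable.contDiff (n := 2)).differentiable_deriv_two, ⟨_, hbound⟩,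
    fun t => by simpa using hbound t⟩

lemma norm_sub_le (hd : 0 < d) (hf : BernsteinClass d Γ f) (t : ℝ) :
    ‖f t - f 0‖ ≤ Real.exp 1 * d * Γ * |t| := by
  have h := convex_univ.norm_image_sub_le_of_norm_hasDerivWithin_le
    (fun (s : ℝ) _ => (hf.differentiable s).hasDerivAt.comp_ofReal.hasDerivWithinAt)
    (fun s _ => (hf.deriv hd).norm_ofReal_le s) (Set.mem_univ 0) (Set.mem_univ t)
  simpa using h

lemma norm_sub_sub_le (hd : 0 < d) (hf : BernsteinClass d Γ f) (t : ℝ) :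
    ‖f t - f 0 - t * deriv f 0‖ ≤ (Real.exp 1 * d) ^ 2 * Γ * t ^ 2 := by
  have hderiv (s : ℝ) :
      HasDerivAt (fun s : ℝ => f s - s * deriv f 0) (deriv f s - deriv f 0) s := by
    simpa using (hf.differentiable s).hasDerivAt.comp_ofReal.fun_sub
      ((hasDerivAt_id (s : ℂ)).comp_ofReal.mul_const (deriv f 0))
  have hnorm (s : ℝ) (hs : s ∈ Set.uIcc 0 t) :
      ‖deriv f s - deriv f 0‖ ≤ (Real.exp 1 * d) ^ 2 * Γ * |t| := by
    have hst : |s| ≤ |t| := by simpa using Set.abs_sub_left_of_mem_uIcc hs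
    have := hf.bound_nonneg
    calc ‖deriv f s - deriv f 0‖ ≤ Real.exp 1 * d * (Real.exp 1 * d * Γ) * |s| :=
          (hf.deriv hd).norm_sub_le hd s
      _ ≤ Real.exp 1 * d * (Real.exp 1 * d * Γ) * |t| := by gcongr
      _ = (Real.exp 1 * d) ^ 2 * Γ * |t| := by ring
  have h := (convex_uIcc 0 t).norm_image_sub_le_of_norm_hasDerivWithin_le
    (fun s _ => (hderiv s).hasDerivWithinAt) hnorm Set.left_mem_uIcc Set.right_mem_uIcc
  calc ‖f t - f 0 - t * deriv f 0‖
      = ‖f t - t * deriv f 0 - (f (0 : ℝ) - (0 : ℝ) * deriv f 0)‖ := by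
        congr 1; push_cast; ring
    _ ≤ (Real.exp 1 * d) ^ 2 * Γ * |t| * ‖t - 0‖ := h
    _ = (Real.exp 1 * d) ^ 2 * Γ * t ^ 2 := by
        rw [sub_zero, Real.norm_eq_abs, mul_assoc _ |t|, abs_mul_abs_self, sq t]

end BernsteinClass

section SingularValue

variable {E F : Type*} [NormedAddCommGroup E] [InnerProductSpace ℝ E]
  [FiniteDimensional ℝ E] [NormedAddCommGroup F] [InnerProductSpace ℝ F]
  [FiniteDimensional ℝ F]

lemma norm_sq_apply_eq_sum_sq_singularValues (T : E →ₗ[ℝ] F) (y : E) :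
    ‖T y‖ ^ 2 = ∑ i : Fin (Module.finrank ℝ E), T.singularValues i ^ 2 *
      (T.isSymmetric_adjoint_comp_self.eigenvectorBasis rfl).repr y i ^ 2 := by
  have hS := T.isSymmetric_adjoint_comp_self
  calc ‖T y‖ ^ 2 = inner ℝ y ((LinearMap.adjoint T ∘ₗ T) y) := by
        rw [LinearMap.comp_apply, LinearMap.adjoint_inner_right, real_inner_self_eq_norm_sq]
    _ = _ := by
        rw [← (hS.eigenvectorBasis rfl).repr.inner_map_map, PiLp.inner_apply]
        refine Finset.sum_congr rfl fun i _ => ?_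
        rw [hS.eigenvectorBasis_apply_self_apply, T.sq_singularValues_fin rfl i]
        simp only [RCLike.inner_apply, conj_trivial, RCLike.ofReal_real_eq_id, id_eq]
        ring

lemma minSingularValue_nonneg (T : E →ₗ[ℝ] F) : 0 ≤ minSingularValue T :=
  T.singularValues_nonneg _

lemma minSingularValue_mul_norm_le (T : E →ₗ[ℝ] F) (y : E) :
    minSingularValue T * ‖y‖ ≤ ‖T y‖ := by
  refine le_of_sq_le_sq ?_ (norm_nonneg _)
  rw [mul_pow, ← (T.isSymmetric_adjoint_comp_self.eigenvectorBasis rfl).repr.norm_map y,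
    EuclideanSpace.real_norm_sq_eq, Finset.mul_sum, norm_sq_apply_eq_sum_sq_singularValues]
  refine Finset.sum_le_sum fun i _ => mul_le_mul_of_nonneg_right ?_ (sq_nonneg _)
  exact pow_le_pow_left₀ (minSingularValue_nonneg T)
    (T.singularValues_antitone (by have := i.2; omega)) 2

lemma exists_norm_eq_minSingularValue [Nontrivial E] (T : E →ₗ[ℝ] F) :
    ∃ y : E, ‖y‖ = 1 ∧ ‖T y‖ = minSingularValue T := by
  have hE : 0 < Module.finrank ℝ E := Module.finrank_pos
  let b := T.isSymmetric_adjoint_comp_self.eigenvectorBasis rfl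
  let i : Fin (Module.finrank ℝ E) := ⟨Module.finrank ℝ E - 1, by omega⟩
  refine ⟨b i, b.orthonormal.1 i, ?_⟩
  rw [← sq_eq_sq₀ (norm_nonneg _) (minSingularValue_nonneg T),
    norm_sq_apply_eq_sum_sq_singularValues, Finset.sum_eq_single i]
  · simp [b, i, minSingularValue]
  · intro j _ hj
    simp [b, hj]
  · simp

end SingularValue

section InnerProductSpace

variable {E : Type*} [NormedAddCommGroup E] [InnerProductSpace ℝ E] {x y : E}

lemma norm_le_of_forall_abs_inner_le {v : E} {B : ℝ} (hB : 0 ≤ B)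
    (h : ∀ u : E, ‖u‖ = 1 → |inner ℝ u v| ≤ B) : ‖v‖ ≤ B := by
  by_cases hv : v = 0
  · simpa [hv] using hB
  · have hn : ‖v‖ ≠ 0 := norm_ne_zero_iff.2 hv
    have hinner : inner ℝ (‖v‖⁻¹ • v) v = ‖v‖ := by
      rw [real_inner_smul_left, real_inner_self_eq_norm_sq, sq, inv_mul_cancel_left₀ hn]
    simpa [hinner] using h (‖v‖⁻¹ • v) (norm_smul_inv_norm (𝕜 := ℝ) hv)

lemma norm_cos_smul_add_sin_smul (hx : ‖x‖ = 1) (hy : ‖y‖ = 1) (hxy : inner ℝ x y = 0) (t : ℝ) :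
    ‖Real.cos t • x + Real.sin t • y‖ = 1 := by
  have h : ‖Real.cos t • x + Real.sin t • y‖ ^ 2 = 1 := by
    rw [norm_add_sq_real, inner_smul_left, inner_smul_right, hxy, norm_smul, norm_smul, hx, hy]
    simp [Real.cos_sq_add_sin_sq]
  exact (pow_eq_one_iff_of_nonneg (norm_nonneg _) two_ne_zero).1 h

lemma norm_add_smul_eq_sqrt (hx : ‖x‖ = 1) (hy : ‖y‖ = 1) (hxy : inner ℝ x y = 0) (b : ℝ) :
    ‖x + b • y‖ = √(1 + b ^ 2) := by
  rw [eq_comm, Real.sqrt_eq_iff_mul_self_eq (by positivity) (norm_nonneg _), ← sq,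
    norm_add_sq_real, inner_smul_right, hxy, norm_smul, hx, hy]
  simp

lemma inv_norm_smul_add_smul (hx : ‖x‖ = 1) (hy : ‖y‖ = 1) (hxy : inner ℝ x y = 0) (b : ℝ) :
    ‖x + b • y‖⁻¹ • (x + b • y)
      = Real.cos (Real.arctan b) • x + Real.sin (Real.arctan b) • y := by
  rw [norm_add_smul_eq_sqrt hx hy hxy, Real.cos_arctan, Real.sin_arctan, smul_add, smul_smul,
    one_div, div_eq_inv_mul]

lemma inv_norm_smul_smul {a : ℝ} (ha : 0 < a) (w : E) : ‖a • w‖⁻¹ • (a • w) = ‖w‖⁻¹ • w := by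
  rw [norm_smul, Real.norm_of_nonneg ha.le, smul_smul]
  congr 1
  field_simp

end InnerProductSpace

section Trigonometry

lemma abs_arctan_le (b : ℝ) : |Real.arctan b| ≤ |b| := by
  have hnonneg (s : ℝ) (hs : 0 ≤ s) : |Real.arctan s| ≤ |s| := by
    have h0 : 0 ≤ Real.arctan s := Real.arctan_nonneg.2 hs
    rw [abs_of_nonneg h0, abs_of_nonneg hs]
    exact (Real.le_tan h0 (Real.arctan_lt_pi_div_two s)).trans_eq (Real.tan_arctan s)
  rcases le_total 0 b with hb | hb
  · exact hnonneg b hb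
  · simpa [Real.arctan_neg] using hnonneg (-b) (by linarith)

lemma norm_exp_mul_I_le (ζ : ℂ) : ‖Complex.exp (ζ * Complex.I)‖ ≤ Real.exp |ζ.im| := by
  rw [Complex.norm_exp]
  simpa using neg_le_abs ζ.im

lemma norm_cos_le_exp (ζ : ℂ) : ‖Complex.cos ζ‖ ≤ Real.exp |ζ.im| := by
  have hneg : ‖Complex.exp (-ζ * Complex.I)‖ ≤ Real.exp |ζ.im| := by
    simpa using norm_exp_mul_I_le (-ζ)
  have hadd := norm_add_le (Complex.exp (ζ * Complex.I)) (Complex.exp (-ζ * Complex.I))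
  rw [Complex.cos, norm_div, Complex.norm_ofNat]
  linarith [norm_exp_mul_I_le ζ]

lemma norm_sin_le_exp (ζ : ℂ) : ‖Complex.sin ζ‖ ≤ Real.exp |ζ.im| := by
  have hneg : ‖Complex.exp (-ζ * Complex.I)‖ ≤ Real.exp |ζ.im| := by
    simpa using norm_exp_mul_I_le (-ζ)
  have hsub := norm_sub_le (Complex.exp (-ζ * Complex.I)) (Complex.exp (ζ * Complex.I))
  rw [Complex.sin, norm_div, norm_mul, Complex.norm_I, Complex.norm_ofNat]
  linarith [norm_exp_mul_I_le ζ]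

end Trigonometry

section GreatCircle

variable {σ : Type*}

/-- The holomorphic extension to `ℂ` of the great circle `t ↦ cos t • x + sin t • y`. -/
noncomputable def greatCircle (x y : σ → ℝ) (ζ : ℂ) : σ → ℂ :=
  fun j => Complex.cos ζ * x j + Complex.sin ζ * y j

lemma norm_greatCircle_le (x y : σ → ℝ) (ζ : ℂ) (j : σ) :
    ‖greatCircle x y ζ j‖ ≤ Real.exp |ζ.im| * (|x j| + |y j|) := by
  refine (norm_add_le _ _).trans ?_
  rw [norm_mul, norm_mul, Complex.norm_real, Complex.norm_real, mul_add]
  exact add_le_add (mul_le_mul_of_nonneg_right (norm_cos_le_exp ζ) (abs_nonneg _))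
    (mul_le_mul_of_nonneg_right (norm_sin_le_exp ζ) (abs_nonneg _))

lemma hasDerivAt_greatCircle (x y : σ → ℝ) (ζ : ℂ) (j : σ) :
    HasDerivAt (fun ζ => greatCircle x y ζ j)
      (-Complex.sin ζ * x j + Complex.cos ζ * y j) ζ :=
  ((Complex.hasDerivAt_cos ζ).mul_const _).add ((Complex.hasDerivAt_sin ζ).mul_const _)

lemma aeval_ofReal (p : MvPolynomial σ ℝ) (x : σ → ℝ) :
    MvPolynomial.aeval (fun j => (x j : ℂ)) p = ((MvPolynomial.eval x p : ℝ) : ℂ) := by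
  rw [← MvPolynomial.coe_aeval_eq_eval]
  exact MvPolynomial.aeval_algebraMap_apply ℂ x p

lemma aeval_greatCircle_ofReal (p : MvPolynomial σ ℝ) (x y : σ → ℝ) (t : ℝ) :
    MvPolynomial.aeval (greatCircle x y t) p
      = ((MvPolynomial.eval (Real.cos t • x + Real.sin t • y) p : ℝ) : ℂ) := by
  rw [← aeval_ofReal]
  congr 2
  funext j
  simp [greatCircle]

section Fintype

variable [Fintype σ]

lemma hasDerivAt_aeval (p : MvPolynomial σ ℝ) {g : σ → ℂ → ℂ} {g' : σ → ℂ} {ζ : ℂ}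
    (hg : ∀ j, HasDerivAt (g j) (g' j) ζ) :
    HasDerivAt (fun z => MvPolynomial.aeval (fun j => g j z) p)
      (∑ j, MvPolynomial.aeval (fun j => g j ζ) (MvPolynomial.pderiv j p) * g' j) ζ := by
  classical
  induction p using MvPolynomial.induction_on with
  | C a => simpa using hasDerivAt_const ζ (a : ℂ)
  | add p q hp hq =>
    simp only [map_add, add_mul, Finset.sum_add_distrib]
    exact hp.add hq
  | mul_X p i hp =>
    simp only [map_mul, MvPolynomial.aeval_X]
    refine (hp.mul (hg i)).congr_deriv ?_
    simp only [Derivation.leibniz, MvPolynomial.pderiv_X, smul_eq_mul, map_add, map_mul,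
      MvPolynomial.aeval_X, add_mul, Finset.sum_add_distrib, Finset.sum_mul]
    rw [add_comm]
    congr 1
    · rw [Finset.sum_eq_single i (fun j _ hj => by simp [hj.symm]) (by simp)]
      simp
    · exact Finset.sum_congr rfl fun j _ => by ring

lemma deriv_aeval_greatCircle_zero (p : MvPolynomial σ ℝ) (x y : σ → ℝ) :
    deriv (fun ζ => MvPolynomial.aeval (greatCircle x y ζ) p) 0
      = ((∑ j, MvPolynomial.eval x (MvPolynomial.pderiv j p) * y j : ℝ) : ℂ) := by
  rw [(hasDerivAt_aeval p (hasDerivAt_greatCircle x y 0)).deriv]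
  push_cast
  refine Finset.sum_congr rfl fun j _ => ?_
  rw [← aeval_ofReal]
  simp [greatCircle]

end Fintype

lemma exists_norm_aeval_le [Finite σ] (p : MvPolynomial σ ℝ) {d : ℕ} (hp : p.totalDegree ≤ d)
    (r : σ → ℝ) :
    ∃ A : ℝ, ∀ (z : σ → ℂ) (s : ℝ), 1 ≤ s → (∀ j, ‖z j‖ ≤ s * r j) →
      ‖MvPolynomial.aeval z p‖ ≤ A * s ^ d := by
  have := Fintype.ofFinite σ
  refine ⟨∑ α ∈ p.support, |p.coeff α| * ∏ j, |r j| ^ α j, fun z s hs hz => ?_⟩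
  rw [MvPolynomial.aeval_def, MvPolynomial.eval₂_eq', Finset.sum_mul]
  refine (norm_sum_le _ _).trans (Finset.sum_le_sum fun α hα => ?_)
  have hdeg : ∑ j, α j ≤ d := by
    rw [← Finsupp.sum_fintype α (fun _ a => a) fun _ => rfl]
    exact (MvPolynomial.le_totalDegree hα).trans hp
  rw [norm_mul, norm_algebraMap', Real.norm_eq_abs, norm_prod, mul_assoc]
  refine mul_le_mul_of_nonneg_left ?_ (abs_nonneg _)
  calc ∏ j, ‖z j ^ α j‖ ≤ ∏ j, (s * |r j|) ^ α j := by
        refine Finset.prod_le_prod (fun j _ => norm_nonneg _) fun j _ => ?_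
        rw [norm_pow]
        have := (hz j).trans (mul_le_mul_of_nonneg_left (le_abs_self (r j)) (by linarith))
        gcongr
    _ = (∏ j, |r j| ^ α j) * s ^ ∑ j, α j := by
        simp only [mul_pow, Finset.prod_mul_distrib, Finset.prod_pow_eq_pow_sum]
        ring
    _ ≤ (∏ j, |r j| ^ α j) * s ^ d := by gcongr

lemma bernsteinClass_aeval_greatCircle [Finite σ] {p : MvPolynomial σ ℝ} {d : ℕ}
    (hp : p.totalDegree ≤ d)
    {x y : σ → ℝ} {Γ : ℝ}
    (hΓ : ∀ t : ℝ, |MvPolynomial.eval (Real.cos t • x + Real.sin t • y) p| ≤ Γ) :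
    BernsteinClass d Γ fun ζ => MvPolynomial.aeval (greatCircle x y ζ) p where
  differentiable ζ :=
    have := Fintype.ofFinite σ
    (hasDerivAt_aeval p (hasDerivAt_greatCircle x y ζ)).differentiableAt
  exists_norm_le := by
    obtain ⟨A, hA⟩ := exists_norm_aeval_le p hp fun j => |x j| + |y j|
    refine ⟨A, fun ζ => ?_⟩
    rw [Real.exp_nat_mul]
    exact hA _ _ (Real.one_le_exp (abs_nonneg _)) (norm_greatCircle_le x y ζ)
  norm_ofReal_le t := by
    rw [aeval_greatCircle_ofReal, Complex.norm_real]
    exact hΓ t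

end GreatCircle

section SphereBound

variable {n m d : ℕ} {P : Fin m → MvPolynomial (Fin n) ℝ} {Γ : ℝ}
  {x y : EuclideanSpace ℝ (Fin n)}

/-- The constant `Γ` bounds `‖P‖₂` on the unit sphere. -/
def IsSphereBound (P : Fin m → MvPolynomial (Fin n) ℝ) (Γ : ℝ) : Prop :=
  ∀ v : EuclideanSpace ℝ (Fin n), ‖v‖ = 1 → ‖evalSystem P v‖ ≤ Γ

/-- The directional derivative `DP(x) y`. -/
noncomputable def dirDeriv (P : Fin m → MvPolynomial (Fin n) ℝ) (x y : EuclideanSpace ℝ (Fin n)) :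
    EuclideanSpace ℝ (Fin m) :=
  WithLp.toLp 2 fun i => ∑ j, MvPolynomial.eval (fun l => x l) (MvPolynomial.pderiv j (P i)) * y j

/-- The polynomial `⟨u, P(x)⟩`, by which bounds for systems reduce to single polynomials. -/
noncomputable def pairing (u : EuclideanSpace ℝ (Fin m)) (P : Fin m → MvPolynomial (Fin n) ℝ) :
    MvPolynomial (Fin n) ℝ :=
  ∑ i, MvPolynomial.C (u i) * P i

lemma totalDegree_pairing_le (hP : ∀ i, (P i).totalDegree ≤ d) (u : EuclideanSpace ℝ (Fin m)) :
    (pairing u P).totalDegree ≤ d := by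
  refine MvPolynomial.totalDegree_finsetSum_le fun i _ => ?_
  refine (MvPolynomial.totalDegree_mul _ _).trans ?_
  rw [MvPolynomial.totalDegree_C, zero_add]
  exact hP i

lemma eval_pairing (u : EuclideanSpace ℝ (Fin m)) (P : Fin m → MvPolynomial (Fin n) ℝ)
    (x : EuclideanSpace ℝ (Fin n)) :
    MvPolynomial.eval (fun j => x j) (pairing u P) = inner ℝ u (evalSystem P x) := by
  simp [pairing, evalSystem, PiLp.inner_apply, mul_comm]

lemma sum_eval_pderiv_pairing (u : EuclideanSpace ℝ (Fin m)) (P : Fin m → MvPolynomial (Fin n) ℝ)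
    (x y : EuclideanSpace ℝ (Fin n)) :
    ∑ j, MvPolynomial.eval (fun l => x l) (MvPolynomial.pderiv j (pairing u P)) * y j
      = inner ℝ u (dirDeriv P x y) := by
  simp only [pairing, map_sum, MvPolynomial.pderiv_C_mul, map_mul, MvPolynomial.eval_C, dirDeriv,
    PiLp.inner_apply, RCLike.inner_apply, conj_trivial, Finset.sum_mul]
  rw [Finset.sum_comm]
  exact Finset.sum_congr rfl fun i _ => Finset.sum_congr rfl fun j _ => by ring

lemma aeval_greatCircle_pairing (u : EuclideanSpace ℝ (Fin m))
    (P : Fin m → MvPolynomial (Fin n) ℝ) (x y : EuclideanSpace ℝ (Fin n)) (t : ℝ) :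
    MvPolynomial.aeval (greatCircle x y t) (pairing u P)
      = ((inner ℝ u (evalSystem P (Real.cos t • x + Real.sin t • y)) : ℝ) : ℂ) := by
  rw [← eval_pairing]
  exact aeval_greatCircle_ofReal _ _ _ _

lemma aeval_greatCircle_zero_pairing (u : EuclideanSpace ℝ (Fin m))
    (P : Fin m → MvPolynomial (Fin n) ℝ) (x y : EuclideanSpace ℝ (Fin n)) :
    MvPolynomial.aeval (greatCircle x y 0) (pairing u P)
      = ((inner ℝ u (evalSystem P x) : ℝ) : ℂ) := by
  simpa using aeval_greatCircle_pairing u P x y 0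

lemma deriv_aeval_greatCircle_pairing_zero (u : EuclideanSpace ℝ (Fin m))
    (P : Fin m → MvPolynomial (Fin n) ℝ) (x y : EuclideanSpace ℝ (Fin n)) :
    deriv (fun ζ => MvPolynomial.aeval (greatCircle x y ζ) (pairing u P)) 0
      = ((inner ℝ u (dirDeriv P x y) : ℝ) : ℂ) := by
  rw [deriv_aeval_greatCircle_zero, sum_eval_pderiv_pairing]

/-- The radially constant extension of `P` from the unit sphere, `w ↦ P(w / ‖w‖)`, through which
averages over the sphere become averages over a ball. -/
noncomputable def sphereEval (P : Fin m → MvPolynomial (Fin n) ℝ)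
    (w : EuclideanSpace ℝ (Fin n)) : EuclideanSpace ℝ (Fin m) :=
  evalSystem P (‖w‖⁻¹ • w)

lemma sphereEval_smul (P : Fin m → MvPolynomial (Fin n) ℝ) {a : ℝ} (ha : 0 < a)
    (w : EuclideanSpace ℝ (Fin n)) : sphereEval P (a • w) = sphereEval P w := by
  rw [sphereEval, inv_norm_smul_smul ha, sphereEval]

namespace IsSphereBound

lemma nonneg (hΓ : IsSphereBound P Γ) (hx : ‖x‖ = 1) : 0 ≤ Γ :=
  (norm_nonneg _).trans (hΓ x hx)

lemma bernsteinClass_pairing (hΓ : IsSphereBound P Γ) (hP : ∀ i, (P i).totalDegree ≤ d)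
    (hx : ‖x‖ = 1) (hy : ‖y‖ = 1) (hxy : inner ℝ x y = 0)
    {u : EuclideanSpace ℝ (Fin m)} (hu : ‖u‖ = 1) :
    BernsteinClass d Γ fun ζ => MvPolynomial.aeval (greatCircle x y ζ) (pairing u P) := by
  refine bernsteinClass_aeval_greatCircle (totalDegree_pairing_le hP u) fun t => ?_
  have hbound : |inner ℝ u (evalSystem P (Real.cos t • x + Real.sin t • y))| ≤ Γ := by
    refine (abs_real_inner_le_norm _ _).trans ?_
    rw [hu, one_mul]
    exact hΓ _ (norm_cos_smul_add_sin_smul hx hy hxy t)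
  rw [← eval_pairing] at hbound
  exact hbound

variable (hΓ : IsSphereBound P Γ) (hP : ∀ i, (P i).totalDegree ≤ d) (hd : 0 < d)
  (hx : ‖x‖ = 1) (hy : ‖y‖ = 1) (hxy : inner ℝ x y = 0)

include hΓ hP hd hx hy hxy

lemma norm_dirDeriv_le : ‖dirDeriv P x y‖ ≤ 3 * d * Γ := by
  have hΓ₀ := hΓ.nonneg hx
  refine norm_le_of_forall_abs_inner_le (by positivity) fun u hu => ?_
  have hderiv := ((hΓ.bernsteinClass_pairing hP hx hy hxy hu).deriv
    (by exact_mod_cast hd)).norm_ofReal_le 0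
  rw [Complex.ofReal_zero, deriv_aeval_greatCircle_pairing_zero, Complex.norm_real] at hderiv
  refine hderiv.trans ?_
  gcongr
  exact Real.exp_one_lt_three.le

lemma norm_evalSystem_sub_le (t : ℝ) :
    ‖evalSystem P (Real.cos t • x + Real.sin t • y) - evalSystem P x‖ ≤ 3 * d * Γ * |t| := by
  have hΓ₀ := hΓ.nonneg hx
  refine norm_le_of_forall_abs_inner_le (by positivity) fun u hu => ?_
  have hsub := (hΓ.bernsteinClass_pairing hP hx hy hxy hu).norm_sub_le (by exact_mod_cast hd) t
  rw [aeval_greatCircle_pairing, aeval_greatCircle_zero_pairing, ← Complex.ofReal_sub,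
    Complex.norm_real, ← inner_sub_right] at hsub
  refine hsub.trans ?_
  gcongr
  exact Real.exp_one_lt_three.le

lemma norm_evalSystem_sub_sub_le (t : ℝ) :
    ‖evalSystem P (Real.cos t • x + Real.sin t • y) - evalSystem P x - t • dirDeriv P x y‖
      ≤ 9 * d ^ 2 * Γ * t ^ 2 := by
  have hΓ₀ := hΓ.nonneg hx
  refine norm_le_of_forall_abs_inner_le (by positivity) fun u hu => ?_
  have hsub := (hΓ.bernsteinClass_pairing hP hx hy hxy hu).norm_sub_sub_le
    (by exact_mod_cast hd) t
  rw [aeval_greatCircle_pairing, aeval_greatCircle_zero_pairing,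
    deriv_aeval_greatCircle_pairing_zero, ← Complex.ofReal_sub, ← Complex.ofReal_mul,
    ← Complex.ofReal_sub, Complex.norm_real, ← inner_sub_right, ← inner_smul_right,
    ← inner_sub_right] at hsub
  calc _ ≤ (Real.exp 1 * d) ^ 2 * Γ * t ^ 2 := hsub
    _ ≤ (3 * d) ^ 2 * Γ * t ^ 2 := by
        gcongr
        exact Real.exp_one_lt_three.le
    _ = 9 * d ^ 2 * Γ * t ^ 2 := by ring

lemma norm_evalSystem_le (t : ℝ) :
    ‖evalSystem P (Real.cos t • x + Real.sin t • y)‖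
      ≤ ‖evalSystem P x‖ + |t| * ‖dirDeriv P x y‖ + 9 * d ^ 2 * Γ * t ^ 2 := by
  have hsub := hΓ.norm_evalSystem_sub_sub_le hP hd hx hy hxy t
  calc ‖evalSystem P (Real.cos t • x + Real.sin t • y)‖
      = ‖evalSystem P x + t • dirDeriv P x y + (evalSystem P (Real.cos t • x + Real.sin t • y)
          - evalSystem P x - t • dirDeriv P x y)‖ := by congr 1; abel
    _ ≤ ‖evalSystem P x‖ + ‖t • dirDeriv P x y‖ + 9 * d ^ 2 * Γ * t ^ 2 :=
        norm_add₃_le.trans (by gcongr)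
    _ = _ := by rw [norm_smul, Real.norm_eq_abs]

omit hy hxy in
lemma norm_sphereEval_add_sub_le {v : EuclideanSpace ℝ (Fin n)} (hv : inner ℝ x v = 0) :
    ‖sphereEval P (x + v) - evalSystem P x‖ ≤ 3 * d * Γ * ‖v‖ := by
  have hΓ₀ := hΓ.nonneg hx
  rcases eq_or_ne v 0 with rfl | hv₀
  · simp [sphereEval, hx]
  have hunit : ‖(‖v‖⁻¹ • v)‖ = 1 := norm_smul_inv_norm (𝕜 := ℝ) hv₀
  have horth : inner ℝ x (‖v‖⁻¹ • v) = 0 := by rw [inner_smul_right, hv, mul_zero]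
  have hv_eq : ‖v‖ • (‖v‖⁻¹ • v) = v := smul_inv_smul₀ (norm_ne_zero_iff.2 hv₀) v
  have hproj := inv_norm_smul_add_smul hx hunit horth ‖v‖
  rw [hv_eq] at hproj
  rw [sphereEval, hproj]
  refine (hΓ.norm_evalSystem_sub_le hP hd hx hunit horth _).trans ?_
  gcongr
  simpa using abs_arctan_le ‖v‖

/-- Normalizing `x + b y + z` amounts to moving first by the angle `arctan b` on the great circle
through `x` and `y`, and then in a direction orthogonal to it. -/
lemma norm_sphereEval_le {z : EuclideanSpace ℝ (Fin n)} (hxz : inner ℝ x z = 0)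
    (hyz : inner ℝ y z = 0) (b : ℝ) :
    ‖sphereEval P (x + b • y + z)‖ ≤ ‖evalSystem P x‖ + |b| * ‖dirDeriv P x y‖
      + 9 * d ^ 2 * Γ * b ^ 2 + 3 * d * Γ * ‖z‖ := by
  have hΓ₀ := hΓ.nonneg hx
  have hproj := inv_norm_smul_add_smul hx hy hxy b
  set r := ‖x + b • y‖ with hr
  have hr₁ : 1 ≤ r := by
    rw [hr, norm_add_smul_eq_sqrt hx hy hxy]
    exact Real.one_le_sqrt.2 (le_add_of_nonneg_right (sq_nonneg b))
  have hr₀ : 0 < r := by linarith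
  set x' := Real.cos (Real.arctan b) • x + Real.sin (Real.arctan b) • y with hx'
  have horth : inner ℝ x' (r⁻¹ • z) = 0 := by
    simp [hx', inner_add_left, inner_smul_left, inner_smul_right, hxz, hyz]
  have hpoint : x + b • y + z = r • (x' + r⁻¹ • z) := by
    rw [← hproj, ← smul_add, smul_inv_smul₀ hr₀.ne']
  have hmove := hΓ.norm_sphereEval_add_sub_le hP hd (norm_cos_smul_add_sin_smul hx hy hxy _) horth
  have hcircle : ‖evalSystem P x'‖
      ≤ ‖evalSystem P x‖ + |b| * ‖dirDeriv P x y‖ + 9 * d ^ 2 * Γ * b ^ 2 := by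
    refine (hΓ.norm_evalSystem_le hP hd hx hy hxy (Real.arctan b)).trans ?_
    have hsq : Real.arctan b ^ 2 ≤ b ^ 2 := sq_le_sq.2 (abs_arctan_le b)
    gcongr _ + ?_ * _ + _ * ?_
    exact abs_arctan_le b
  have hz : ‖r⁻¹ • z‖ ≤ ‖z‖ := by
    rw [norm_smul, norm_inv, Real.norm_of_nonneg hr₀.le]
    exact mul_le_of_le_one_left (norm_nonneg _) (inv_le_one_of_one_le₀ hr₁)
  calc ‖sphereEval P (x + b • y + z)‖ = ‖sphereEval P (x' + r⁻¹ • z)‖ := by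
        rw [hpoint, sphereEval_smul P hr₀]
    _ ≤ ‖evalSystem P x'‖ + 3 * d * Γ * ‖r⁻¹ • z‖ := by
        linarith [norm_sub_norm_le (sphereEval P (x' + r⁻¹ • z)) (evalSystem P x')]
    _ ≤ _ := by gcongr

end IsSphereBound

end SphereBound

section Forms

variable {n k : ℕ}

/-- The vector `(√(k! / α!) x^α)_α` of scaled monomials of degree `k` at `x`. -/
noncomputable def veronese (k : ℕ) (x : EuclideanSpace ℝ (Fin n)) :
    EuclideanSpace ℝ (MultiIndex n k) :=
  WithLp.toLp 2 fun α => √((α : Fin n →₀ ℕ).multinomial : ℝ) * ∏ j, x j ^ (α : Fin n →₀ ℕ) j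

lemma sum_multiIndex (α : MultiIndex n k) : ∑ j, (α : Fin n →₀ ℕ) j = k :=
  (Finset.mem_finsuppAntidiag.1 α.2).1

lemma card_multiIndex : Fintype.card (MultiIndex n k) = (n + k - 1).choose k := by
  rw [Fintype.card_coe, Finset.card_finsuppAntidiag_nat_eq_choose, Finset.card_univ,
    Fintype.card_fin]

lemma eval_formOfCoeffs (c : EuclideanSpace ℝ (MultiIndex n k)) (x : EuclideanSpace ℝ (Fin n)) :
    MvPolynomial.eval (fun j => x j) (formOfCoeffs c) = inner ℝ (veronese k x) c := by
  simp only [formOfCoeffs, map_sum, MvPolynomial.eval_monomial, veronese, PiLp.inner_apply,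
    RCLike.inner_apply, conj_trivial]
  refine Finset.sum_congr rfl fun α _ => ?_
  rw [Finsupp.prod_fintype _ _ (fun _ => pow_zero _)]
  ring

lemma totalDegree_formOfCoeffs_le (c : EuclideanSpace ℝ (MultiIndex n k)) :
    (formOfCoeffs c).totalDegree ≤ k := by
  refine MvPolynomial.totalDegree_finsetSum_le fun α _ =>
    (MvPolynomial.totalDegree_monomial_le _ _).trans_eq ?_
  rw [Finsupp.sum_fintype _ _ (fun _ => rfl)]
  exact sum_multiIndex α

/-- This is the multinomial theorem for `(x₁² + ⋯ + xₙ²)^k`. -/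
lemma norm_veronese (x : EuclideanSpace ℝ (Fin n)) : ‖veronese k x‖ = ‖x‖ ^ k := by
  rw [← sq_eq_sq₀ (norm_nonneg _) (by positivity), ← pow_mul, mul_comm k, pow_mul,
    EuclideanSpace.real_norm_sq_eq, EuclideanSpace.real_norm_sq_eq,
    Finset.sum_pow_eq_sum_piAntidiag]
  refine Finset.sum_bij (fun (α : MultiIndex n k) _ => ((α : Fin n →₀ ℕ) : Fin n → ℕ))
    (fun α _ => by simpa using sum_multiIndex α)
    (fun α _ β _ h => Subtype.ext (DFunLike.coe_injective h))
    (fun f hf => ⟨⟨Finsupp.equivFunOnFinite.symm f, by simpa using hf⟩, by simp, rfl⟩)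
    fun α _ => ?_
  have hmult : (α : Fin n →₀ ℕ).multinomial = Nat.multinomial Finset.univ (α : Fin n →₀ ℕ) :=
    Finsupp.multinomial_eq_of_support_subset (Finset.subset_univ _)
  simp only [veronese, mul_pow, Real.sq_sqrt (Nat.cast_nonneg _), hmult, ← Finset.prod_pow,
    pow_right_comm]

lemma continuous_veronese : Continuous (veronese k : EuclideanSpace ℝ (Fin n) → _) := by
  unfold veronese
  fun_prop

lemma coeff_formOfCoeffs (c : EuclideanSpace ℝ (MultiIndex n k)) (α : MultiIndex n k) :
    (formOfCoeffs c).coeff (α : Fin n →₀ ℕ) = √((α : Fin n →₀ ℕ).multinomial : ℝ) * c α := by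
  rw [formOfCoeffs, MvPolynomial.coeff_sum, Finset.sum_eq_single α]
  · simp
  · intro β _ hβ
    rw [MvPolynomial.coeff_monomial, if_neg fun h => hβ (Subtype.ext h)]
  · simp

lemma weylSq_formOfCoeffs (c : EuclideanSpace ℝ (MultiIndex n k)) :
    weylSq k (formOfCoeffs c) = ‖c‖ ^ 2 := by
  rw [weylSq, EuclideanSpace.real_norm_sq_eq]
  refine Finset.sum_congr rfl fun α _ => ?_
  have hpos : (0 : ℝ) < ((α : Fin n →₀ ℕ).multinomial : ℝ) := by
    exact_mod_cast Nat.multinomial_pos _ _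
  rw [coeff_formOfCoeffs, mul_pow, Real.sq_sqrt hpos.le, mul_div_cancel_left₀ _ hpos.ne']

end Forms

section Systems

variable {n m : ℕ} {deg : Fin m → ℕ}

/-- The coefficient vectors of a system of forms of degrees `deg`. -/
abbrev Coeffs (n : ℕ) {m : ℕ} (deg : Fin m → ℕ) : Type :=
  (i : Fin m) → EuclideanSpace ℝ (MultiIndex n (deg i))

/-- The system of forms with given coefficient vectors. -/
noncomputable abbrev forms (c : Coeffs n deg) : Fin m → MvPolynomial (Fin n) ℝ :=
  fun i => formOfCoeffs (c i)

lemma evalSystem_forms_apply (c : Coeffs n deg) (x : EuclideanSpace ℝ (Fin n)) (i : Fin m) :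
    evalSystem (forms c) x i = inner ℝ (veronese (deg i) x) (c i) :=
  eval_formOfCoeffs _ _

end Systems

section Box

variable {V : Type*} [NormedAddCommGroup V] [InnerProductSpace ℝ V] [FiniteDimensional ℝ V]
  [MeasurableSpace V] [BorelSpace V]

lemma lintegral_gaussian {b : ℝ} (hb : 0 < b) :
    ∫⁻ v : V, ENNReal.ofReal (Real.exp (-b * ‖v‖ ^ 2))
      = ENNReal.ofReal (√(Real.pi / b) ^ Module.finrank ℝ V) := by
  have hint := GaussianFourier.integral_rexp_neg_mul_sq_norm (V := V) hb
  have hpos : (0 : ℝ) < (Real.pi / b) ^ (Module.finrank ℝ V / 2 : ℝ) :=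
    Real.rpow_pos_of_pos (by positivity) _
  rw [← ofReal_integral_eq_lintegral_ofReal, hint]
  · rw [Real.sqrt_eq_rpow, ← Real.rpow_natCast, ← Real.rpow_mul (by positivity)]
    ring_nf
  · exact Integrable.of_integral_ne_zero (hint ▸ hpos.ne')
  · exact Filter.Eventually.of_forall fun v => (Real.exp_pos _).le

/-- On the ball the Gaussian density `exp (-n ‖v‖²)` is at least `exp (-4 n)`. -/
lemma volume_ball_two_le {n : ℕ} (hn : 0 < n) (hV : Module.finrank ℝ V = n) :
    volume (Metric.ball (0 : V) 2)
      ≤ ENNReal.ofReal (Real.exp (4 * n) * √(Real.pi / n) ^ n) := by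
  have hn₀ : (0 : ℝ) < n := by exact_mod_cast hn
  have hgauss := lintegral_gaussian (V := V) hn₀
  rw [hV] at hgauss
  rw [ENNReal.ofReal_mul (Real.exp_pos _).le, ← hgauss,
    ← lintegral_const_mul' _ _ ENNReal.ofReal_ne_top]
  calc volume (Metric.ball (0 : V) 2) = ∫⁻ _ in Metric.ball (0 : V) 2, 1 := by simp
    _ ≤ ∫⁻ v in Metric.ball (0 : V) 2,
          ENNReal.ofReal (Real.exp (4 * n)) * ENNReal.ofReal (Real.exp (-n * ‖v‖ ^ 2)) := by
        refine setLIntegral_mono' measurableSet_ball fun v hv => ?_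
        rw [← ENNReal.ofReal_mul (Real.exp_pos _).le, ← Real.exp_add, ← ENNReal.ofReal_one]
        refine ENNReal.ofReal_le_ofReal (Real.one_le_exp ?_)
        have hv_sq : ‖v‖ ^ 2 ≤ 4 := by
          nlinarith [norm_nonneg v, mem_ball_zero_iff.1 hv]
        nlinarith
    _ ≤ _ := setLIntegral_le_lintegral _ _

variable {k : ℕ}

omit [FiniteDimensional ℝ V] [MeasurableSpace V] [BorelSpace V] in
lemma exists_orthonormalBasis_apply_zero [FiniteDimensional ℝ V]
    (hV : Module.finrank ℝ V = k + 1) {x : V} (hx : ‖x‖ = 1) :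
    ∃ e : OrthonormalBasis (Fin (k + 1)) ℝ V, e 0 = x := by
  have hv : Orthonormal ℝ (({0} : Set (Fin (k + 1))).domRestrict fun _ => x) :=
    ⟨fun _ => hx, fun i j hij => absurd (Subsingleton.elim i j) hij⟩
  obtain ⟨e, he⟩ := hv.exists_orthonormalBasis_extension_of_card_eq (by simpa using hV)
  exact ⟨e, he 0 rfl⟩

omit [FiniteDimensional ℝ V] [MeasurableSpace V] [BorelSpace V] in
lemma exists_orthonormalBasis_pair [FiniteDimensional ℝ V] (hV : Module.finrank ℝ V = k + 2)
    {x y : V} (hx : ‖x‖ = 1) (hy : ‖y‖ = 1) (hxy : inner ℝ x y = 0) :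
    ∃ e : OrthonormalBasis (Fin (k + 2)) ℝ V, e 0 = x ∧ e 1 = y := by
  let v : Fin (k + 2) → V := Fin.cons x fun _ => y
  have hv : Orthonormal ℝ (({0, 1} : Set (Fin (k + 2))).domRestrict v) := by
    refine ⟨?_, ?_⟩
    · rintro ⟨i, rfl | rfl⟩
      · exact hx
      · exact hy
    · rintro ⟨i, rfl | rfl⟩ ⟨j, rfl | rfl⟩ hij
      · exact absurd rfl hij
      · exact hxy
      · exact (real_inner_comm _ _).trans hxy
      · exact absurd rfl hij
  obtain ⟨e, he⟩ := hv.exists_orthonormalBasis_extension_of_card_eq (by simpa using hV)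
  exact ⟨e, he 0 (by simp), he 1 (by simp)⟩

/-- The box of points whose coordinates in the orthonormal basis `e` are about `1` along `e 0`, of
size `β₁` along `e 1` and together of size `β₂` along the remaining `k` vectors. -/
def box (e : OrthonormalBasis (Fin (k + 2)) ℝ V) (β₁ β₂ : ℝ) : Set V :=
  {w | e.repr w 0 ∈ Set.Icc (1 / 2) 1 ∧ |e.repr w 1| ≤ β₁ / 2 ∧
    ∀ j : Fin k, |e.repr w j.succ.succ| ≤ β₂ / (2 * √(k + 2))}

variable (e : OrthonormalBasis (Fin (k + 2)) ℝ V) {β₁ β₂ : ℝ}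

omit [FiniteDimensional ℝ V] in
lemma measurableSet_box : MeasurableSet (box e β₁ β₂) := by
  have hcoord (i : Fin (k + 2)) : Measurable fun w => e.repr w i := by
    simp only [e.repr_apply_apply]
    fun_prop
  refine (hcoord 0 measurableSet_Icc).inter ((measurableSet_le (hcoord 1).abs ?_).inter ?_)
  · exact measurable_const
  · change MeasurableSet {w | ∀ j : Fin k, |e.repr w j.succ.succ| ≤ β₂ / (2 * √(k + 2))}
    rw [Set.ofPred_forall]
    exact MeasurableSet.iInter fun j => measurableSet_le (hcoord j.succ.succ).abs measurable_const

lemma volume_box (hβ₁ : 0 ≤ β₁) (hβ₂ : 0 ≤ β₂) :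
    volume (box e β₁ β₂) = ENNReal.ofReal (1 / 2 * β₁ * (β₂ / √(k + 2)) ^ k) := by
  set r := β₂ / (2 * √(k + 2)) with hr
  let lo : Fin (k + 2) → ℝ := Fin.cons (1 / 2) (Fin.cons (-(β₁ / 2)) fun _ : Fin k => -r)
  let hi : Fin (k + 2) → ℝ := Fin.cons 1 (Fin.cons (β₁ / 2) fun _ : Fin k => r)
  have hpre : box e β₁ β₂ = (fun w => WithLp.ofLp (e.repr w)) ⁻¹' Set.Icc lo hi := by
    ext w
    simp only [box, abs_le, Set.mem_preimage, Set.mem_Icc, Pi.le_def, Fin.forall_fin_succ, lo, hi,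
      Fin.cons_zero, Fin.cons_succ, Set.mem_ofPred_eq, Fin.succ_zero_eq_one, ← hr]
    exact ⟨fun h => ⟨⟨h.1.1, h.2.1.1, fun j => (h.2.2 j).1⟩, h.1.2, h.2.1.2, fun j => (h.2.2 j).2⟩,
      fun h => ⟨⟨h.1.1, h.2.1⟩, ⟨h.1.2.1, h.2.2.1⟩, fun j => ⟨h.1.2.2 j, h.2.2.2 j⟩⟩⟩
  have hpres : MeasurePreserving (fun w => WithLp.ofLp (e.repr w)) volume volume :=
    (PiLp.volume_preserving_ofLp (Fin (k + 2))).comp e.measurePreserving_repr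
  have hr₀ : 0 ≤ r := by positivity
  have hwidth : r - -r = β₂ / √(k + 2) := by rw [hr]; ring
  rw [hpre, hpres.measure_preimage measurableSet_Icc.nullMeasurableSet, Real.volume_Icc_pi,
    ← ENNReal.ofReal_prod_of_nonneg]
  · rw [Fin.prod_univ_succ, Fin.prod_univ_succ]
    simp only [lo, hi, Fin.cons_zero, Fin.cons_succ, Finset.prod_const, Finset.card_univ,
      Fintype.card_fin, hwidth]
    ring_nf
  · refine fun i _ => sub_nonneg.2 (Fin.cases ?_ (Fin.cases ?_ fun i => ?_) i)
    · norm_num [lo, hi]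
    · simp only [lo, hi, Fin.cons_succ, Fin.cons_zero]; linarith
    · simp only [lo, hi, Fin.cons_succ]; linarith

section

omit [FiniteDimensional ℝ V] [MeasurableSpace V] [BorelSpace V]

variable {e} {w : V}

lemma sum_sq_repr_le_of_mem_box (hw : w ∈ box e β₁ β₂) :
    ∑ j : Fin k, e.repr w j.succ.succ ^ 2 ≤ (β₂ / 2) ^ 2 := by
  have hsqrt : √((k : ℝ) + 2) ^ 2 = k + 2 := Real.sq_sqrt (by positivity)
  calc ∑ j : Fin k, e.repr w j.succ.succ ^ 2
      ≤ ∑ _j : Fin k, (β₂ / (2 * √(k + 2))) ^ 2 :=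
        Finset.sum_le_sum fun j _ => sq_le_sq' (abs_le.1 (hw.2.2 j)).1 (abs_le.1 (hw.2.2 j)).2
    _ = k * (β₂ / (2 * √(k + 2))) ^ 2 := by simp
    _ ≤ (k + 2) * (β₂ / (2 * √(k + 2))) ^ 2 := by gcongr; linarith
    _ = (β₂ / 2) ^ 2 := by
        rw [div_pow, mul_pow, hsqrt]
        field_simp

lemma box_subset_ball (hβ₁ : 0 ≤ β₁) (hβ₁' : β₁ ≤ 1) (hβ₂ : 0 ≤ β₂) (hβ₂' : β₂ ≤ 1) :
    box e β₁ β₂ ⊆ Metric.ball 0 2 := by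
  intro w hw
  have hnorm : ‖w‖ ^ 2 = e.repr w 0 ^ 2 + (e.repr w 1 ^ 2 +
      ∑ j : Fin k, e.repr w j.succ.succ ^ 2) := by
    rw [← e.repr.norm_map, EuclideanSpace.real_norm_sq_eq, Fin.sum_univ_succ, Fin.sum_univ_succ,
      Fin.succ_zero_eq_one]
  have hrest := sum_sq_repr_le_of_mem_box hw
  obtain ⟨⟨hlo, hhi⟩, hsnd, -⟩ := hw
  have hsnd_sq : e.repr w 1 ^ 2 ≤ (β₁ / 2) ^ 2 := sq_le_sq' (abs_le.1 hsnd).1 (abs_le.1 hsnd).2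
  rw [mem_ball_zero_iff]
  refine lt_of_pow_lt_pow_left₀ 2 zero_le_two ?_
  nlinarith

lemma exists_eq_smul_of_mem_box (hw : w ∈ box e β₁ β₂) (hβ₂ : 0 ≤ β₂) :
    ∃ (a b : ℝ) (z : V), 0 < a ∧ w = a • (e 0 + b • e 1 + z) ∧ |b| ≤ β₁ ∧ ‖z‖ ≤ β₂ ∧
      inner ℝ (e 0) z = 0 ∧ inner ℝ (e 1) z = 0 := by
  have hrest := sum_sq_repr_le_of_mem_box hw
  obtain ⟨⟨hlo, -⟩, hsnd, -⟩ := hw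
  set a := e.repr w 0
  have ha : 0 < a := by linarith
  set z := ∑ j : Fin k, e.repr w j.succ.succ • e j.succ.succ with hz
  have hw_eq : w = a • e 0 + (e.repr w 1 • e 1 + z) := by
    conv_lhs => rw [← e.sum_repr w]
    rw [Fin.sum_univ_succ, Fin.sum_univ_succ, Fin.succ_zero_eq_one]
  have hz_norm : ‖z‖ ≤ β₂ / 2 := by
    have ho : Orthonormal ℝ (fun j : Fin k => e j.succ.succ) :=
      e.orthonormal.comp _ ((Fin.succ_injective _).comp (Fin.succ_injective _))
    refine le_of_sq_le_sq ?_ (by positivity)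
    rw [← real_inner_self_eq_norm_sq, hz, ho.inner_sum]
    simpa [sq] using hrest
  have horth (i : Fin (k + 2)) (hi : ∀ j : Fin k, i ≠ j.succ.succ) : inner ℝ (e i) z = 0 := by
    rw [hz, inner_sum]
    refine Finset.sum_eq_zero fun j _ => ?_
    rw [inner_smul_right, e.orthonormal.2 (hi j), mul_zero]
  refine ⟨a, e.repr w 1 / a, a⁻¹ • z, ha, ?_, ?_, ?_, ?_, ?_⟩
  · rw [smul_add, smul_add, smul_smul, smul_inv_smul₀ ha.ne', mul_div_cancel₀ _ ha.ne', add_assoc]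
    exact hw_eq
  · rw [abs_div, abs_of_pos ha, div_le_iff₀ ha]
    nlinarith [abs_nonneg (e.repr w 1)]
  · rw [norm_smul, norm_inv, Real.norm_of_nonneg ha.le, inv_mul_le_iff₀ ha]
    nlinarith
  · rw [inner_smul_right, horth 0 fun j => (Fin.succ_ne_zero _).symm, mul_zero]
  · rw [inner_smul_right, horth 1 fun j h => by simpa using congrArg Fin.val h, mul_zero]

end

lemma volume_ball_two_le_mul_volume_box (hβ₁ : 0 < β₁) (hβ₂ : 0 < β₂) :
    volume (Metric.ball (0 : V) 2)
      ≤ ENNReal.ofReal (Real.exp 6 ^ (k + 2) / (β₁ * β₂ ^ k)) * volume (box e β₁ β₂) := by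
  have hfinrank : Module.finrank ℝ V = k + 2 := by
    simpa using Module.finrank_eq_card_basis e.toBasis
  refine (volume_ball_two_le (by omega) hfinrank).trans ?_
  rw [volume_box e hβ₁.le hβ₂.le, ← ENNReal.ofReal_mul (by positivity)]
  refine ENNReal.ofReal_le_ofReal ?_
  push_cast
  set ν : ℝ := (k : ℝ) + 2
  have hν : 2 ≤ ν := by simp [ν]
  have hpi : √Real.pi ≤ Real.exp 1 := by
    rw [Real.sqrt_le_left (Real.exp_pos _).le]
    nlinarith [Real.pi_lt_d2, Real.exp_one_gt_d9]
  have hexp : Real.exp (4 * ν) = Real.exp 4 ^ (k + 2) := by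
    rw [← Real.exp_nat_mul, mul_comm]
    push_cast
    rfl
  have hbase : Real.exp 4 * √Real.pi ≤ Real.exp 6 := by
    calc Real.exp 4 * √Real.pi ≤ Real.exp 4 * Real.exp 1 := by gcongr
      _ = Real.exp 5 := by rw [← Real.exp_add]; norm_num
      _ ≤ Real.exp 6 := Real.exp_le_exp.2 (by norm_num)
  calc Real.exp (4 * ν) * √(Real.pi / ν) ^ (k + 2)
      = (Real.exp 4 * √Real.pi) ^ (k + 2) * (1 / (√ν ^ k * √ν ^ 2)) := by
        rw [hexp, Real.sqrt_div Real.pi_pos.le, div_pow, mul_pow, pow_add √ν]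
        ring
    _ ≤ Real.exp 6 ^ (k + 2) * (1 / (√ν ^ k * 2)) := by
        rw [Real.sq_sqrt (by linarith)]
        gcongr
    _ = _ := by
        rw [div_pow]
        field_simp

end Box

section ExponentialMoments

variable {Ω : Type*} [MeasurableSpace Ω] {μ : Measure Ω}

lemma lintegral_comp_le_tsum {u : Ω → ℝ} (hu : Measurable u) (hu₀ : ∀ ω, 0 ≤ u ω)
    {φ : ℝ → ℝ≥0∞} {b : ℕ → ℝ≥0∞} (hφ : ∀ (k : ℕ) (t : ℝ), k ≤ t → t < k + 1 → φ t ≤ b k) :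
    ∫⁻ ω, φ (u ω) ∂μ ≤ ∑' k : ℕ, b k * μ {ω | k ≤ u ω ∧ u ω < k + 1} := by
  let layer (k : ℕ) : Set Ω := {ω | k ≤ u ω ∧ u ω < k + 1}
  have hlayer (k : ℕ) : MeasurableSet (layer k) :=
    (measurableSet_le measurable_const hu).inter (measurableSet_lt hu measurable_const)
  calc ∫⁻ ω, φ (u ω) ∂μ
      ≤ ∫⁻ ω, ∑' k : ℕ, (layer k).indicator (fun _ => b k) ω ∂μ := by
        refine lintegral_mono fun ω => le_trans ?_ (ENNReal.le_tsum ⌊u ω⌋₊)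
        have hmem : ω ∈ layer ⌊u ω⌋₊ := ⟨Nat.floor_le (hu₀ ω), Nat.lt_floor_add_one (u ω)⟩
        rw [Set.indicator_of_mem hmem]
        exact hφ _ _ hmem.1 hmem.2
    _ = ∑' k : ℕ, b k * μ (layer k) := by
        rw [lintegral_tsum fun k => (measurable_const.indicator (hlayer k)).aemeasurable]
        exact tsum_congr fun k => lintegral_indicator_const (hlayer k) _

lemma tsum_ofReal_geometric {a r : ℝ} (ha : 0 ≤ a) (hr₀ : 0 ≤ r) (hr₁ : r < 1) :
    ∑' k : ℕ, ENNReal.ofReal (a * r ^ k) = ENNReal.ofReal (a / (1 - r)) := by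
  rw [← ENNReal.ofReal_tsum_of_nonneg (fun k => by positivity)
    ((summable_geometric_of_lt_one hr₀ hr₁).mul_left a), tsum_mul_left,
    tsum_geometric_of_lt_one hr₀ hr₁, div_eq_mul_inv]

lemma measure_le_ofReal_of_real_le [IsFiniteMeasure μ] {s : Set Ω} {a : ℝ} (h : μ.real s ≤ a) :
    μ s ≤ ENNReal.ofReal a := by
  rw [← ofReal_measureReal]
  exact ENNReal.ofReal_le_ofReal h

lemma exp_neg_one_le : Real.exp (-1) ≤ 0.37 := by
  rw [Real.exp_neg, inv_le_comm₀ (Real.exp_pos _) (by norm_num)]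
  linarith [Real.exp_one_gt_d9]

section Scalar

variable {p : Ω → ℝ} {K c₀ ε : ℝ}

lemma measure_natCast_le_sq_div_le [IsProbabilityMeasure μ] (hK : 0 < K)
    (htail : ∀ t : ℝ, 0 < t → μ.real {ω | t ≤ |p ω|} ≤ 2 * Real.exp (-t ^ 2 / K ^ 2)) (k : ℕ) :
    μ {ω | (k : ℝ) ≤ p ω ^ 2 / (2 * K ^ 2)} ≤ ENNReal.ofReal (2 * Real.exp (-(2 * k))) := by
  rcases Nat.eq_zero_or_pos k with rfl | hk
  · refine prob_le_one.trans ?_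
    simp
  · have : (0 : ℝ) < k := by exact_mod_cast hk
    have hsqrt : √(2 * k : ℝ) ^ 2 = 2 * k := Real.sq_sqrt (by positivity)
    have hexponent : -(√(2 * k) * K) ^ 2 / K ^ 2 = -(2 * k : ℝ) := by
      rw [mul_pow, hsqrt]
      field_simp
    rw [← hexponent]
    refine (measure_mono fun ω (hω : (k : ℝ) ≤ _) => ?_).trans
      (measure_le_ofReal_of_real_le (htail (√(2 * k) * K) (by positivity)))
    rw [le_div_iff₀ (by positivity)] at hω
    refine le_of_sq_le_sq (a := √(2 * k) * K) ?_ (abs_nonneg (p ω))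
    rw [mul_pow, hsqrt, sq_abs]
    linarith

lemma lintegral_exp_sq_le [IsProbabilityMeasure μ] (hp : Measurable p) (hK : 0 < K)
    (htail : ∀ t : ℝ, 0 < t → μ.real {ω | t ≤ |p ω|} ≤ 2 * Real.exp (-t ^ 2 / K ^ 2)) :
    ∫⁻ ω, ENNReal.ofReal (Real.exp (p ω ^ 2 / (2 * K ^ 2))) ∂μ ≤ 9 := by
  have hterm (k : ℕ) : ENNReal.ofReal (Real.exp (k + 1)) *
      μ {ω | (k : ℝ) ≤ p ω ^ 2 / (2 * K ^ 2) ∧ p ω ^ 2 / (2 * K ^ 2) < k + 1}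
      ≤ ENNReal.ofReal (2 * Real.exp 1 * Real.exp (-1) ^ k) := by
    calc _ ≤ ENNReal.ofReal (Real.exp (k + 1)) * ENNReal.ofReal (2 * Real.exp (-(2 * k))) := by
          gcongr
          exact (measure_mono fun ω hω => hω.1).trans (measure_natCast_le_sq_div_le hK htail k)
      _ = _ := by
          rw [← ENNReal.ofReal_mul (Real.exp_pos _).le, ← Real.exp_nat_mul, mul_left_comm,
            mul_assoc, ← Real.exp_add, ← Real.exp_add]
          ring_nf
  calc ∫⁻ ω, ENNReal.ofReal (Real.exp (p ω ^ 2 / (2 * K ^ 2))) ∂μ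
      ≤ ∑' k : ℕ, ENNReal.ofReal (2 * Real.exp 1 * Real.exp (-1) ^ k) :=
        (lintegral_comp_le_tsum (φ := fun t => ENNReal.ofReal (Real.exp t)) (by fun_prop)
          (fun ω => by positivity) fun k t _ ht => ENNReal.ofReal_le_ofReal
            (Real.exp_le_exp.2 ht.le)).trans (ENNReal.tsum_le_tsum hterm)
    _ = ENNReal.ofReal (2 * Real.exp 1 / (1 - Real.exp (-1))) :=
        tsum_ofReal_geometric (by positivity) (Real.exp_pos _).le
          (by linarith [exp_neg_one_le])
    _ ≤ 9 := by
        rw [← ENNReal.ofReal_ofNat]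
        refine ENNReal.ofReal_le_ofReal ?_
        rw [div_le_iff₀ (by linarith [exp_neg_one_le])]
        linarith [exp_neg_one_le, Real.exp_one_lt_d9]

lemma measure_sq_div_lt_natCast_add_one_le [IsFiniteMeasure μ] (hε : 0 < ε)
    (hball : ∀ t : ℝ, 0 < t → μ.real {ω | |p ω| ≤ t} ≤ c₀ * t) (k : ℕ) :
    μ {ω | p ω ^ 2 / ε ^ 2 < k + 1} ≤ ENNReal.ofReal (c₀ * (Real.exp (k / 2) * ε)) := by
  refine (measure_mono fun ω (hω : _ < (k : ℝ) + 1) => ?_).trans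
    (measure_le_ofReal_of_real_le (hball (Real.exp (k / 2) * ε) (by positivity)))
  rw [div_lt_iff₀ (by positivity)] at hω
  refine abs_le_of_sq_le_sq (hω.le.trans ?_) (by positivity)
  have hexp : Real.exp (k / 2 : ℝ) ^ 2 = Real.exp k := by
    rw [← Real.exp_nat_mul]
    congr 1
    push_cast
    ring
  rw [mul_pow, hexp]
  gcongr
  exact Real.add_one_le_exp (k : ℝ)

lemma lintegral_exp_neg_sq_le [IsFiniteMeasure μ] (hp : Measurable p) (hc₀ : 0 < c₀) (hε : 0 < ε)
    (hball : ∀ t : ℝ, 0 < t → μ.real {ω | |p ω| ≤ t} ≤ c₀ * t) :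
    ∫⁻ ω, ENNReal.ofReal (Real.exp (-(p ω ^ 2 / ε ^ 2))) ∂μ ≤ ENNReal.ofReal (3 * c₀ * ε) := by
  have hterm (k : ℕ) : ENNReal.ofReal (Real.exp (-k)) *
      μ {ω | (k : ℝ) ≤ p ω ^ 2 / ε ^ 2 ∧ p ω ^ 2 / ε ^ 2 < k + 1}
      ≤ ENNReal.ofReal (c₀ * ε * Real.exp (-(1 / 2)) ^ k) := by
    calc _ ≤ ENNReal.ofReal (Real.exp (-k)) * ENNReal.ofReal (c₀ * (Real.exp (k / 2) * ε)) := by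
          gcongr
          exact (measure_mono fun ω hω => hω.2).trans
            (measure_sq_div_lt_natCast_add_one_le hε hball k)
      _ = ENNReal.ofReal (c₀ * ε * (Real.exp (-k) * Real.exp (k / 2))) := by
          rw [← ENNReal.ofReal_mul (Real.exp_pos _).le]
          ring_nf
      _ = _ := by
          rw [← Real.exp_nat_mul, ← Real.exp_add]
          ring_nf
  have hratio : Real.exp (-(1 / 2)) ≤ 2 / 3 := by
    refine le_of_sq_le_sq ?_ (by norm_num)
    rw [← Real.exp_nat_mul]
    norm_num
    linarith [exp_neg_one_le]
  calc ∫⁻ ω, ENNReal.ofReal (Real.exp (-(p ω ^ 2 / ε ^ 2))) ∂μ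
      ≤ ∑' k : ℕ, ENNReal.ofReal (c₀ * ε * Real.exp (-(1 / 2)) ^ k) :=
        (lintegral_comp_le_tsum (φ := fun t => ENNReal.ofReal (Real.exp (-t))) (by fun_prop)
          (fun ω => by positivity) fun k t ht _ => ENNReal.ofReal_le_ofReal
            (Real.exp_le_exp.2 (neg_le_neg ht))).trans (ENNReal.tsum_le_tsum hterm)
    _ = ENNReal.ofReal (c₀ * ε / (1 - Real.exp (-(1 / 2)))) :=
        tsum_ofReal_geometric (by positivity) (Real.exp_pos _).le (by linarith)
    _ ≤ ENNReal.ofReal (3 * c₀ * ε) := by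
        refine ENNReal.ofReal_le_ofReal ?_
        rw [div_le_iff₀ (by linarith)]
        nlinarith [mul_pos hc₀ hε]

end Scalar

section Vector

variable {ι : Type*} [Fintype ι] {X : Ω → EuclideanSpace ℝ ι} {K c₀ : ℝ}

lemma SubGaussianWith.lintegral_exp_inner_le [IsProbabilityMeasure μ] (hX : Measurable X)
    (hK : 0 < K) (hsub : SubGaussianWith μ X K) (v : EuclideanSpace ℝ ι) :
    ∫⁻ ω, ENNReal.ofReal (Real.exp (inner ℝ (X ω) v)) ∂μ
      ≤ ENNReal.ofReal (Real.exp (K ^ 2 / 2 * ‖v‖ ^ 2)) * 9 := by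
  rcases eq_or_ne v 0 with rfl | hv
  · simp only [inner_zero_right, Real.exp_zero, ENNReal.ofReal_one, lintegral_const, measure_univ,
      norm_zero]
    norm_num
  have hn : ‖v‖ ≠ 0 := norm_ne_zero_iff.2 hv
  refine le_trans ?_ (mul_le_mul_right (lintegral_exp_sq_le
    (hX.inner (measurable_const (a := ‖v‖⁻¹ • v))) hK
    (hsub _ (norm_smul_inv_norm (𝕜 := ℝ) hv))) _)
  rw [← lintegral_const_mul' _ _ ENNReal.ofReal_ne_top]
  refine lintegral_mono fun ω => ?_
  rw [← ENNReal.ofReal_mul (Real.exp_pos _).le, ← Real.exp_add]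
  refine ENNReal.ofReal_le_ofReal (Real.exp_le_exp.2 ?_)
  set s := inner ℝ (X ω) (‖v‖⁻¹ • v) with hs
  have hinner : inner ℝ (X ω) v = ‖v‖ * s := by
    rw [hs, inner_smul_right, mul_inv_cancel_left₀ hn]
  have hsquare : (s / K - K * ‖v‖) ^ 2
      = 2 * (K ^ 2 / 2 * ‖v‖ ^ 2 + s ^ 2 / (2 * K ^ 2)) - 2 * (‖v‖ * s) := by
    field_simp
    ring
  linarith [sq_nonneg (s / K - K * ‖v‖)]

/-- Completing the square writes `exp (‖C‖² / 4b)` as a Gaussian average of `exp ⟨C, v⟩`. -/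
lemma mul_exp_norm_sq_eq_lintegral {b : ℝ} (hb : 0 < b) (C : EuclideanSpace ℝ ι) :
    ENNReal.ofReal (√(Real.pi / b) ^ Fintype.card ι) *
        ENNReal.ofReal (Real.exp (‖C‖ ^ 2 / (4 * b)))
      = ∫⁻ v : EuclideanSpace ℝ ι, ENNReal.ofReal (Real.exp (-b * ‖v‖ ^ 2)) *
          ENNReal.ofReal (Real.exp (inner ℝ C v)) := by
  rw [← finrank_euclideanSpace (𝕜 := ℝ) (ι := ι), ← lintegral_gaussian hb,
    ← lintegral_mul_const' _ _ ENNReal.ofReal_ne_top,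
    ← lintegral_add_right_eq_self _ (-((1 / (2 * b)) • C))]
  refine lintegral_congr fun v => ?_
  rw [← ENNReal.ofReal_mul (Real.exp_pos _).le, ← ENNReal.ofReal_mul (Real.exp_pos _).le,
    ← Real.exp_add, ← Real.exp_add, ← sub_eq_add_neg, norm_sub_sq_real, inner_smul_right,
    norm_smul, real_inner_comm, mul_pow, Real.norm_eq_abs, sq_abs]
  congr 2
  field_simp
  ring

lemma SubGaussianWith.lintegral_exp_norm_sq_le [IsProbabilityMeasure μ] (hX : Measurable X)
    (hK : 0 < K) (hsub : SubGaussianWith μ X K) :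
    ∫⁻ ω, ENNReal.ofReal (Real.exp (‖X ω‖ ^ 2 / (4 * K ^ 2))) ∂μ
      ≤ ENNReal.ofReal (9 * √2 ^ Fintype.card ι) := by
  have hK₂ : 0 < K ^ 2 := by positivity
  have hconst : ENNReal.ofReal (√(Real.pi / K ^ 2) ^ Fintype.card ι) ≠ 0 := by
    rw [Ne, ENNReal.ofReal_eq_zero, not_le]
    positivity
  rw [← ENNReal.mul_le_mul_iff_right hconst ENNReal.ofReal_ne_top,
    ← lintegral_const_mul' _ _ ENNReal.ofReal_ne_top]
  calc ∫⁻ ω, ENNReal.ofReal (√(Real.pi / K ^ 2) ^ Fintype.card ι) *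
        ENNReal.ofReal (Real.exp (‖X ω‖ ^ 2 / (4 * K ^ 2))) ∂μ
      = ∫⁻ ω, ∫⁻ v : EuclideanSpace ℝ ι, ENNReal.ofReal (Real.exp (-K ^ 2 * ‖v‖ ^ 2)) *
          ENNReal.ofReal (Real.exp (inner ℝ (X ω) v)) ∂volume ∂μ :=
        lintegral_congr fun ω => mul_exp_norm_sq_eq_lintegral hK₂ _
    _ = ∫⁻ v : EuclideanSpace ℝ ι, ∫⁻ ω, ENNReal.ofReal (Real.exp (-K ^ 2 * ‖v‖ ^ 2)) *
          ENNReal.ofReal (Real.exp (inner ℝ (X ω) v)) ∂μ ∂volume := by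
        refine lintegral_lintegral_swap (Measurable.aemeasurable ?_)
        have hinner : Measurable fun z : Ω × EuclideanSpace ℝ ι => inner ℝ (X z.1) z.2 :=
          (hX.comp measurable_fst).inner measurable_snd
        exact Measurable.mul (by fun_prop) hinner.exp.ennreal_ofReal
    _ ≤ ∫⁻ v : EuclideanSpace ℝ ι, ENNReal.ofReal (Real.exp (-(K ^ 2 / 2) * ‖v‖ ^ 2)) * 9 := by
        refine lintegral_mono fun v => ?_
        rw [lintegral_const_mul' _ _ ENNReal.ofReal_ne_top]
        refine (mul_le_mul_right (hsub.lintegral_exp_inner_le hX hK v) _).trans_eq ?_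
        rw [← mul_assoc, ← ENNReal.ofReal_mul (Real.exp_pos _).le, ← Real.exp_add]
        ring_nf
    _ = ENNReal.ofReal (√(Real.pi / (K ^ 2 / 2)) ^ Fintype.card ι * 9) := by
        rw [lintegral_mul_const' _ _ (by norm_num), lintegral_gaussian (by positivity),
          finrank_euclideanSpace, ← ENNReal.ofReal_ofNat, ← ENNReal.ofReal_mul (by positivity)]
    _ = _ := by
        rw [div_div_eq_mul_div, mul_div_right_comm, Real.sqrt_mul (by positivity), mul_pow,
          ← ENNReal.ofReal_mul (by positivity)]
        ring_nf

/-- At the scale `2 K` a coordinate of `X` is neither often large nor often small, so the two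
assumptions force `K c₀` to be bounded from below. -/
lemma one_le_mul_of_subGaussian_of_smallBall [IsProbabilityMeasure μ] [Nonempty ι] (hK : 0 < K)
    (hsub : SubGaussianWith μ X K) (hball : SmallBallWith μ X c₀) : 1 ≤ 4 * (K * c₀) := by
  classical
  obtain ⟨i⟩ := ‹Nonempty ι›
  let θ : EuclideanSpace ℝ ι := EuclideanSpace.single i 1
  have hθ : ‖θ‖ = 1 := by simp [θ]
  have hlarge : μ.real {ω | 2 * K ≤ |inner ℝ (X ω) θ|} ≤ 2 * Real.exp (-4) := by
    refine (hsub θ hθ (2 * K) (by positivity)).trans_eq ?_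
    field_simp
    norm_num
  have hsmall : μ.real {ω | |inner ℝ (X ω) θ| ≤ 2 * K} ≤ c₀ * (2 * K) := by
    simpa only [hθ, mul_one, real_inner_comm] using
      hball θ (by rw [← norm_ne_zero_iff, hθ]; norm_num) (2 * K) (by positivity)
  have hcover : (1 : ℝ) ≤ μ.real {ω | 2 * K ≤ |inner ℝ (X ω) θ|} +
      μ.real {ω | |inner ℝ (X ω) θ| ≤ 2 * K} := by
    rw [← probReal_univ (μ := μ)]
    refine (measureReal_mono ?_).trans (measureReal_union_le _ _)
    exact fun ω _ => le_total (2 * K) |inner ℝ (X ω) θ|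
  have hexp : Real.exp (-4) ≤ 1 / 4 := by
    rw [Real.exp_neg, one_div]
    exact inv_anti₀ (by norm_num) (by linarith [Real.add_one_le_exp (4 : ℝ)])
  linarith

end Vector

end ExponentialMoments

section Markov

/-- Markov's inequality for the average of `h ω` over `A`, which is large when `h ω` is large on a
substantial part of `A`. -/
lemma mul_measure_le_of_exists_large_set {Ω W : Type*} [MeasurableSpace Ω] [MeasurableSpace W]
    {μ : Measure Ω} [SFinite μ] {ν : Measure W} [SFinite ν]
    {h : Ω → W → ℝ≥0∞} (hh : Measurable (Function.uncurry h)) {A : Set W} (hA₀ : ν A ≠ 0)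
    (hA : ν A ≠ ∞) {S : Set Ω} {R q H : ℝ≥0∞} (hR : R ≠ ∞)
    (hS : ∀ ω ∈ S, ∃ B : Set W, MeasurableSet B ∧ B ⊆ A ∧ ν A ≤ R * ν B ∧ ∀ w ∈ B, q ≤ h ω w)
    (hH : ∀ᵐ w ∂ν, ∫⁻ ω, h ω w ∂μ ≤ H) : q * μ S ≤ R * H := by
  let G : Ω → ℝ≥0∞ := fun ω => ∫⁻ w in A, h ω w ∂ν
  have hG : Measurable G := hh.lintegral_prod_right'
  have hlarge : S ⊆ {ω | q * ν A ≤ R * G ω} := by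
    intro ω hω
    obtain ⟨B, hB, hBA, hAB, hqB⟩ := hS ω hω
    calc q * ν A ≤ q * (R * ν B) := by gcongr
      _ = R * ∫⁻ _ in B, q ∂ν := by rw [setLIntegral_const, mul_left_comm]
      _ ≤ R * ∫⁻ w in B, h ω w ∂ν := by
          gcongr R * ?_
          exact setLIntegral_mono' hB hqB
      _ ≤ R * G ω := by
          gcongr R * ?_
          exact lintegral_mono_set hBA
  rw [← ENNReal.mul_le_mul_iff_left hA₀ hA]
  calc q * μ S * ν A = q * ν A * μ S := by ring
    _ ≤ q * ν A * μ {ω | q * ν A ≤ R * G ω} := by gcongr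
    _ ≤ ∫⁻ ω, R * G ω ∂μ := mul_meas_ge_le_lintegral₀ (hG.const_mul R).aemeasurable _
    _ = R * ∫⁻ ω, G ω ∂μ := lintegral_const_mul' _ _ hR
    _ = R * ∫⁻ w in A, ∫⁻ ω, h ω w ∂μ ∂ν := by rw [lintegral_lintegral_swap hh.aemeasurable]
    _ ≤ R * ∫⁻ _ in A, H ∂ν := by
        gcongr R * ?_
        exact lintegral_mono_ae (ae_restrict_of_ae hH)
    _ = R * H * ν A := by rw [setLIntegral_const, mul_assoc]

end Markov

section BoxEstimates

variable {k m d : ℕ} {P : Fin m → MvPolynomial (Fin (k + 2)) ℝ}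
  {e : OrthonormalBasis (Fin (k + 2)) ℝ (EuclideanSpace ℝ (Fin (k + 2)))}
  {w : EuclideanSpace ℝ (Fin (k + 2))}

lemma half_norm_evalSystem_le_of_mem_box (hmax : IsSphereBound P ‖evalSystem P (e 0)‖)
    (hP : ∀ i, (P i).totalDegree ≤ d) (hd : 0 < d)
    (hw : w ∈ box e (1 / (12 * d)) (1 / (12 * d))) :
    ‖evalSystem P (e 0)‖ / 2 ≤ ‖sphereEval P w‖ := by
  obtain ⟨a, b, z, ha, rfl, hb, hz, hxz, -⟩ := exists_eq_smul_of_mem_box hw (by positivity)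
  rw [sphereEval_smul P ha, add_assoc]
  have horth : inner ℝ (e 0) (b • e 1 + z) = 0 := by
    rw [inner_add_right, inner_smul_right, e.inner_eq_zero Fin.zero_ne_one, hxz, mul_zero, add_zero]
  have hsmall : ‖b • e 1 + z‖ ≤ 1 / (6 * d) :=
    calc ‖b • e 1 + z‖ ≤ ‖b • e 1‖ + ‖z‖ := norm_add_le _ _
      _ = |b| + ‖z‖ := by rw [norm_smul, e.norm_eq_one, mul_one, Real.norm_eq_abs]
      _ ≤ 1 / (12 * d) + 1 / (12 * d) := add_le_add hb hz
      _ = 1 / (6 * d) := by ring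
  have hvariation : 3 * d * ‖evalSystem P (e 0)‖ * ‖b • e 1 + z‖ ≤ ‖evalSystem P (e 0)‖ / 2 :=
    calc 3 * d * ‖evalSystem P (e 0)‖ * ‖b • e 1 + z‖
        ≤ 3 * d * ‖evalSystem P (e 0)‖ * (1 / (6 * d)) := by gcongr
      _ = ‖evalSystem P (e 0)‖ / 2 := by field_simp; ring
  have hreverse := norm_sub_norm_le (evalSystem P (e 0)) (sphereEval P (e 0 + (b • e 1 + z)))
  rw [norm_sub_rev] at hreverse
  linarith [hmax.norm_sphereEval_add_sub_le hP hd (e.norm_eq_one 0) horth]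

/-- The sides of the box are those for which each of the four terms of
`IsSphereBound.norm_sphereEval_le` is at most `ρ ^ 2 * γ`. -/
lemma norm_sphereEval_le_of_mem_box {γ ρ : ℝ} (hγ : IsSphereBound P γ)
    (hP : ∀ i, (P i).totalDegree ≤ d) (hd : 0 < d) (hρ : 0 < ρ) (hρ' : ρ ≤ 1)
    (hvalue : ‖evalSystem P (e 0)‖ ≤ ρ ^ 2 * γ)
    (hderiv : ‖dirDeriv P (e 0) (e 1)‖ ≤ d * (ρ ^ 2 * γ))
    (hw : w ∈ box e (ρ / (3 * d)) (ρ ^ 2 / (3 * d))) : ‖sphereEval P w‖ ≤ 4 * (ρ ^ 2 * γ) := by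
  have hγ₀ : 0 ≤ γ := hγ.nonneg (e.norm_eq_one 0)
  obtain ⟨a, b, z, ha, rfl, hb, hz, hxz, hyz⟩ := exists_eq_smul_of_mem_box hw (by positivity)
  rw [sphereEval_smul P ha]
  have hlinear : |b| * ‖dirDeriv P (e 0) (e 1)‖ ≤ ρ ^ 2 * γ :=
    calc |b| * ‖dirDeriv P (e 0) (e 1)‖ ≤ ρ / (3 * d) * (d * (ρ ^ 2 * γ)) := by gcongr
      _ = ρ / 3 * (ρ ^ 2 * γ) := by field_simp
      _ ≤ 1 * (ρ ^ 2 * γ) := by gcongr; linarith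
      _ = ρ ^ 2 * γ := one_mul _
  have hquadratic : 9 * d ^ 2 * γ * b ^ 2 ≤ ρ ^ 2 * γ :=
    calc 9 * d ^ 2 * γ * b ^ 2 = 9 * d ^ 2 * γ * |b| ^ 2 := by rw [sq_abs]
      _ ≤ 9 * d ^ 2 * γ * (ρ / (3 * d)) ^ 2 := by gcongr
      _ = ρ ^ 2 * γ := by field_simp; ring
  have horthogonal : 3 * d * γ * ‖z‖ ≤ ρ ^ 2 * γ :=
    calc 3 * d * γ * ‖z‖ ≤ 3 * d * γ * (ρ ^ 2 / (3 * d)) := by gcongr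
      _ = ρ ^ 2 * γ := by field_simp
  linarith [hγ.norm_sphereEval_le hP hd (e.norm_eq_one 0) (e.norm_eq_one 1)
    (e.inner_eq_zero Fin.zero_ne_one) hxz hyz b]

end BoxEstimates

section SphereMaximum

variable {n m : ℕ} (P : Fin m → MvPolynomial (Fin n) ℝ)

lemma continuous_evalSystem : Continuous (evalSystem P) :=
  (PiLp.continuous_toLp 2 _).comp <| continuous_pi fun i =>
    (MvPolynomial.continuous_eval (P i)).comp (PiLp.continuous_ofLp 2 _)

lemma exists_isSphereBound_norm_evalSystem [NeZero n] :
    ∃ x, ‖x‖ = 1 ∧ IsSphereBound P ‖evalSystem P x‖ := by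
  obtain ⟨x, hx, hmax⟩ := (isCompact_sphere (0 : EuclideanSpace ℝ (Fin n)) 1).exists_isMaxOn
    (NormedSpace.sphere_nonempty.2 zero_le_one) (continuous_evalSystem P).norm.continuousOn
  exact ⟨x, by simpa using hx, fun v hv => hmax (by simpa using hv)⟩

end SphereMaximum

section RandomForms

lemma le_ofReal_exp_neg_mul {p : ℝ≥0∞} {a b : ℝ}
    (h : ENNReal.ofReal (Real.exp a) * p ≤ ENNReal.ofReal b) :
    p ≤ ENNReal.ofReal (Real.exp (-a) * b) := by
  have hpos : ENNReal.ofReal (Real.exp a) ≠ 0 := by simpa using Real.exp_pos a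
  rwa [← ENNReal.mul_le_mul_iff_right hpos ENNReal.ofReal_ne_top,
    ← ENNReal.ofReal_mul (Real.exp_pos _).le, ← mul_assoc, ← Real.exp_add, add_neg_cancel,
    Real.exp_zero, one_mul]

variable {n m : ℕ} {deg : Fin m → ℕ} {Ω : Type*} [MeasurableSpace Ω] {μ : Measure Ω}
  {X : (i : Fin m) → Ω → EuclideanSpace ℝ (MultiIndex n (deg i))} {K c₀ : ℝ}

/-- The random system of forms whose coefficient vectors are the `X i`. -/
noncomputable abbrev randomForms (X : (i : Fin m) → Ω → EuclideanSpace ℝ (MultiIndex n (deg i)))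
    (ω : Ω) : Fin m → MvPolynomial (Fin n) ℝ :=
  forms fun i => X i ω

lemma norm_sq_evalSystem_forms (c : Coeffs n deg) (x : EuclideanSpace ℝ (Fin n)) :
    ‖evalSystem (forms c) x‖ ^ 2 = ∑ i, inner ℝ (veronese (deg i) x) (c i) ^ 2 := by
  rw [EuclideanSpace.real_norm_sq_eq]
  simp only [evalSystem_forms_apply]

lemma measurable_norm_sq_sphereEval (hX : ∀ i, Measurable (X i)) :
    Measurable fun z : Ω × EuclideanSpace ℝ (Fin n) =>
      ‖sphereEval (randomForms X z.1) z.2‖ ^ 2 := by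
  simp only [sphereEval, norm_sq_evalSystem_forms]
  refine Finset.measurable_sum _ fun i _ => Measurable.pow_const (Measurable.inner ?_ ?_) 2
  · exact continuous_veronese.measurable.comp (by fun_prop)
  · exact (hX i).comp measurable_fst

lemma lintegral_exp_sum_eq_prod (hX : ∀ i, Measurable (X i)) (hind : iIndepFun X μ)
    {h : (i : Fin m) → EuclideanSpace ℝ (MultiIndex n (deg i)) → ℝ} (hh : ∀ i, Measurable (h i)) :
    ∫⁻ ω, ENNReal.ofReal (Real.exp (∑ i, h i (X i ω))) ∂μ
      = ∏ i, ∫⁻ ω, ENNReal.ofReal (Real.exp (h i (X i ω))) ∂μ := by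
  have hmeas (i : Fin m) : Measurable fun c => ENNReal.ofReal (Real.exp (h i c)) :=
    (hh i).exp.ennreal_ofReal
  rw [← lintegral_prod_eq_prod_lintegral_of_indepFun Finset.univ
    (fun i ω => ENNReal.ofReal (Real.exp (h i (X i ω)))) (hind.comp _ hmeas)
    fun i => (hmeas i).comp (hX i)]
  refine lintegral_congr fun ω => ?_
  rw [Real.exp_sum, ENNReal.ofReal_prod_of_nonneg fun i _ => (Real.exp_pos _).le]

variable [IsProbabilityMeasure μ]

lemma lintegral_exp_norm_sq_evalSystem_le (hX : ∀ i, Measurable (X i)) (hind : iIndepFun X μ)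
    (hK : 0 < K) (hsub : ∀ i, SubGaussianWith μ (X i) K)
    {x : EuclideanSpace ℝ (Fin n)} (hx : ‖x‖ = 1) :
    ∫⁻ ω, ENNReal.ofReal (Real.exp (‖evalSystem (randomForms X ω) x‖ ^ 2 / (2 * K ^ 2))) ∂μ
      ≤ 9 ^ m := by
  simp only [norm_sq_evalSystem_forms, Finset.sum_div]
  rw [lintegral_exp_sum_eq_prod hX hind
    (h := fun i c => inner ℝ (veronese (deg i) x) c ^ 2 / (2 * K ^ 2)) (fun i => by fun_prop)]
  calc _ ≤ ∏ _i : Fin m, (9 : ℝ≥0∞) := by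
        refine Finset.prod_le_prod' fun i _ => ?_
        refine lintegral_exp_sq_le (p := fun ω => inner ℝ (veronese (deg i) x) (X i ω))
          (measurable_const.inner (hX i)) hK fun t ht => ?_
        simp only [real_inner_comm (X i _)]
        exact hsub i _ (by rw [norm_veronese, hx, one_pow]) t ht
    _ = 9 ^ m := by simp

lemma lintegral_exp_neg_norm_sq_evalSystem_le (hX : ∀ i, Measurable (X i)) (hind : iIndepFun X μ)
    (hc₀ : 0 < c₀) (hball : ∀ i, SmallBallWith μ (X i) c₀) {ε : ℝ} (hε : 0 < ε)
    {x : EuclideanSpace ℝ (Fin n)} (hx : ‖x‖ = 1) :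
    ∫⁻ ω, ENNReal.ofReal (Real.exp (-(‖evalSystem (randomForms X ω) x‖ ^ 2 / ε ^ 2))) ∂μ
      ≤ ENNReal.ofReal ((3 * c₀ * ε) ^ m) := by
  simp only [norm_sq_evalSystem_forms, Finset.sum_div, ← Finset.sum_neg_distrib]
  rw [lintegral_exp_sum_eq_prod hX hind
    (h := fun i c => -(inner ℝ (veronese (deg i) x) c ^ 2 / ε ^ 2)) (fun i => by fun_prop)]
  calc _ ≤ ∏ _i : Fin m, ENNReal.ofReal (3 * c₀ * ε) := by
        refine Finset.prod_le_prod' fun i _ => ?_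
        refine lintegral_exp_neg_sq_le (p := fun ω => inner ℝ (veronese (deg i) x) (X i ω))
          (measurable_const.inner (hX i)) hc₀ hε fun t ht => ?_
        have hnorm : ‖veronese (deg i) x‖ = 1 := by rw [norm_veronese, hx, one_pow]
        simpa only [hnorm, mul_one] using
          hball i (veronese (deg i) x) (by rw [← norm_ne_zero_iff, hnorm]; norm_num) t ht
    _ = _ := by
        rw [Finset.prod_const, Finset.card_univ, Fintype.card_fin,
          ENNReal.ofReal_pow (by positivity)]

lemma nine_mul_sqrt_two_pow_le {k : ℕ} (hk : k ≠ 0) : 9 * √2 ^ k ≤ Real.exp 3 ^ k := by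
  have hsqrt : √(2 : ℝ) ≤ 3 / 2 := (Real.sqrt_le_left (by norm_num)).2 (by norm_num)
  have hexp : 27 / 2 ≤ Real.exp 3 :=
    calc (27 / 2 : ℝ) ≤ 2.7 ^ 3 := by norm_num
      _ ≤ Real.exp 1 ^ 3 := by gcongr; linarith [Real.exp_one_gt_d9]
      _ = Real.exp 3 := by rw [← Real.exp_nat_mul]; norm_num
  calc 9 * √2 ^ k ≤ 9 ^ k * √2 ^ k := by
        gcongr
        exact le_self_pow₀ (by norm_num) hk
    _ = (9 * √2) ^ k := (mul_pow _ _ _).symm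
    _ ≤ Real.exp 3 ^ k := by gcongr; linarith

lemma lintegral_exp_sum_norm_sq_le (hn : 0 < n) (hX : ∀ i, Measurable (X i))
    (hind : iIndepFun X μ) (hK : 0 < K) (hsub : ∀ i, SubGaussianWith μ (X i) K) :
    ∫⁻ ω, ENNReal.ofReal (Real.exp (∑ i, ‖X i ω‖ ^ 2 / (4 * K ^ 2))) ∂μ
      ≤ ENNReal.ofReal (Real.exp (3 * ↑(∑ i, (n + deg i - 1).choose (deg i)))) := by
  rw [lintegral_exp_sum_eq_prod hX hind (h := fun i c => ‖c‖ ^ 2 / (4 * K ^ 2))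
    fun i => by fun_prop]
  have hexp : Real.exp (3 * ↑(∑ i, (n + deg i - 1).choose (deg i)))
      = ∏ i, Real.exp 3 ^ (n + deg i - 1).choose (deg i) := by
    rw [Finset.prod_pow_eq_pow_sum, mul_comm, Real.exp_nat_mul]
  rw [hexp, ENNReal.ofReal_prod_of_nonneg fun i _ => by positivity]
  refine Finset.prod_le_prod' fun i _ => ((hsub i).lintegral_exp_norm_sq_le (hX i) hK).trans ?_
  rw [card_multiIndex]
  exact ENNReal.ofReal_le_ofReal (nine_mul_sqrt_two_pow_le (Nat.choose_pos (by omega)).ne')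

lemma measure_le_sum_norm_sq_le (hn : 0 < n) (hX : ∀ i, Measurable (X i)) (hind : iIndepFun X μ)
    (hK : 0 < K) (hsub : ∀ i, SubGaussianWith μ (X i) K) (r : ℝ) :
    μ {ω | 4 * K ^ 2 * r ≤ ∑ i, ‖X i ω‖ ^ 2}
      ≤ ENNReal.ofReal (Real.exp (3 * ↑(∑ i, (n + deg i - 1).choose (deg i)) - r)) := by
  rw [sub_eq_neg_add, Real.exp_add]
  refine le_ofReal_exp_neg_mul (le_trans ?_ (lintegral_exp_sum_norm_sq_le hn hX hind hK hsub))
  refine le_trans ?_ (mul_meas_ge_le_lintegral₀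
    (Measurable.aemeasurable (by fun_prop)) (ENNReal.ofReal (Real.exp r)))
  gcongr with ω
  intro (hω : 4 * K ^ 2 * r ≤ ∑ i, ‖X i ω‖ ^ 2)
  refine ENNReal.ofReal_le_ofReal (Real.exp_le_exp.2 ?_)
  rw [← Finset.sum_div, le_div_iff₀ (by positivity)]
  linarith

end RandomForms

section SphereTails

variable {k m d : ℕ} {deg : Fin m → ℕ} {Ω : Type*} [MeasurableSpace Ω] {μ : Measure Ω}

lemma mul_measure_le_of_forall_exists_box [SFinite μ]
    {h : Ω → EuclideanSpace ℝ (Fin (k + 2)) → ℝ≥0∞} (hh : Measurable fun z : Ω × _ => h z.1 z.2)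
    {β₁ β₂ : ℝ} (hβ₁ : 0 < β₁) (hβ₁' : β₁ ≤ 1) (hβ₂ : 0 < β₂) (hβ₂' : β₂ ≤ 1)
    {S : Set Ω} {q H : ℝ≥0∞}
    (hS : ∀ ω ∈ S, ∃ e : OrthonormalBasis (Fin (k + 2)) ℝ (EuclideanSpace ℝ (Fin (k + 2))),
      ∀ w ∈ box e β₁ β₂, q ≤ h ω w)
    (hH : ∀ w, w ≠ 0 → ∫⁻ ω, h ω w ∂μ ≤ H) :
    q * μ S ≤ ENNReal.ofReal (Real.exp 6 ^ (k + 2) / (β₁ * β₂ ^ k)) * H := by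
  refine mul_measure_le_of_exists_large_set (ν := volume) hh (A := Metric.ball 0 2)
    (Metric.measure_ball_pos volume 0 two_pos).ne' measure_ball_lt_top.ne ENNReal.ofReal_ne_top
    (fun ω hω => ?_) ((Measure.ae_ne volume 0).mono hH)
  obtain ⟨e, he⟩ := hS ω hω
  exact ⟨box e β₁ β₂, measurableSet_box e, box_subset_ball hβ₁.le hβ₁' hβ₂.le hβ₂',
    volume_ball_two_le_mul_volume_box e hβ₁ hβ₂, he⟩

variable [IsProbabilityMeasure μ]
  {X : (i : Fin m) → Ω → EuclideanSpace ℝ (MultiIndex (k + 2) (deg i))} {K c₀ γ ρ : ℝ}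

lemma measure_not_isSphereBound_le (hX : ∀ i, Measurable (X i)) (hind : iIndepFun X μ)
    (hK : 0 < K) (hsub : ∀ i, SubGaussianWith μ (X i) K) (hd : 0 < d) (hdeg : ∀ i, deg i ≤ d)
    (hγ : 0 ≤ γ) :
    μ {ω | ¬ IsSphereBound (randomForms X ω) γ}
      ≤ ENNReal.ofReal (Real.exp (-(γ ^ 2 / (8 * K ^ 2))) *
          (Real.exp 6 ^ (k + 2) * (12 * d) ^ (k + 1) * 9 ^ m)) := by
  have hd₁ : (1 : ℝ) ≤ d := by exact_mod_cast hd
  set β : ℝ := 1 / (12 * d) with hβ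
  have hβ₀ : 0 < β := by positivity
  have hβ₁ : β ≤ 1 := (div_le_one (by positivity)).2 (by linarith)
  have hconst : ENNReal.ofReal (Real.exp 6 ^ (k + 2) / (β * β ^ k)) * 9 ^ m
      = ENNReal.ofReal (Real.exp 6 ^ (k + 2) * (12 * d) ^ (k + 1) * 9 ^ m) := by
    rw [← ENNReal.ofReal_ofNat, ← ENNReal.ofReal_pow (by norm_num),
      ← ENNReal.ofReal_mul (by positivity), ← pow_succ', hβ, one_div, inv_pow, div_inv_eq_mul]
  refine le_ofReal_exp_neg_mul (le_of_le_of_eq (mul_measure_le_of_forall_exists_box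
    (h := fun ω w => ENNReal.ofReal
      (Real.exp (‖sphereEval (randomForms X ω) w‖ ^ 2 / (2 * K ^ 2))))
    ((measurable_norm_sq_sphereEval hX).div_const _).exp.ennreal_ofReal
    hβ₀ hβ₁ hβ₀ hβ₁ ?_ ?_) hconst)
  · intro ω hω
    obtain ⟨v, hv, hγv⟩ : ∃ v, ‖v‖ = 1 ∧ γ < ‖evalSystem (randomForms X ω) v‖ := by
      simpa [IsSphereBound] using hω
    obtain ⟨x, hx, hmax⟩ := exists_isSphereBound_norm_evalSystem (randomForms X ω)
    obtain ⟨e, rfl⟩ := exists_orthonormalBasis_apply_zero finrank_euclideanSpace_fin hx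
    refine ⟨e, fun w hw => ENNReal.ofReal_le_ofReal (Real.exp_le_exp.2 ?_)⟩
    have hhalf : γ / 2 ≤ ‖sphereEval (randomForms X ω) w‖ := by
      linarith [hmax v hv, half_norm_evalSystem_le_of_mem_box hmax
        (fun i => (totalDegree_formOfCoeffs_le _).trans (hdeg i)) hd hw]
    calc γ ^ 2 / (8 * K ^ 2) = (γ / 2) ^ 2 / (2 * K ^ 2) := by ring
      _ ≤ _ := by gcongr
  · exact fun w hw =>
      lintegral_exp_norm_sq_evalSystem_le hX hind hK hsub (norm_smul_inv_norm (𝕜 := ℝ) hw)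

/-- There is a point `x` of the sphere with a unit tangent vector `y` such that `‖P(x)‖ ≤ α` and
`‖DP(x) y‖ ≤ d α`; for small `α` this is a quantitative form of `L(P, x) = 0`. -/
def IsNearlySingular {n : ℕ} (P : Fin m → MvPolynomial (Fin n) ℝ) (d : ℕ) (α : ℝ) : Prop :=
  ∃ x y : EuclideanSpace ℝ (Fin n), ‖x‖ = 1 ∧ ‖y‖ = 1 ∧ inner ℝ x y = 0 ∧
    ‖evalSystem P x‖ ≤ α ∧ ‖dirDeriv P x y‖ ≤ d * α

lemma measure_isSphereBound_and_isNearlySingular_le (hm : 0 < m) (hX : ∀ i, Measurable (X i))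
    (hind : iIndepFun X μ) (hc₀ : 0 < c₀) (hball : ∀ i, SmallBallWith μ (X i) c₀)
    (hd : 0 < d) (hdeg : ∀ i, deg i ≤ d) (hγ : 0 < γ) (hρ : 0 < ρ) (hρ' : ρ ≤ 1) :
    μ {ω | IsSphereBound (randomForms X ω) γ ∧ IsNearlySingular (randomForms X ω) d (ρ ^ 2 * γ)}
      ≤ ENNReal.ofReal (Real.exp 6 ^ (k + 2) * (3 * d) ^ (k + 1) / ρ ^ (2 * k + 1) *
          (36 * c₀ * (ρ ^ 2 * γ) / √m) ^ m) := by
  have hd₁ : (1 : ℝ) ≤ d := by exact_mod_cast hd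
  have hm₀ : (0 : ℝ) < m := by exact_mod_cast hm
  have hβ₁ : ρ / (3 * d) ≤ 1 := (div_le_one (by positivity)).2 (by linarith)
  have hβ₂ : ρ ^ 2 / (3 * d) ≤ 1 :=
    (div_le_one (by positivity)).2 (by linarith [pow_le_one₀ hρ.le hρ' (n := 2)])
  set ε : ℝ := 4 * (ρ ^ 2 * γ) / √m with hε
  have hε₀ : 0 < ε := by positivity
  have hmarkov := mul_measure_le_of_forall_exists_box
    (S := {ω | IsSphereBound (randomForms X ω) γ ∧
      IsNearlySingular (randomForms X ω) d (ρ ^ 2 * γ)})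
    (h := fun ω w => ENNReal.ofReal
      (Real.exp (-(‖sphereEval (randomForms X ω) w‖ ^ 2 / ε ^ 2))))
    (q := ENNReal.ofReal (Real.exp (-m)))
    ((measurable_norm_sq_sphereEval hX).div_const _).fun_neg.exp.ennreal_ofReal
    (by positivity) hβ₁ (by positivity) hβ₂ ?_ fun w hw =>
      lintegral_exp_neg_norm_sq_evalSystem_le hX hind hc₀ hball hε₀ (norm_smul_inv_norm (𝕜 := ℝ) hw)
  · rw [← ENNReal.ofReal_mul (by positivity)] at hmarkov
    refine (le_ofReal_exp_neg_mul hmarkov).trans (ENNReal.ofReal_le_ofReal ?_)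
    have hsides : ρ / (3 * d) * (ρ ^ 2 / (3 * d)) ^ k = ρ ^ (2 * k + 1) / (3 * d) ^ (k + 1) := by
      rw [div_pow, div_mul_div_comm, ← pow_mul, ← pow_succ', ← pow_succ']
    have hexp : Real.exp m ≤ 3 ^ m := by
      rw [← mul_one (m : ℝ), Real.exp_nat_mul]
      gcongr
      linarith [Real.exp_one_lt_d9]
    rw [hsides, div_div_eq_mul_div, neg_neg]
    calc _ = Real.exp 6 ^ (k + 2) * (3 * d) ^ (k + 1) / ρ ^ (2 * k + 1) *
          (Real.exp m * (3 * c₀ * ε) ^ m) := by ring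
      _ ≤ Real.exp 6 ^ (k + 2) * (3 * d) ^ (k + 1) / ρ ^ (2 * k + 1) *
          (3 ^ m * (3 * c₀ * ε) ^ m) := by gcongr
      _ = _ := by rw [← mul_pow, hε]; ring
  · rintro ω ⟨hγω, x, y, hx, hy, hxy, hvalue, hderiv⟩
    obtain ⟨e, rfl, rfl⟩ := exists_orthonormalBasis_pair finrank_euclideanSpace_fin hx hy hxy
    refine ⟨e, fun w hw => ENNReal.ofReal_le_ofReal (Real.exp_le_exp.2 (neg_le_neg ?_))⟩
    have hsmall := norm_sphereEval_le_of_mem_box hγω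
      (fun i => (totalDegree_formOfCoeffs_le _).trans (hdeg i)) hd hρ hρ' hvalue hderiv hw
    rw [div_le_iff₀ (by positivity), hε, div_pow, Real.sq_sqrt hm₀.le, mul_div_cancel₀ _ hm₀.ne']
    gcongr

end SphereTails

section Kappa

variable {n m : ℕ} {deg : Fin m → ℕ}

/-- The square of `L(P, x)` with the smallest singular value replaced by the size of the scaled
derivative in the tangent direction `y`; the minimum over all unit `y` is `L(P, x) ^ 2`. -/
noncomputable def directionalLSq (deg : Fin m → ℕ) (P : Fin m → MvPolynomial (Fin n) ℝ)
    (x y : EuclideanSpace ℝ (Fin n)) : ℝ :=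
  ∑ i, dirDeriv P x y i ^ 2 / deg i + ‖evalSystem P x‖ ^ 2

lemma inv_degMatrix (hdeg : ∀ i, 0 < deg i) :
    (degMatrix deg)⁻¹ = Matrix.diagonal fun i => (√(deg i : ℝ))⁻¹ := by
  refine Matrix.inv_eq_right_inv ?_
  rw [degMatrix, Matrix.diagonal_mul_diagonal, ← Matrix.diagonal_one]
  congr 1
  funext i
  exact mul_inv_cancel₀ (Real.sqrt_pos.2 (Nat.cast_pos.2 (hdeg i))).ne'

lemma norm_sq_scaledTangentDeriv (hdeg : ∀ i, 0 < deg i) (P : Fin m → MvPolynomial (Fin n) ℝ)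
    (x : EuclideanSpace ℝ (Fin n)) (y : ↥((ℝ ∙ x)ᗮ)) :
    ‖scaledTangentDeriv deg P x y‖ ^ 2 = ∑ i, dirDeriv P x y i ^ 2 / deg i := by
  rw [EuclideanSpace.real_norm_sq_eq]
  refine Finset.sum_congr rfl fun i _ => ?_
  have happly : scaledTangentDeriv deg P x y i = (√(deg i : ℝ))⁻¹ * dirDeriv P x y i := by
    rw [scaledTangentDeriv, inv_degMatrix hdeg]
    simp [Matrix.toLpLin_apply, Matrix.mulVec, dotProduct, Matrix.diagonal_mul, dirDeriv, jacobian,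
      Finset.mul_sum, mul_assoc]
  rw [happly, mul_pow, inv_pow, Real.sq_sqrt (Nat.cast_nonneg _), inv_mul_eq_div]

lemma localL_le_sqrt_directionalLSq (hdeg : ∀ i, 0 < deg i) (P : Fin m → MvPolynomial (Fin n) ℝ)
    {x y : EuclideanSpace ℝ (Fin n)} (hy : ‖y‖ = 1) (hxy : inner ℝ x y = 0) :
    localL deg P x ≤ √(directionalLSq deg P x y) := by
  let y' : ↥((ℝ ∙ x)ᗮ) := ⟨y, Submodule.mem_orthogonal_singleton_iff_inner_right.2 hxy⟩
  have hy' : ‖y'‖ = 1 := hy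
  have hmin : minSingularValue (scaledTangentDeriv deg P x) ≤ ‖scaledTangentDeriv deg P x y'‖ := by
    simpa only [hy', mul_one] using minSingularValue_mul_norm_le (scaledTangentDeriv deg P x) y'
  unfold localL directionalLSq
  rw [← norm_sq_scaledTangentDeriv hdeg P x y']
  gcongr
  exact minSingularValue_nonneg _

lemma exists_localL_eq_sqrt_directionalLSq (hn : 2 ≤ n) (hdeg : ∀ i, 0 < deg i)
    (P : Fin m → MvPolynomial (Fin n) ℝ) (x : EuclideanSpace ℝ (Fin n)) :
    ∃ y, ‖y‖ = 1 ∧ inner ℝ x y = 0 ∧ localL deg P x = √(directionalLSq deg P x y) := by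
  have hspan : Module.finrank ℝ ↥(ℝ ∙ x) ≤ 1 :=
    (finrank_span_le_card ({x} : Set _)).trans (by simp)
  have hsum := (ℝ ∙ x).finrank_add_finrank_orthogonal
  rw [finrank_euclideanSpace_fin] at hsum
  have : Nontrivial ↥((ℝ ∙ x)ᗮ) := Module.nontrivial_of_finrank_pos (R := ℝ) (by omega)
  obtain ⟨y, hy, hmin⟩ := exists_norm_eq_minSingularValue (scaledTangentDeriv deg P x)
  refine ⟨y, hy, Submodule.mem_orthogonal_singleton_iff_inner_right.1 y.2, ?_⟩
  rw [localL, directionalLSq, ← hmin, norm_sq_scaledTangentDeriv hdeg]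

lemma localL_nonneg (P : Fin m → MvPolynomial (Fin n) ℝ) (x : EuclideanSpace ℝ (Fin n)) :
    0 ≤ localL deg P x :=
  Real.sqrt_nonneg _

lemma weylNorm_nonneg (P : Fin m → MvPolynomial (Fin n) ℝ) : 0 ≤ weylNorm deg P :=
  Real.sqrt_nonneg _

lemma localKappa_le_kappa (P : Fin m → MvPolynomial (Fin n) ℝ) {x : EuclideanSpace ℝ (Fin n)}
    (hx : ‖x‖ = 1) : localKappa deg P x ≤ kappa deg P :=
  le_iSup₂ (f := fun x _ => localKappa deg P x) x (mem_sphere_zero_iff_norm.2 hx)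

lemma localKappa_eq_div {P : Fin m → MvPolynomial (Fin n) ℝ} (hP : 0 < weylNorm deg P)
    (x : EuclideanSpace ℝ (Fin n)) :
    localKappa deg P x = ENNReal.ofReal (weylNorm deg P) / ENNReal.ofReal (localL deg P x) := by
  rw [localKappa]
  split_ifs with hL
  · rw [hL, ENNReal.ofReal_zero, ENNReal.div_zero (ENNReal.ofReal_pos.2 hP).ne']
  · exact ENNReal.ofReal_div_of_pos ((localL_nonneg P x).lt_of_ne' hL)

lemma mul_localL_le_of_lt_localKappa {P : Fin m → MvPolynomial (Fin n) ℝ}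
    {x : EuclideanSpace ℝ (Fin n)} {a : ℝ} (h : ENNReal.ofReal a < localKappa deg P x) :
    a * localL deg P x ≤ weylNorm deg P := by
  rw [localKappa] at h
  split_ifs at h with hL
  · rw [hL, mul_zero]
    exact weylNorm_nonneg P
  · have hpos : 0 < localL deg P x := (localL_nonneg P x).lt_of_ne' hL
    exact ((le_div_iff₀ hpos).1 ((ENNReal.ofReal_lt_ofReal_iff'.1 h).1.le))

lemma exists_mul_sqrt_directionalLSq_le_of_lt_kappa (hn : 2 ≤ n) (hdeg : ∀ i, 0 < deg i)
    {P : Fin m → MvPolynomial (Fin n) ℝ} {a : ℝ} (h : ENNReal.ofReal a < kappa deg P) :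
    ∃ x y, ‖x‖ = 1 ∧ ‖y‖ = 1 ∧ inner ℝ x y = 0 ∧
      a * √(directionalLSq deg P x y) ≤ weylNorm deg P := by
  simp only [kappa, lt_iSup_iff] at h
  obtain ⟨x, hx, hlt⟩ := h
  obtain ⟨y, hy, hxy, hL⟩ := exists_localL_eq_sqrt_directionalLSq hn hdeg P x
  exact ⟨x, y, mem_sphere_zero_iff_norm.1 hx, hy, hxy, hL ▸ mul_localL_le_of_lt_localKappa hlt⟩

end Kappa

section KappaForms

variable {n m d : ℕ} {deg : Fin m → ℕ}

lemma weylNorm_forms (c : Coeffs n deg) : weylNorm deg (forms c) = √(∑ i, ‖c i‖ ^ 2) := by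
  simp only [weylNorm, weylSq_formOfCoeffs]

lemma weylNorm_forms_pos {c : Coeffs n deg} (hc : c ≠ 0) : 0 < weylNorm deg (forms c) := by
  rw [weylNorm_forms, Real.sqrt_pos]
  obtain ⟨i, hi⟩ := Function.ne_iff.1 hc
  have : 0 < ‖c i‖ := norm_pos_iff.2 hi
  exact Finset.sum_pos' (fun i _ => sq_nonneg _) ⟨i, Finset.mem_univ i, by positivity⟩

lemma isSphereBound_weylNorm (c : Coeffs n deg) :
    IsSphereBound (forms c) (weylNorm deg (forms c)) := by
  intro x hx
  rw [weylNorm_forms]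
  refine Real.le_sqrt_of_sq_le ?_
  rw [norm_sq_evalSystem_forms]
  refine Finset.sum_le_sum fun i _ => sq_le_sq.2 ?_
  rw [abs_norm]
  simpa only [norm_veronese, hx, one_pow, one_mul] using
    abs_real_inner_le_norm (veronese (deg i) x) (c i)

lemma sum_sq_dirDeriv_div_le (hdeg : ∀ i, 0 < deg i) (P : Fin m → MvPolynomial (Fin n) ℝ)
    (x y : EuclideanSpace ℝ (Fin n)) :
    ∑ i, dirDeriv P x y i ^ 2 / deg i ≤ ‖dirDeriv P x y‖ ^ 2 := by
  rw [EuclideanSpace.real_norm_sq_eq]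
  exact Finset.sum_le_sum fun i _ => div_le_self (sq_nonneg _) (Nat.one_le_cast.2 (hdeg i))

lemma localL_forms_le (hdeg : ∀ i, 0 < deg i) (hd : 0 < d) (hdegd : ∀ i, deg i ≤ d)
    (c : Coeffs n deg) {x y : EuclideanSpace ℝ (Fin n)} (hx : ‖x‖ = 1) (hy : ‖y‖ = 1)
    (hxy : inner ℝ x y = 0) : localL deg (forms c) x ≤ 4 * d * weylNorm deg (forms c) := by
  set Γ := weylNorm deg (forms c)
  have hΓ : IsSphereBound (forms c) Γ := isSphereBound_weylNorm c
  have hΓ₀ : 0 ≤ Γ := hΓ.nonneg hx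
  have hd₁ : (1 : ℝ) ≤ d := by exact_mod_cast hd
  refine (localL_le_sqrt_directionalLSq hdeg _ hy hxy).trans
    (Real.sqrt_le_iff.2 ⟨by positivity, ?_⟩)
  have hderiv : ‖dirDeriv (forms c) x y‖ ≤ 3 * d * Γ := hΓ.norm_dirDeriv_le
    (fun i => (totalDegree_formOfCoeffs_le _).trans (hdegd i)) hd hx hy hxy
  calc directionalLSq deg (forms c) x y
      ≤ ‖dirDeriv (forms c) x y‖ ^ 2 + ‖evalSystem (forms c) x‖ ^ 2 := by
        unfold directionalLSq
        gcongr
        exact sum_sq_dirDeriv_div_le hdeg _ x y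
    _ ≤ (3 * d * Γ) ^ 2 + (1 * Γ) ^ 2 := by
        gcongr
        simpa using hΓ x hx
    _ ≤ (3 * d * Γ) ^ 2 + (d * Γ) ^ 2 := by gcongr
    _ ≤ (4 * d * Γ) ^ 2 := by nlinarith [sq_nonneg (d * Γ)]

lemma le_kappa_forms {k : ℕ} (hdeg : ∀ i, 0 < deg i) (hd : 0 < d) (hdegd : ∀ i, deg i ≤ d)
    (c : Coeffs (k + 2) deg) : ENNReal.ofReal (1 / (4 * d)) ≤ kappa deg (forms c) := by
  let e := EuclideanSpace.basisFun (Fin (k + 2)) ℝ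
  refine le_trans ?_ (localKappa_le_kappa (forms c) (e.norm_eq_one 0))
  rw [localKappa]
  split_ifs with hL
  · exact le_top
  · have hpos := (localL_nonneg (forms c) (e 0)).lt_of_ne' hL
    refine ENNReal.ofReal_le_ofReal ?_
    rw [div_le_div_iff₀ (by positivity) hpos, one_mul, mul_comm]
    exact localL_forms_le hdeg hd hdegd c (e.norm_eq_one 0) (e.norm_eq_one 1)
      (e.inner_eq_zero Fin.zero_ne_one)

lemma kappa_forms_zero {k : ℕ} (hdeg : ∀ i, 0 < deg i) :
    kappa deg (forms (0 : Coeffs (k + 2) deg)) = ∞ := by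
  let e := EuclideanSpace.basisFun (Fin (k + 2)) ℝ
  have hL : localL deg (forms (0 : Coeffs (k + 2) deg)) (e 0) = 0 := by
    refine le_antisymm ?_ (localL_nonneg _ _)
    simpa [weylNorm_forms] using localL_forms_le hdeg (Nat.succ_pos (Finset.univ.sup deg))
      (fun i => (Finset.le_sup (Finset.mem_univ i)).trans (Nat.le_succ _)) 0 (e.norm_eq_one 0)
      (e.norm_eq_one 1) (e.inner_eq_zero Fin.zero_ne_one)
  refine top_le_iff.1 (le_of_eq_of_le ?_ (localKappa_le_kappa _ (e.norm_eq_one 0)))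
  rw [localKappa, if_pos hL]

/-- The pairs of orthogonal unit vectors of `ℝⁿ`. -/
def orthonormalPairs (n : ℕ) : Set (EuclideanSpace ℝ (Fin n) × EuclideanSpace ℝ (Fin n)) :=
  {p | ‖p.1‖ = 1 ∧ ‖p.2‖ = 1 ∧ inner ℝ p.1 p.2 = 0}

lemma kappa_eq_div_iInf {P : Fin m → MvPolynomial (Fin n) ℝ} (hn : 2 ≤ n)
    (hdeg : ∀ i, 0 < deg i) (hP : 0 < weylNorm deg P) :
    kappa deg P = ENNReal.ofReal (weylNorm deg P) /
      ⨅ p ∈ orthonormalPairs n, ENNReal.ofReal √(directionalLSq deg P p.1 p.2) := by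
  simp only [div_eq_mul_inv, ENNReal.inv_iInf, ENNReal.mul_iSup]
  apply le_antisymm
  · refine iSup₂_le fun x hx => ?_
    obtain ⟨y, hy, hxy, hL⟩ := exists_localL_eq_sqrt_directionalLSq hn hdeg P x
    rw [localKappa_eq_div hP, hL, div_eq_mul_inv]
    exact le_iSup₂_of_le (x, y) ⟨mem_sphere_zero_iff_norm.1 hx, hy, hxy⟩ le_rfl
  · refine iSup₂_le fun p ⟨hx, hy, hxy⟩ => le_trans ?_ (localKappa_le_kappa P hx)
    rw [localKappa_eq_div hP, ← div_eq_mul_inv]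
    gcongr
    exact localL_le_sqrt_directionalLSq hdeg P hy hxy

lemma continuous_eval_forms (x : EuclideanSpace ℝ (Fin n)) (i : Fin m) :
    Continuous fun c : Coeffs n deg => evalSystem (forms c) x i := by
  simp only [evalSystem_forms_apply]
  fun_prop

lemma continuous_dirDeriv_forms (x y : EuclideanSpace ℝ (Fin n)) (i : Fin m) :
    Continuous fun c : Coeffs n deg => dirDeriv (forms c) x y i := by
  have hpderiv (j) : Continuous fun c : Coeffs n deg =>
      MvPolynomial.eval (fun l => x l) (MvPolynomial.pderiv j (forms c i)) := by
    simp only [forms, formOfCoeffs, map_sum, MvPolynomial.pderiv_monomial,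
      MvPolynomial.eval_monomial]
    fun_prop
  exact continuous_finsetSum Finset.univ fun j _ => (hpderiv j).mul (continuous_const (y := y j))

lemma continuous_directionalLSq_forms (x y : EuclideanSpace ℝ (Fin n)) :
    Continuous fun c : Coeffs n deg => directionalLSq deg (forms c) x y := by
  simp only [directionalLSq, EuclideanSpace.real_norm_sq_eq]
  exact (continuous_finsetSum _ fun i _ =>
      ((continuous_dirDeriv_forms x y i).pow 2).div_const _).add
    (continuous_finsetSum _ fun i _ => (continuous_eval_forms x i).pow 2)

lemma measurable_kappa_forms {k : ℕ} (hdeg : ∀ i, 0 < deg i) :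
    Measurable fun c : Coeffs (k + 2) deg => kappa deg (forms c) := by
  classical
  have hcases : (fun c : Coeffs (k + 2) deg => kappa deg (forms c)) = fun c =>
      if c ∈ ({0} : Set (Coeffs (k + 2) deg)) then ∞ else ENNReal.ofReal (weylNorm deg (forms c)) /
        ⨅ p ∈ orthonormalPairs (k + 2), ENNReal.ofReal √(directionalLSq deg (forms c) p.1 p.2) := by
    funext c
    split_ifs with hc
    · rw [Set.mem_singleton_iff.1 hc, kappa_forms_zero hdeg]
    · exact kappa_eq_div_iInf (by omega) hdeg (weylNorm_forms_pos hc)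
  rw [hcases]
  refine Measurable.ite (measurableSet_singleton _) measurable_const (Measurable.div ?_ ?_)
  · simp only [weylNorm_forms]
    exact (ENNReal.continuous_ofReal.comp (by fun_prop)).measurable
  · apply UpperSemicontinuous.measurable
    refine upperSemicontinuous_biInf fun p _ => Continuous.upperSemicontinuous ?_
    exact ENNReal.continuous_ofReal.comp (continuous_directionalLSq_forms p.1 p.2).sqrt

end KappaForms

section NearlySingular

variable {n m d : ℕ} {deg : Fin m → ℕ}

lemma norm_dirDeriv_sq_le (hdeg : ∀ i, 0 < deg i) (hdegd : ∀ i, deg i ≤ d)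
    (P : Fin m → MvPolynomial (Fin n) ℝ) (x y : EuclideanSpace ℝ (Fin n)) :
    ‖dirDeriv P x y‖ ^ 2 ≤ d * ∑ i, dirDeriv P x y i ^ 2 / deg i := by
  rw [EuclideanSpace.real_norm_sq_eq, Finset.mul_sum]
  refine Finset.sum_le_sum fun i _ => ?_
  have hpos : (0 : ℝ) < deg i := by exact_mod_cast hdeg i
  have hle : (deg i : ℝ) ≤ d := by exact_mod_cast hdegd i
  rw [← mul_div_assoc, le_div_iff₀ hpos, mul_comm]
  gcongr

lemma isNearlySingular_of_directionalLSq_le (hdeg : ∀ i, 0 < deg i) (hdegd : ∀ i, deg i ≤ d)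
    {P : Fin m → MvPolynomial (Fin n) ℝ} {x y : EuclideanSpace ℝ (Fin n)} (hx : ‖x‖ = 1)
    (hy : ‖y‖ = 1) (hxy : inner ℝ x y = 0) {α : ℝ} (hα : 0 ≤ α)
    (hL : directionalLSq deg P x y ≤ α ^ 2) : IsNearlySingular P d α := by
  have hsum : 0 ≤ ∑ i, dirDeriv P x y i ^ 2 / deg i := by positivity
  rw [directionalLSq] at hL
  refine ⟨x, y, hx, hy, hxy, le_of_sq_le_sq (by linarith) hα,
    le_of_sq_le_sq ?_ (by positivity)⟩
  have hdd : (d : ℝ) ≤ d ^ 2 := by exact_mod_cast Nat.le_self_pow two_ne_zero d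
  calc ‖dirDeriv P x y‖ ^ 2 ≤ d * ∑ i, dirDeriv P x y i ^ 2 / deg i :=
        norm_dirDeriv_sq_le hdeg hdegd P x y
    _ ≤ d ^ 2 * α ^ 2 := by
        gcongr
        linarith [sq_nonneg ‖evalSystem P x‖]
    _ = (d * α) ^ 2 := by ring

lemma isNearlySingular_of_le_kappa (hn : 2 ≤ n) (hdeg : ∀ i, 0 < deg i)
    (hdegd : ∀ i, deg i ≤ d) {P : Fin m → MvPolynomial (Fin n) ℝ} {s α : ℝ} (hs : 0 < s)
    (hα : 0 ≤ α) (hκ : ENNReal.ofReal s ≤ kappa deg P) (hP : 2 * weylNorm deg P ≤ s * α) :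
    IsNearlySingular P d α := by
  have hhalf : ENNReal.ofReal (s / 2) < kappa deg P :=
    ((ENNReal.ofReal_lt_ofReal_iff hs).2 (half_lt_self hs)).trans_le hκ
  obtain ⟨x, y, hx, hy, hxy, hL⟩ := exists_mul_sqrt_directionalLSq_le_of_lt_kappa hn hdeg hhalf
  refine isNearlySingular_of_directionalLSq_le hdeg hdegd hx hy hxy hα
    ((Real.sqrt_le_left hα).1 (le_of_mul_le_mul_left ?_ hs))
  linarith

lemma measure_le_kappa_le_add {Ω : Type*} [MeasurableSpace Ω] {μ : Measure Ω}
    {X : (i : Fin m) → Ω → EuclideanSpace ℝ (MultiIndex n (deg i))} {K s r α : ℝ}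
    (hn : 2 ≤ n) (hdeg : ∀ i, 0 < deg i) (hdegd : ∀ i, deg i ≤ d) (hs : 0 < s) (hα : 0 ≤ α)
    (hr : 16 * K ^ 2 * r ≤ (s * α) ^ 2) (γ : ℝ) :
    μ {ω | ENNReal.ofReal s ≤ kappa deg (randomForms X ω)} ≤
      μ {ω | 4 * K ^ 2 * r ≤ ∑ i, ‖X i ω‖ ^ 2} +
        (μ {ω | ¬ IsSphereBound (randomForms X ω) γ} +
          μ {ω | IsSphereBound (randomForms X ω) γ ∧
            IsNearlySingular (randomForms X ω) d α}) := by
  refine (measure_mono fun ω hω => ?_).trans ((measure_union_le _ _).trans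
    (add_le_add_right (measure_union_le _ _) _))
  by_cases hnorm : 4 * K ^ 2 * r ≤ ∑ i, ‖X i ω‖ ^ 2
  · exact Or.inl hnorm
  by_cases hbound : IsSphereBound (randomForms X ω) γ
  · refine Or.inr (Or.inr ⟨hbound, isNearlySingular_of_le_kappa hn hdeg hdegd hs hα hω ?_⟩)
    refine abs_le_of_sq_le_sq' ?_ (by positivity) |>.2
    rw [mul_pow, weylNorm_forms, Real.sq_sqrt (by positivity)]
    linarith
  · exact Or.inr (Or.inl hbound)

end NearlySingular

section LogRatio

/-- The ratio `log t / b`, truncated below at `1`. It is `1` up to the threshold `t = exp b`, which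
lets a single formula cover all regimes of the tail estimate. -/
noncomputable def logRatio (b t : ℝ) : ℝ :=
  max 1 (Real.log t / b)

variable {b t : ℝ}

lemma one_le_logRatio (b t : ℝ) : 1 ≤ logRatio b t :=
  le_max_left _ _

lemma log_le_logRatio_mul (hb : 0 < b) (t : ℝ) : Real.log t ≤ logRatio b t * b :=
  (div_le_iff₀ hb).1 (le_max_right _ _)

lemma logRatio_le_self (hb : 1 ≤ b) (ht : 1 ≤ t) : logRatio b t ≤ t :=
  max_le ht ((div_le_self (Real.log_nonneg ht) hb).trans
    (Real.log_le_self (zero_le_one.trans ht)))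

lemma logRatio_anti {b' : ℝ} (hb : 0 < b) (hbb' : b ≤ b') (ht : 1 ≤ t) :
    logRatio b' t ≤ logRatio b t :=
  max_le_max le_rfl (div_le_div_of_nonneg_left (Real.log_nonneg ht) hb hbb')

lemma logRatio_of_le_exp (hb : 0 < b) (ht : 0 < t) (htb : t ≤ Real.exp b) : logRatio b t = 1 :=
  max_eq_left ((div_le_one hb).2 ((Real.log_le_iff_le_exp ht).2 htb))

lemma logRatio_of_exp_le (hb : 0 < b) (htb : Real.exp b ≤ t) : logRatio b t = Real.log t / b :=
  max_eq_right ((one_le_div hb).2 ((Real.le_log_iff_exp_le ((Real.exp_pos b).trans_le htb)).2 htb))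

lemma logRatio_le_rpow (hb : 0 < b) (ht : 1 ≤ t) : logRatio b t ≤ t ^ (1 / (2 * b)) := by
  have hexp : Real.exp 1 * Real.exp (Real.log t / b / 2 - 1) = Real.exp (Real.log t / b / 2) := by
    rw [← Real.exp_add, add_sub_cancel]
  have hv : 0 ≤ Real.log t / b := div_nonneg (Real.log_nonneg ht) hb.le
  calc logRatio b t ≤ Real.exp (Real.log t / b / 2) := by
        refine max_le (Real.one_le_exp (by positivity)) ?_
        rw [← hexp]
        nlinarith [Real.exp_one_gt_d9, Real.add_one_le_exp (Real.log t / b / 2 - 1)]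
    _ = t ^ (1 / (2 * b)) := by
        rw [Real.rpow_def_of_pos (zero_lt_one.trans_le ht)]
        congr 1
        field_simp

/-- The factor by which the tail bound for the condition number exceeds `t ^ (-1 / 2)`, for a
system of `m` equations with `N` coefficients, where `l` stands for `log (e d)`. -/
noncomputable def tailFactor (m : ℕ) (l N t : ℝ) : ℝ :=
  logRatio (2 * m * l) t ^ (((m : ℝ) - 1 / 2) / 2) * logRatio (2 * N) t ^ (1 / 4 : ℝ)

variable {m : ℕ} {l N : ℝ}

lemma one_le_tailFactor (hm : 0 < m) (l N t : ℝ) : 1 ≤ tailFactor m l N t := by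
  have hm₁ : (1 : ℝ) ≤ m := by exact_mod_cast hm
  exact one_le_mul_of_one_le_of_one_le
    (Real.one_le_rpow (one_le_logRatio _ _) (by linarith))
    (Real.one_le_rpow (one_le_logRatio _ _) (by norm_num))

lemma tailFactor_of_le_exp (hm : 0 < m) (hl : 0 < l) (hN : m * l ≤ N) (ht : 0 < t)
    (htl : t ≤ Real.exp (2 * m * l)) : tailFactor m l N t = 1 := by
  have hml : 0 < m * l := by positivity
  rw [tailFactor, logRatio_of_le_exp (by positivity) ht htl,
    logRatio_of_le_exp (by linarith) ht (htl.trans (Real.exp_le_exp.2 (by linarith))),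
    Real.one_rpow, Real.one_rpow, one_mul]

lemma tailFactor_of_exp_le_of_le_exp (hm : 0 < m) (hl : 0 < l) (hN : m * l ≤ N)
    (htl : Real.exp (2 * m * l) ≤ t) (htN : t ≤ Real.exp (2 * N)) :
    tailFactor m l N t = (Real.log t / (2 * m * l)) ^ (((m : ℝ) - 1 / 2) / 2) := by
  have hml : 0 < m * l := by positivity
  rw [tailFactor, logRatio_of_exp_le (by positivity) htl,
    logRatio_of_le_exp (by linarith) ((Real.exp_pos _).trans_le htl) htN, Real.one_rpow, mul_one]

lemma tailFactor_of_exp_le (hm : 0 < m) (hl : 0 < l) (hN : m * l ≤ N)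
    (htN : Real.exp (2 * N) ≤ t) :
    tailFactor m l N t = (Real.log t / (2 * N)) ^ (1 / 4 : ℝ) *
      (Real.log t / (2 * m * l)) ^ (((m : ℝ) - 1 / 2) / 2) := by
  have hml : 0 < m * l := by positivity
  rw [tailFactor, logRatio_of_exp_le (by positivity)
    ((Real.exp_le_exp.2 (by linarith)).trans htN), logRatio_of_exp_le (by linarith) htN, mul_comm]

lemma tailFactor_le_rpow (hm : 0 < m) (hl : 0 < l) (hN : m * l ≤ N) (ht : 1 ≤ t) :
    tailFactor m l N t ≤ t ^ (1 / (8 * l)) := by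
  have hb : 0 < 2 * m * l := by positivity
  have hS : 0 < logRatio (2 * m * l) t := zero_lt_one.trans_le (one_le_logRatio _ _)
  have hT : 0 < logRatio (2 * N) t := zero_lt_one.trans_le (one_le_logRatio _ _)
  calc tailFactor m l N t
      ≤ logRatio (2 * m * l) t ^ (((m : ℝ) - 1 / 2) / 2) *
          logRatio (2 * m * l) t ^ (1 / 4 : ℝ) := by
        unfold tailFactor
        gcongr
        exact logRatio_anti hb (by linarith) ht
    _ = logRatio (2 * m * l) t ^ ((m : ℝ) / 2) := by
        rw [← Real.rpow_add hS]
        congr 1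
        ring
    _ ≤ (t ^ (1 / (2 * (2 * m * l)))) ^ ((m : ℝ) / 2) := by
        gcongr
        exact logRatio_le_rpow hb ht
    _ = t ^ (1 / (8 * l)) := by
        rw [← Real.rpow_mul (by linarith)]
        congr 1
        field_simp
        norm_num

lemma sqrt_sqrt_div_mul_sqrt_pow {S T : ℝ} (hS : 0 < S) (hT : 0 < T) (ht : 0 < t) (m : ℕ) :
    √(√(T / S) / t) * √S ^ m
      = t ^ (-(1 / 2) : ℝ) * (S ^ (((m : ℝ) - 1 / 2) / 2) * T ^ (1 / 4 : ℝ)) := by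
  have hsqrt : √(√(T / S) / t)
      = T ^ (1 / 4 : ℝ) * (S ^ (1 / 4 : ℝ))⁻¹ * t ^ (-(1 / 2) : ℝ) := by
    rw [Real.sqrt_div (Real.sqrt_nonneg _), Real.rpow_neg ht.le, ← Real.sqrt_eq_rpow,
      div_eq_mul_inv]
    congr 1
    rw [Real.sqrt_eq_rpow, Real.sqrt_eq_rpow, ← Real.rpow_mul (by positivity),
      Real.div_rpow hT.le hS.le, div_eq_mul_inv]
    norm_num
  have hpow : √S ^ m = S ^ ((m : ℝ) / 2) := by
    rw [Real.sqrt_eq_rpow, ← Real.rpow_natCast, ← Real.rpow_mul hS.le]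
    congr 1
    ring
  have hsplit : S ^ (((m : ℝ) - 1 / 2) / 2) = S ^ ((m : ℝ) / 2) * (S ^ (1 / 4 : ℝ))⁻¹ := by
    rw [← Real.rpow_neg hS.le, ← Real.rpow_add hS]
    congr 1
    ring
  rw [hsqrt, hpow, hsplit]
  ring

end LogRatio

section TailBound

lemma mul_add_one_le_choose (a b : ℕ) : a * b + 1 ≤ (a + b).choose b := by
  induction a with
  | zero => simp
  | succ a ih =>
    rcases b with _ | b
    · simp
    · have hpascal : (a + 1 + (b + 1)).choose (b + 1)
          = (a + (b + 1)).choose b + (a + (b + 1)).choose (b + 1) := by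
        rw [add_right_comm, Nat.choose_succ_succ]
      have hmono : b + 1 ≤ (a + (b + 1)).choose b := by
        simpa [Nat.choose_succ_self_right] using
          Nat.choose_le_choose b (show b + 1 ≤ a + (b + 1) by omega)
      rw [hpascal]
      linarith

variable {k m d : ℕ} {deg : Fin m → ℕ} {K c₀ t : ℝ}

lemma log_exp_one_mul (hd : 0 < d) : Real.log (Real.exp 1 * d) = 1 + Real.log d := by
  rw [Real.log_mul (Real.exp_ne_zero _) (by positivity), Real.log_exp]

lemma one_le_log_exp_one_mul (hd : 0 < d) : 1 ≤ Real.log (Real.exp 1 * d) := by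
  rw [log_exp_one_mul hd]
  linarith [Real.log_nonneg (show (1 : ℝ) ≤ d by exact_mod_cast hd)]

lemma log_exp_one_mul_le (hd : 0 < d) : Real.log (Real.exp 1 * d) ≤ d := by
  rw [log_exp_one_mul hd]
  linarith [Real.log_le_sub_one_of_pos (show (0 : ℝ) < d by exact_mod_cast hd)]

lemma mul_log_le_sum_choose (hm : m = k + 1) (hd : 0 < d) (hmax : ∃ i, deg i = d) :
    m * Real.log (Real.exp 1 * d) ≤ ↑(∑ i, (k + 2 + deg i - 1).choose (deg i)) := by
  obtain ⟨i, rfl⟩ := hmax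
  have hterm : m * deg i ≤ (k + 2 + deg i - 1).choose (deg i) := by
    rw [show k + 2 + deg i - 1 = m + deg i by omega]
    exact (Nat.le_succ _).trans (mul_add_one_le_choose m (deg i))
  have hsum : m * deg i ≤ ∑ j, (k + 2 + deg j - 1).choose (deg j) :=
    hterm.trans (Finset.single_le_sum (f := fun j => (k + 2 + deg j - 1).choose (deg j))
      (fun _ _ => Nat.zero_le _) (Finset.mem_univ i))
  calc m * Real.log (Real.exp 1 * deg i) ≤ m * deg i := by
        gcongr
        exact log_exp_one_mul_le hd
    _ ≤ _ := by exact_mod_cast hsum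

lemma exp_neg_five_mul_le {A F : ℝ} (hd : 2 ≤ d) (ht : 0 < t) (hF : 1 ≤ F)
    (hA : 2 * Real.log (Real.exp 1 * d) ≤ A) (htA : Real.log t ≤ 2 * A) :
    Real.exp (-(5 * A)) ≤ t ^ (-(1 / 2) : ℝ) * F / (24 * d) := by
  have hd₂ : (2 : ℝ) ≤ d := by exact_mod_cast hd
  have hed : (5 : ℝ) ≤ Real.exp 1 * d := by nlinarith [Real.exp_one_gt_d9]
  have hfirst : Real.exp (-A) ≤ t ^ (-(1 / 2) : ℝ) := by
    rw [Real.rpow_def_of_pos ht]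
    exact Real.exp_le_exp.2 (by linarith)
  have hlast : Real.exp (-(4 * A)) ≤ 1 / (24 * d) := by
    rw [Real.exp_neg, ← one_div]
    refine one_div_le_one_div_of_le (by positivity) ?_
    calc 24 * (d : ℝ) ≤ 5 ^ 7 * (Real.exp 1 * d) := by
          nlinarith [Real.exp_one_gt_d9]
      _ ≤ (Real.exp 1 * d) ^ 7 * (Real.exp 1 * d) := by gcongr
      _ = Real.exp ((8 : ℕ) * Real.log (Real.exp 1 * d)) := by
          rw [Real.exp_nat_mul, Real.exp_log (by positivity)]
          ring
      _ ≤ Real.exp (4 * A) := Real.exp_le_exp.2 (by push_cast; linarith)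
  calc Real.exp (-(5 * A)) = Real.exp (-A) * Real.exp (-(4 * A)) := by
        rw [← Real.exp_add]
        congr 1
        ring
    _ ≤ t ^ (-(1 / 2) : ℝ) * F * (1 / (24 * d)) := by
        gcongr
        exact hfirst.trans (le_mul_of_one_le_right (by positivity) hF)
    _ = _ := mul_one_div _ _

lemma exp_six_pow_le (k : ℕ) : Real.exp 6 ^ (k + 2) ≤ Real.exp 12 ^ (k + 1) := by
  have hsq : Real.exp 12 = Real.exp 6 ^ 2 := by
    rw [← Real.exp_nat_mul]
    norm_num
  rw [hsq, ← pow_mul]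
  exact pow_le_pow_right₀ (Real.one_le_exp (by norm_num)) (by omega)

lemma exp_neg_mul_le_exp_neg_five_mul {A : ℝ} (hd : 0 < d)
    (hA : ↑(k + 1) * Real.log (Real.exp 1 * d) ≤ A) :
    Real.exp (-(32 * A)) * (Real.exp 6 ^ (k + 2) * (12 * d) ^ (k + 1) * 9 ^ (k + 1))
      ≤ Real.exp (-(5 * A)) := by
  set l := Real.log (Real.exp 1 * d)
  have hl : 1 ≤ l := one_le_log_exp_one_mul hd
  have h108 : (108 : ℝ) ≤ Real.exp 5 := by
    calc (108 : ℝ) ≤ 2.7 ^ 5 := by norm_num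
      _ ≤ Real.exp 1 ^ 5 := by
          gcongr
          linarith [Real.exp_one_gt_d9]
      _ = Real.exp 5 := by rw [← Real.exp_nat_mul]; norm_num
  have hd_exp : (d : ℝ) ≤ Real.exp l :=
    (le_mul_of_one_le_left d.cast_nonneg (Real.one_le_exp zero_le_one)).trans
      (Real.le_exp_log _)
  calc Real.exp (-(32 * A)) * (Real.exp 6 ^ (k + 2) * (12 * d) ^ (k + 1) * 9 ^ (k + 1))
      ≤ Real.exp (-(32 * A)) * (Real.exp 12 ^ (k + 1) * (12 * d) ^ (k + 1) * 9 ^ (k + 1)) := by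
        gcongr
        exact exp_six_pow_le k
    _ = Real.exp (-(32 * A)) * (Real.exp 12 * (108 * d)) ^ (k + 1) := by
        rw [← mul_pow, ← mul_pow]
        ring
    _ ≤ Real.exp (-(32 * A)) * (Real.exp 12 * (Real.exp 5 * Real.exp l)) ^ (k + 1) := by gcongr
    _ = Real.exp (-(32 * A) + ↑(k + 1) * (17 + l)) := by
        rw [← Real.exp_add, ← Real.exp_add, ← Real.exp_nat_mul, ← Real.exp_add]
        ring_nf
    _ ≤ Real.exp (-(5 * A)) := by
        refine Real.exp_le_exp.2 ?_
        have hcard : (↑(k + 1) : ℝ) ≤ ↑(k + 1) * l := le_mul_of_one_le_right (by positivity) hl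
        linarith

/-- The universal constant of the theorem. It absorbs the constants `36 * 3` of the small ball
estimate, `16` of the sphere bound and `exp 12` of the volume comparison, with a factor `24` to
spare. -/
noncomputable def condConst : ℝ := 24 * (108 * 16 * Real.exp 12)

lemma condConst_pos : 0 < condConst := by
  unfold condConst
  positivity

lemma one_le_mul_condConst {Ω : Type*} [MeasurableSpace Ω] {μ : Measure Ω}
    [IsProbabilityMeasure μ] {n e : ℕ} {X : Ω → EuclideanSpace ℝ (MultiIndex n e)} (hn : 0 < n)
    (hK : 0 < K) (hsub : SubGaussianWith μ X K) (hball : SmallBallWith μ X c₀) :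
    1 ≤ K * c₀ * condConst := by
  have : Nonempty (MultiIndex n e) := by
    rw [← Fintype.card_pos_iff, card_multiIndex]
    exact Nat.choose_pos (by omega)
  have hfour : 1 ≤ 4 * (K * c₀) := one_le_mul_of_subGaussian_of_smallBall hK hsub hball
  have hconst : 4 ≤ condConst := by
    unfold condConst
    linarith [Real.one_le_exp (show (0 : ℝ) ≤ 12 by norm_num)]
  nlinarith

/-- The scale of the condition number: up to the factor `√N`, its square is the threshold beyond
which the tail estimate holds. Here `B` stands for `K * c₀ * condConst`. -/
noncomputable def condScale (m d : ℕ) (B : ℝ) : ℝ :=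
  (B * d * √(Real.log (Real.exp 1 * d))) ^ m * d

lemma one_le_condScale {B : ℝ} (hd : 0 < d) (hB : 1 ≤ B) : 1 ≤ condScale m d B := by
  have hd₁ : (1 : ℝ) ≤ d := by exact_mod_cast hd
  exact one_le_mul_of_one_le_of_one_le (one_le_pow₀ (one_le_mul_of_one_le_of_one_le
    (one_le_mul_of_one_le_of_one_le hB hd₁)
    (Real.one_le_sqrt.2 (one_le_log_exp_one_mul hd)))) hd₁

lemma sq_condScale_le {B : ℝ} (hm : 2 ≤ m) (hd : 0 < d) :
    condScale m d B ^ 2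
      ≤ B ^ (2 * m) * (3 * (d : ℝ) ^ 2 * Real.log (Real.exp 1 * d)) ^ (2 * m - 1) := by
  have hd₁ : (1 : ℝ) ≤ d := by exact_mod_cast hd
  have hl := one_le_log_exp_one_mul hd
  unfold condScale
  set l := Real.log (Real.exp 1 * d)
  calc ((B * d * √l) ^ m * d) ^ 2 = B ^ (2 * m) * ((d : ℝ) ^ (2 * m + 2) * (√l ^ 2) ^ m) := by ring
    _ = B ^ (2 * m) * ((d : ℝ) ^ (2 * m + 2) * l ^ m) := by rw [Real.sq_sqrt (by linarith)]
    _ ≤ B ^ (2 * m) * ((d : ℝ) ^ (2 * (2 * m - 1)) * l ^ (2 * m - 1)) := by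
        have hB : 0 ≤ B ^ (2 * m) := (even_two_mul m).pow_nonneg B
        gcongr <;> first | assumption | omega
    _ = B ^ (2 * m) * ((d : ℝ) ^ 2 * l) ^ (2 * m - 1) := by rw [mul_pow, ← pow_mul]
    _ ≤ B ^ (2 * m) * (3 * (d : ℝ) ^ 2 * l) ^ (2 * m - 1) := by
        have hB : 0 ≤ B ^ (2 * m) := (even_two_mul m).pow_nonneg B
        gcongr
        linarith [sq_nonneg (d : ℝ)]

lemma sqrt_mul_sq_condScale_le {n : ℕ} (hn : 3 ≤ n) (hd : 0 < d) (B N : ℝ) :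
    √N * condScale (n - 1) d B ^ 2
      ≤ √N * B ^ (2 * (n - 1)) * (3 * (d : ℝ) ^ 2 * Real.log (Real.exp 1 * d)) ^ (2 * n - 3) *
        √n := by
  have hsqrt : 1 ≤ √(n : ℝ) := Real.one_le_sqrt.2 (by exact_mod_cast (show 1 ≤ n by omega))
  have hscale := sq_condScale_le (m := n - 1) (B := B) (by omega) hd
  rw [show 2 * (n - 1) - 1 = 2 * n - 3 by omega] at hscale
  rw [mul_assoc √N]
  exact (mul_le_mul_of_nonneg_left hscale (Real.sqrt_nonneg N)).trans
    (le_mul_of_one_le_right (mul_nonneg (Real.sqrt_nonneg N) ((sq_nonneg _).trans hscale)) hsqrt)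

/-- The bound for `‖P‖` on the sphere that fails with the probability allowed by the tail estimate.
Here `l` stands for `log (e d)` and `S ≥ 1` grows with the level of the tail. -/
noncomputable def sphereRadius (m : ℕ) (K l S : ℝ) : ℝ := 16 * K * √(m * l * S)

/-- The scale `ρ` of the boxes around a nearly singular point: the point is nearly singular with
parameter `ρ ^ 2 * sphereRadius m K l S`. Here `q` stands for `condScale m d B`. -/
noncomputable def boxScale (q S T t : ℝ) : ℝ := √(√(T / S) / t) / q

lemma boxScale_pos {q S T : ℝ} (hq : 0 < q) (hS : 0 < S) (hT : 0 < T) (ht : 0 < t) :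
    0 < boxScale q S T t := by
  unfold boxScale
  positivity

lemma boxScale_le_one {q S T : ℝ} (hq : 1 ≤ q) (hS : 1 ≤ S) (ht : 1 ≤ t) (hT : T ≤ t) :
    boxScale q S T t ≤ 1 := by
  refine div_le_one_of_le₀ (le_trans ?_ hq) (by linarith)
  rw [Real.sqrt_le_one, div_le_one (by linarith), Real.sqrt_le_left (by linarith),
    div_le_iff₀ (by linarith)]
  nlinarith

lemma mul_le_sq_mul_boxScale {q S T l N M : ℝ} (hq : 0 < q) (hS : 0 < S) (hT : 0 < T)
    (ht : 0 < t) (hl : 1 ≤ m * l) (hN : 0 ≤ N) (hM : √N * q ^ 2 ≤ M) :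
    16 * K ^ 2 * (8 * (T * N))
      ≤ (t * M * (boxScale q S T t ^ 2 * sphereRadius m K l S)) ^ 2 := by
  have hscale : t * M * (boxScale q S T t ^ 2 * sphereRadius m K l S)
      = M / q ^ 2 * √(T / S) * (16 * K * √(m * l * S)) := by
    rw [boxScale, sphereRadius, div_pow, Real.sq_sqrt (by positivity)]
    field_simp
  have hMq : N ≤ (M / q ^ 2) ^ 2 :=
    calc N = √N ^ 2 := (Real.sq_sqrt hN).symm
      _ ≤ (M / q ^ 2) ^ 2 := by
          gcongr
          exact (le_div_iff₀ (by positivity)).2 hM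
  rw [hscale, mul_pow, mul_pow, mul_pow, Real.sq_sqrt (by positivity),
    Real.sq_sqrt (by positivity)]
  calc 16 * K ^ 2 * (8 * (T * N)) = N * (128 * K ^ 2 * T * 1) := by ring
    _ ≤ (M / q ^ 2) ^ 2 * (256 * K ^ 2 * T * (m * l)) := by
        gcongr
        norm_num
    _ = _ := by
        field_simp
        ring

lemma singularBound_le {l S ρ : ℝ} (hK : 0 ≤ K) (hc₀ : 0 ≤ c₀) (hl : 0 ≤ l) (hρ : 0 < ρ) :
    Real.exp 6 ^ (k + 2) * (3 * d) ^ (k + 1) / ρ ^ (2 * k + 1) *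
        (36 * c₀ * (ρ ^ 2 * sphereRadius (k + 1) K l S) / √↑(k + 1)) ^ (k + 1)
      ≤ (1 / 24) ^ (k + 1) * (K * c₀ * condConst * d * √l) ^ (k + 1) * √S ^ (k + 1) * ρ := by
  have hradius : 36 * c₀ * (ρ ^ 2 * sphereRadius (k + 1) K l S) / √↑(k + 1)
      = ρ ^ 2 * (36 * c₀ * (16 * K * (√l * √S))) := by
    have hm : √(↑(k + 1) : ℝ) ≠ 0 := by positivity
    rw [sphereRadius, Real.sqrt_mul (by positivity), Real.sqrt_mul (by positivity)]
    field_simp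
  calc _ = Real.exp 6 ^ (k + 2) * (3 * d * (36 * c₀ * (16 * K * (√l * √S)))) ^ (k + 1) * ρ := by
        rw [hradius]
        simp only [mul_pow]
        field_simp
        ring
    _ ≤ Real.exp 12 ^ (k + 1) * (3 * d * (36 * c₀ * (16 * K * (√l * √S)))) ^ (k + 1) * ρ := by
        gcongr
        exact exp_six_pow_le k
    _ = _ := by
        simp only [← mul_pow]
        unfold condConst
        ring

lemma singularBound_boxScale_le {S T : ℝ} (hd : 0 < d) (hK : 0 < K) (hc₀ : 0 < c₀) (hS : 0 < S)
    (hT : 0 < T) (ht : 0 < t) :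
    Real.exp 6 ^ (k + 2) * (3 * d) ^ (k + 1) /
        boxScale (condScale (k + 1) d (K * c₀ * condConst)) S T t ^ (2 * k + 1) *
        (36 * c₀ * (boxScale (condScale (k + 1) d (K * c₀ * condConst)) S T t ^ 2 *
          sphereRadius (k + 1) K (Real.log (Real.exp 1 * d)) S) / √↑(k + 1)) ^ (k + 1)
      ≤ t ^ (-(1 / 2) : ℝ) * (S ^ ((↑(k + 1) - 1 / 2) / 2 : ℝ) * T ^ (1 / 4 : ℝ)) / (24 * d) := by
  have hl : 0 < Real.log (Real.exp 1 * d) := zero_lt_one.trans_le (one_le_log_exp_one_mul hd)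
  have hC := condConst_pos
  have hscale : 0 < (K * c₀ * condConst * d * √(Real.log (Real.exp 1 * d))) ^ (k + 1) := by
    positivity
  refine (singularBound_le hK.le hc₀.le hl.le
    (boxScale_pos (mul_pos hscale (by positivity)) hS hT ht)).trans ?_
  rw [← sqrt_sqrt_div_mul_sqrt_pow hS hT ht]
  calc _ = (1 / 24 : ℝ) ^ (k + 1) * (√(√(T / S) / t) * √S ^ (k + 1)) / d := by
        rw [boxScale]
        generalize (K * c₀ * condConst * d * √(Real.log (Real.exp 1 * d))) ^ (k + 1) = q at hscale
        field_simp
    _ ≤ 1 / 24 * (√(√(T / S) / t) * √S ^ (k + 1)) / d := by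
        gcongr
        exact pow_le_of_le_one (by norm_num) (by norm_num) k.succ_ne_zero
    _ = _ := by field_simp

end TailBound

section KappaTail

variable {k m d N : ℕ} {deg : Fin m → ℕ} {Ω : Type*} [MeasurableSpace Ω] {μ : Measure Ω}
  [IsProbabilityMeasure μ] {X : (i : Fin m) → Ω → EuclideanSpace ℝ (MultiIndex (k + 2) (deg i))}
  {K c₀ t : ℝ}

lemma measure_le_sum_norm_sq_le_tailFactor (hm : 2 ≤ m) (hX : ∀ i, Measurable (X i))
    (hind : iIndepFun X μ) (hK : 0 < K) (hsub : ∀ i, SubGaussianWith μ (X i) K) (hd : 2 ≤ d)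
    (hN : N = ∑ i, (k + 2 + deg i - 1).choose (deg i))
    (hmN : m * Real.log (Real.exp 1 * d) ≤ N) (ht : 0 < t) :
    μ {ω | 4 * K ^ 2 * (8 * (logRatio (2 * N) t * N)) ≤ ∑ i, ‖X i ω‖ ^ 2}
      ≤ ENNReal.ofReal (t ^ (-(1 / 2) : ℝ) * tailFactor m (Real.log (Real.exp 1 * d)) N t /
          (24 * d)) := by
  have hl : 1 ≤ Real.log (Real.exp 1 * d) := one_le_log_exp_one_mul (by omega)
  have hml : 2 * Real.log (Real.exp 1 * d) ≤ m * Real.log (Real.exp 1 * d) := by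
    gcongr
    exact_mod_cast hm
  have hT : (N : ℝ) ≤ logRatio (2 * N) t * N :=
    le_mul_of_one_le_left N.cast_nonneg (one_le_logRatio _ _)
  refine (measure_le_sum_norm_sq_le (by omega) hX hind hK hsub _).trans (ENNReal.ofReal_le_ofReal
    (le_trans (Real.exp_le_exp.2 ?_) (exp_neg_five_mul_le hd ht
      (one_le_tailFactor (by omega) _ _ _) (A := logRatio (2 * N) t * N) (by linarith) ?_)))
  · rw [← hN]
    linarith
  · linarith [log_le_logRatio_mul (show (0 : ℝ) < 2 * N by linarith) t]

lemma measure_not_isSphereBound_le_tailFactor (hm : m = k + 1) (hk : 0 < k)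
    (hX : ∀ i, Measurable (X i)) (hind : iIndepFun X μ) (hK : 0 < K)
    (hsub : ∀ i, SubGaussianWith μ (X i) K) (hd : 2 ≤ d) (hdegd : ∀ i, deg i ≤ d) (N : ℝ)
    (ht : 0 < t) {l S : ℝ} (hl : l = Real.log (Real.exp 1 * d)) (hS : S = logRatio (2 * m * l) t) :
    μ {ω | ¬ IsSphereBound (randomForms X ω) (sphereRadius m K l S)}
      ≤ ENNReal.ofReal (t ^ (-(1 / 2) : ℝ) * tailFactor m l N t / (24 * d)) := by
  have hl₁ : 1 ≤ l := hl ▸ one_le_log_exp_one_mul (by omega)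
  have hm₂ : (2 : ℝ) ≤ m := by exact_mod_cast (show 2 ≤ m by omega)
  have hS₁ : 1 ≤ S := hS ▸ one_le_logRatio _ _
  have hml : 2 * l ≤ m * l := by gcongr
  have hmlS : m * l ≤ m * l * S := le_mul_of_one_le_right (by positivity) hS₁
  have hexponent : sphereRadius m K l S ^ 2 / (8 * K ^ 2) = 32 * (m * l * S) := by
    rw [sphereRadius, mul_pow, mul_pow, Real.sq_sqrt (by positivity)]
    field_simp
    norm_num
  have hlog : Real.log t ≤ S * (2 * m * l) := hS ▸ log_le_logRatio_mul (by positivity) t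
  refine (measure_not_isSphereBound_le hX hind hK hsub (by omega) hdegd
    (by unfold sphereRadius; positivity)).trans (ENNReal.ofReal_le_ofReal (le_trans ?_
      (exp_neg_five_mul_le hd ht (one_le_tailFactor (by omega) l N t) (A := m * l * S)
        (by rw [← hl]; linarith) (by linarith))))
  rw [hexponent]
  subst hm hl
  exact exp_neg_mul_le_exp_neg_five_mul (by omega) hmlS

lemma measure_isNearlySingular_le_tailFactor (hm : m = k + 1) (hX : ∀ i, Measurable (X i))
    (hind : iIndepFun X μ) (hK : 0 < K) (hc₀ : 0 < c₀) (hball : ∀ i, SmallBallWith μ (X i) c₀)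
    (hB : 1 ≤ K * c₀ * condConst) (hd : 2 ≤ d) (hdegd : ∀ i, deg i ≤ d) (hN : 1 ≤ 2 * N)
    (ht : 1 ≤ t) {l S T ρ : ℝ} (hl : l = Real.log (Real.exp 1 * d))
    (hS : S = logRatio (2 * m * l) t) (hT : T = logRatio (2 * N) t)
    (hρ : ρ = boxScale (condScale m d (K * c₀ * condConst)) S T t) :
    μ {ω | IsSphereBound (randomForms X ω) (sphereRadius m K l S) ∧
        IsNearlySingular (randomForms X ω) d (ρ ^ 2 * sphereRadius m K l S)}
      ≤ ENNReal.ofReal (t ^ (-(1 / 2) : ℝ) * tailFactor m l N t / (24 * d)) := by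
  have hl₁ : 1 ≤ l := hl ▸ one_le_log_exp_one_mul (by omega)
  have hS₁ : 1 ≤ S := hS ▸ one_le_logRatio _ _
  have hT₁ : 1 ≤ T := hT ▸ one_le_logRatio _ _
  have hTt : T ≤ t := hT ▸ logRatio_le_self (by exact_mod_cast hN) ht
  have hq : 1 ≤ condScale m d (K * c₀ * condConst) := one_le_condScale (by omega) hB
  have hm₀ : (0 : ℝ) < m := by exact_mod_cast (show 0 < m by omega)
  have hρ₀ : 0 < ρ := hρ ▸ boxScale_pos (by linarith) (by linarith) (by linarith) (by linarith)
  have hρ₁ : ρ ≤ 1 := hρ ▸ boxScale_le_one hq hS₁ ht hTt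
  refine (measure_isSphereBound_and_isNearlySingular_le (by omega) hX hind hc₀ hball (by omega)
    hdegd (by unfold sphereRadius; positivity) hρ₀ hρ₁).trans (ENNReal.ofReal_le_ofReal ?_)
  rw [tailFactor, ← hS, ← hT]
  subst hm hρ hl
  exact singularBound_boxScale_le (by omega) hK hc₀ (by linarith) (by linarith) (by linarith)

lemma measure_le_kappa_randomForms_le (hm : m = k + 1) (hk : 0 < k) (hdeg : ∀ i, 0 < deg i)
    (hd : 2 ≤ d) (hdegd : ∀ i, deg i ≤ d) (hX : ∀ i, Measurable (X i)) (hind : iIndepFun X μ)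
    (hK : 0 < K) (hc₀ : 0 < c₀) (hsub : ∀ i, SubGaussianWith μ (X i) K)
    (hball : ∀ i, SmallBallWith μ (X i) c₀) (hN : N = ∑ i, (k + 2 + deg i - 1).choose (deg i))
    (hmN : m * Real.log (Real.exp 1 * d) ≤ N)
    {M : ℝ} (hM : √N * condScale m d (K * c₀ * condConst) ^ 2 ≤ M) (ht : 1 ≤ t) :
    μ {ω | ENNReal.ofReal (t * M) ≤ kappa deg (randomForms X ω)}
      ≤ ENNReal.ofReal (t ^ (-(1 / 2) : ℝ) * tailFactor m (Real.log (Real.exp 1 * d)) N t /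
          (8 * d)) := by
  set l := Real.log (Real.exp 1 * d) with hl
  set S := logRatio (2 * m * l) t with hS
  set T := logRatio (2 * N) t with hT
  set ρ := boxScale (condScale m d (K * c₀ * condConst)) S T t with hρ
  have i : Fin m := ⟨0, by omega⟩
  have hB : 1 ≤ K * c₀ * condConst := one_le_mul_condConst (by omega) hK (hsub i) (hball i)
  have hq : 1 ≤ condScale m d (K * c₀ * condConst) := one_le_condScale (by omega) hB
  have hml : 1 ≤ m * l := one_le_mul_of_one_le_of_one_le
    (by exact_mod_cast (show 1 ≤ m by omega)) (one_le_log_exp_one_mul (by omega))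
  have hN₁ : 1 ≤ (N : ℝ) := hml.trans hmN
  have ht₀ : 0 < t := by linarith
  have hM₀ : 0 < M := lt_of_lt_of_le (by positivity) hM
  set τ := t ^ (-(1 / 2) : ℝ) * tailFactor m l N t / (24 * d) with hτ
  have hτ₀ : 0 ≤ τ := by
    have hF := one_le_tailFactor (m := m) (by omega) l N t
    positivity
  calc μ {ω | ENNReal.ofReal (t * M) ≤ kappa deg (randomForms X ω)}
      ≤ _ := measure_le_kappa_le_add (by omega) hdeg hdegd (by positivity)
        (by unfold sphereRadius; positivity)
        (mul_le_sq_mul_boxScale (by positivity) (zero_lt_one.trans_le (one_le_logRatio _ _))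
          (zero_lt_one.trans_le (one_le_logRatio _ _)) ht₀ hml N.cast_nonneg hM)
        (sphereRadius m K l S)
    _ ≤ ENNReal.ofReal τ + (ENNReal.ofReal τ + ENNReal.ofReal τ) := by
        gcongr
        · exact measure_le_sum_norm_sq_le_tailFactor (by omega) hX hind hK hsub hd hN hmN ht₀
        · exact measure_not_isSphereBound_le_tailFactor hm hk hX hind hK hsub hd hdegd N ht₀ hl hS
        · exact measure_isNearlySingular_le_tailFactor hm hX hind hK hc₀ hball hB hd hdegd
            (by exact_mod_cast (show (1 : ℝ) ≤ 2 * N by linarith)) ht hl hS hT hρ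
    _ = _ := by
        rw [← ENNReal.ofReal_add hτ₀ hτ₀, ← ENNReal.ofReal_add hτ₀ (by positivity), hτ]
        congr 1
        ring

end KappaTail

section Moments

variable {Ω : Type*} [MeasurableSpace Ω] {μ : Measure Ω} {β p q M : ℝ}
  {κ : Ω → ℝ≥0∞}

lemma ae_ne_top_of_tail (hp : 0 < p) (htail : ∀ t : ℝ, 1 ≤ t →
      μ {ω | ENNReal.ofReal (t * M) ≤ κ ω} ≤ ENNReal.ofReal (β * t ^ (-p))) :
    ∀ᵐ ω ∂μ, κ ω ≠ ∞ := by
  have hbound : ∀ t : ℝ, 1 ≤ t → μ {ω | ¬ κ ω ≠ ∞} ≤ ENNReal.ofReal (β * t ^ (-p)) :=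
    fun t ht => (measure_mono fun ω hω => le_top.trans_eq (not_not.1 hω).symm).trans (htail t ht)
  have hlim : Filter.Tendsto (fun t : ℝ => ENNReal.ofReal (β * t ^ (-p))) Filter.atTop
      (nhds 0) := by
    simpa using ENNReal.tendsto_ofReal ((tendsto_rpow_neg_atTop hp).const_mul β)
  exact ae_iff.2 (le_antisymm
    (ge_of_tendsto hlim ((Filter.eventually_ge_atTop 1).mono hbound)) zero_le)

lemma lintegral_Ioc_zero_one_rpow_sub_one (hq : 0 < q) :
    ∫⁻ t in Set.Ioc (0 : ℝ) 1, ENNReal.ofReal (t ^ (q - 1)) = ENNReal.ofReal (1 / q) := by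
  have hint : IntegrableOn (fun t : ℝ => t ^ (q - 1)) (Set.Ioc 0 1) :=
    (intervalIntegrable_iff_integrableOn_Ioc_of_le zero_le_one).1
      (intervalIntegral.intervalIntegrable_rpow' (by linarith))
  have hnonneg : ∀ᵐ t ∂volume.restrict (Set.Ioc (0 : ℝ) 1), 0 ≤ t ^ (q - 1) := by
    filter_upwards [ae_restrict_mem measurableSet_Ioc] with t ht
    exact Real.rpow_nonneg ht.1.le _
  rw [← ofReal_integral_eq_lintegral_ofReal hint hnonneg,
    ← intervalIntegral.integral_of_le zero_le_one, integral_rpow (Or.inl (by linarith)),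
    sub_add_cancel, Real.one_rpow, Real.zero_rpow hq.ne', sub_zero]

lemma lintegral_Ioi_one_rpow_neg_sub_one (hβ : 0 < β) :
    ∫⁻ t in Set.Ioi (1 : ℝ), ENNReal.ofReal (t ^ (-β - 1)) = ENNReal.ofReal (1 / β) := by
  have hnonneg : ∀ᵐ t ∂volume.restrict (Set.Ioi (1 : ℝ)), 0 ≤ t ^ (-β - 1) := by
    filter_upwards [ae_restrict_mem measurableSet_Ioi] with t ht
    exact Real.rpow_nonneg (zero_le_one.trans (Set.mem_Ioi.1 ht).le) _
  rw [← ofReal_integral_eq_lintegral_ofReal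
    (integrableOn_Ioi_rpow_of_lt (by linarith) one_pos) hnonneg,
    integral_Ioi_rpow_of_lt (by linarith) one_pos, Real.one_rpow, sub_add_cancel, neg_div_neg_eq]

variable [IsProbabilityMeasure μ]

lemma lintegral_rpow_le_of_tail {f : Ω → ℝ} (hf : Measurable f) (hf₀ : ∀ ω, 0 ≤ f ω)
    (hβ : 0 < β) (hq : 0 < q) (hqp : q + β ≤ p)
    (htail : ∀ t : ℝ, 1 ≤ t → μ {ω | t ≤ f ω} ≤ ENNReal.ofReal (β * t ^ (-p))) :
    ∫⁻ ω, ENNReal.ofReal (f ω ^ q) ∂μ ≤ ENNReal.ofReal (1 + q) := by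
  have hsmall : ∫⁻ t in Set.Ioc (0 : ℝ) 1, μ {ω | t ≤ f ω} * ENNReal.ofReal (t ^ (q - 1))
      ≤ ENNReal.ofReal (1 / q) :=
    (lintegral_mono fun _ => mul_le_of_le_one_left zero_le prob_le_one).trans_eq
      (lintegral_Ioc_zero_one_rpow_sub_one hq)
  have hlarge : ∫⁻ t in Set.Ioi (1 : ℝ), μ {ω | t ≤ f ω} * ENNReal.ofReal (t ^ (q - 1))
      ≤ ENNReal.ofReal 1 :=
    calc _ ≤ ∫⁻ t in Set.Ioi (1 : ℝ), ENNReal.ofReal β * ENNReal.ofReal (t ^ (-β - 1)) := by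
          refine setLIntegral_mono' measurableSet_Ioi fun t (ht : 1 < t) => ?_
          have ht₀ : 0 < t := by linarith
          have hexponent : t ^ (-p) * t ^ (q - 1) ≤ t ^ (-β - 1) := by
            rw [← Real.rpow_add ht₀]
            exact Real.rpow_le_rpow_of_exponent_le ht.le (by linarith)
          grw [htail t ht.le, ← ENNReal.ofReal_mul (by positivity), mul_assoc, hexponent,
            ENNReal.ofReal_mul hβ.le]
      _ = ENNReal.ofReal 1 := by
          rw [lintegral_const_mul' _ _ ENNReal.ofReal_ne_top,
            lintegral_Ioi_one_rpow_neg_sub_one hβ, ← ENNReal.ofReal_mul hβ.le,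
            mul_one_div_cancel hβ.ne']
  rw [lintegral_rpow_eq_lintegral_meas_le_mul μ (.of_forall hf₀) hf.aemeasurable hq,
    ← Set.Ioc_union_Ioi_eq_Ioi zero_le_one,
    lintegral_union measurableSet_Ioi (Set.Ioc_disjoint_Ioi le_rfl)]
  calc _ ≤ ENNReal.ofReal q * (ENNReal.ofReal (1 / q) + ENNReal.ofReal 1) := by gcongr
    _ = ENNReal.ofReal (1 + q) := by
        rw [← ENNReal.ofReal_add (by positivity) zero_le_one, ← ENNReal.ofReal_mul hq.le, mul_add,
          mul_one_div_cancel hq.ne', mul_one]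

lemma lintegral_toReal_div_rpow_le_of_tail (hκ : Measurable κ) (hM : 0 < M) (hβ : 0 < β)
    (hq : 0 < q) (hqp : q + β ≤ p) (htail : ∀ t : ℝ, 1 ≤ t →
      μ {ω | ENNReal.ofReal (t * M) ≤ κ ω} ≤ ENNReal.ofReal (β * t ^ (-p))) :
    ∫⁻ ω, ENNReal.ofReal (((κ ω).toReal / M) ^ q) ∂μ ≤ ENNReal.ofReal (1 + q) :=
  lintegral_rpow_le_of_tail (hκ.ennreal_toReal.div_const M) (fun _ => by positivity) hβ hq hqp
    fun t ht => (measure_mono fun _ hω =>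
      ENNReal.ofReal_le_of_le_toReal ((le_div_iff₀ hM).1 hω)).trans (htail t ht)

lemma lintegral_rpow_rpow_one_div_le_of_tail (hκ : Measurable κ) (hM : 0 < M) (hβ : 0 < β)
    (hq : 0 < q) (hq₁ : q ≤ 1) (hqp : q + β ≤ p) (htail : ∀ t : ℝ, 1 ≤ t →
      μ {ω | ENNReal.ofReal (t * M) ≤ κ ω} ≤ ENNReal.ofReal (β * t ^ (-p))) :
    (∫⁻ ω, κ ω ^ q ∂μ) ^ (1 / q) ≤ ENNReal.ofReal (M * Real.exp (1 / q)) := by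
  have hscale : ∫⁻ ω, κ ω ^ q ∂μ
      = ∫⁻ ω, ENNReal.ofReal (M ^ q) * ENNReal.ofReal (((κ ω).toReal / M) ^ q) ∂μ := by
    refine lintegral_congr_ae ?_
    filter_upwards [ae_ne_top_of_tail (by linarith) htail] with ω hω
    rw [← ENNReal.ofReal_mul (by positivity), ← Real.mul_rpow hM.le (by positivity),
      mul_div_cancel₀ _ hM.ne', ← ENNReal.ofReal_rpow_of_nonneg ENNReal.toReal_nonneg hq.le,
      ENNReal.ofReal_toReal hω]
  have hmoment : ∫⁻ ω, κ ω ^ q ∂μ ≤ ENNReal.ofReal (M ^ q * Real.exp 1) := by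
    rw [hscale, lintegral_const_mul' _ _ ENNReal.ofReal_ne_top, ENNReal.ofReal_mul (by positivity)]
    gcongr
    refine (lintegral_toReal_div_rpow_le_of_tail hκ hM hβ hq hqp htail).trans
      (ENNReal.ofReal_le_ofReal ?_)
    linarith [Real.add_one_le_exp 1]
  refine (ENNReal.rpow_le_rpow hmoment (by positivity)).trans_eq ?_
  rw [ENNReal.ofReal_rpow_of_nonneg (by positivity) (by positivity),
    Real.mul_rpow (by positivity) (by positivity), ← Real.rpow_mul hM.le,
    mul_one_div_cancel hq.ne', Real.rpow_one, ← Real.exp_mul, one_mul]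

lemma log_le_log_add_div_rpow_sub_one_div {y : ℝ} (hy : 0 < y) (hM : 0 < M) (hq : 0 < q) :
    Real.log y ≤ Real.log M + ((y / M) ^ q - 1) / q := by
  have hlog := Real.log_le_sub_one_of_pos (Real.rpow_pos_of_pos (div_pos hy hM) q)
  rw [Real.log_rpow (div_pos hy hM), Real.log_div hy.ne' hM.ne', ← le_div_iff₀' hq] at hlog
  linarith

lemma integrable_log_and_integral_log_le {f : Ω → ℝ} {a : ℝ} (hf : Measurable f) (ha : 0 < a)
    (hfa : ∀ᵐ ω ∂μ, a ≤ f ω) (hM : 0 < M) (hq : 0 < q)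
    (hmoment : ∫⁻ ω, ENNReal.ofReal ((f ω / M) ^ q) ∂μ ≤ ENNReal.ofReal (1 + q)) :
    Integrable (fun ω => Real.log (f ω)) μ ∧ ∫ ω, Real.log (f ω) ∂μ ≤ 1 + Real.log M := by
  set g : Ω → ℝ := fun ω => (f ω / M) ^ q
  have hg : AEStronglyMeasurable g μ := ((hf.div_const M).pow_const q).aestronglyMeasurable
  have hg₀ : 0 ≤ᵐ[μ] g := by
    filter_upwards [hfa] with ω hω
    exact Real.rpow_nonneg (div_nonneg (ha.le.trans hω) hM.le) q
  have hg_int : Integrable g μ :=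
    ⟨hg, (hasFiniteIntegral_iff_ofReal hg₀).2 (hmoment.trans_lt ENNReal.ofReal_lt_top)⟩
  have hg_le : ∫ ω, g ω ∂μ ≤ 1 + q := by
    rw [integral_eq_lintegral_of_nonneg_ae hg₀ hg]
    exact ENNReal.toReal_le_of_le_ofReal (by positivity) hmoment
  have hlog_lower : ∀ᵐ ω ∂μ, Real.log a ≤ Real.log (f ω) :=
    hfa.mono fun ω hω => Real.log_le_log ha hω
  have hlog_upper : ∀ᵐ ω ∂μ, Real.log (f ω) ≤ Real.log M + (g ω - 1) / q :=
    hfa.mono fun ω hω => log_le_log_add_div_rpow_sub_one_div (ha.trans_le hω) hM hq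
  have hdiv_int : Integrable (fun ω => (g ω - 1) / q) μ :=
    (hg_int.sub (integrable_const 1)).div_const q
  have hupper_int : Integrable (fun ω => Real.log M + (g ω - 1) / q) μ :=
    (integrable_const _).add hdiv_int
  have hlog_int : Integrable (fun ω => Real.log (f ω)) μ :=
    integrable_of_le_of_le (Real.measurable_log.comp hf).aestronglyMeasurable hlog_lower
      hlog_upper (integrable_const _) hupper_int
  refine ⟨hlog_int, ?_⟩
  calc ∫ ω, Real.log (f ω) ∂μ ≤ ∫ ω, (Real.log M + (g ω - 1) / q) ∂μ :=
        integral_mono_ae hlog_int hupper_int hlog_upper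
    _ = Real.log M + (∫ ω, g ω ∂μ - 1) / q := by
        rw [integral_add (integrable_const _) hdiv_int, integral_div,
          integral_sub hg_int (integrable_const 1)]
        simp
    _ ≤ 1 + Real.log M := by
        rw [add_comm]
        gcongr
        rw [div_le_one hq]
        linarith

lemma integrable_log_and_integral_log_le_of_tail {a : ℝ} (hκ : Measurable κ) (ha : 0 < a)
    (hκa : ∀ ω, ENNReal.ofReal a ≤ κ ω) (hM : 0 < M) (hβ : 0 < β) (hβp : β < p)
    (htail : ∀ t : ℝ, 1 ≤ t →
      μ {ω | ENNReal.ofReal (t * M) ≤ κ ω} ≤ ENNReal.ofReal (β * t ^ (-p))) :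
    Integrable (fun ω => Real.log (κ ω).toReal) μ ∧
      ∫ ω, Real.log (κ ω).toReal ∂μ ≤ 1 + Real.log M :=
  integrable_log_and_integral_log_le hκ.ennreal_toReal ha
    ((ae_ne_top_of_tail (hβ.trans hβp) htail).mono fun ω hω =>
      (ENNReal.ofReal_le_iff_le_toReal hω).1 (hκa ω)) hM (sub_pos.2 hβp)
    (lintegral_toReal_div_rpow_le_of_tail hκ hM hβ (sub_pos.2 hβp) (sub_add_cancel p β).le htail)

end Moments

section TailRegimes

variable {Ω : Type*} [MeasurableSpace Ω] {μ : Measure Ω} {κ : Ω → ℝ≥0∞} {m : ℕ} {l N M t : ℝ}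

/-- The tail bound for the condition number at scale `M`: the event `t M ≤ κ` has probability at
most `t ^ (-1 / 2) * tailFactor m l N t / (8 l)`. For systems of `m` forms of degree at most `d`
with `N` coefficients, `l` is `log (e d)`. -/
def HasTailBound (μ : Measure Ω) (κ : Ω → ℝ≥0∞) (m : ℕ) (l N M : ℝ) : Prop :=
  ∀ t : ℝ, 1 ≤ t → μ {ω | ENNReal.ofReal (t * M) ≤ κ ω} ≤
    ENNReal.ofReal (t ^ (-(1 / 2) : ℝ) * tailFactor m l N t / (8 * l))

namespace HasTailBound

variable (hκ : HasTailBound μ κ m l N M) (hm : 0 < m) (hl : 1 ≤ l) (hN : m * l ≤ N)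

include hκ hm hl

lemma measureReal_le (ht : 1 ≤ t) : μ.real {ω | ENNReal.ofReal (t * M) ≤ κ ω} ≤
    3 * t ^ (-(1 / 2) : ℝ) * tailFactor m l N t := by
  have hF := one_le_tailFactor hm l N t
  calc _ ≤ t ^ (-(1 / 2) : ℝ) * tailFactor m l N t / (8 * l) :=
        ENNReal.toReal_le_of_le_ofReal (by positivity) (hκ t ht)
    _ ≤ t ^ (-(1 / 2) : ℝ) * tailFactor m l N t := div_le_self (by positivity) (by linarith)
    _ ≤ 3 * t ^ (-(1 / 2) : ℝ) * tailFactor m l N t := by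
        rw [mul_assoc 3]
        exact le_mul_of_one_le_left (by positivity) (by norm_num)

include hN

lemma measureReal_le_of_le_exp (ht : 1 ≤ t) (htl : t ≤ Real.exp (2 * m * l)) :
    μ.real {ω | ENNReal.ofReal (t * M) ≤ κ ω} ≤ 3 * t ^ (-(1 / 2) : ℝ) :=
  (hκ.measureReal_le hm hl ht).trans_eq (by
    rw [tailFactor_of_le_exp hm (by linarith) hN (by linarith) htl, mul_one])

lemma measureReal_le_of_exp_le_of_le_exp (htl : Real.exp (2 * m * l) ≤ t)
    (htN : t ≤ Real.exp (2 * N)) :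
    μ.real {ω | ENNReal.ofReal (t * M) ≤ κ ω} ≤ 3 * t ^ (-(1 / 2) : ℝ) *
      (Real.log t / (2 * m * l)) ^ (((m : ℝ) - 1 / 2) / 2) :=
  (hκ.measureReal_le hm hl ((Real.one_le_exp (by positivity)).trans htl)).trans_eq (by
    rw [tailFactor_of_exp_le_of_le_exp hm (by linarith) hN htl htN])

lemma measureReal_le_of_exp_le (htN : Real.exp (2 * N) ≤ t) :
    μ.real {ω | ENNReal.ofReal (t * M) ≤ κ ω} ≤ 3 * t ^ (-(1 / 2) : ℝ) *
      (Real.log t / (2 * N)) ^ (1 / 4 : ℝ) *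
        (Real.log t / (2 * m * l)) ^ (((m : ℝ) - 1 / 2) / 2) :=
  have hN₀ : 0 ≤ N := hN.trans' (by positivity)
  (hκ.measureReal_le hm hl ((Real.one_le_exp (by positivity)).trans htN)).trans_eq (by
    rw [tailFactor_of_exp_le hm (by linarith) hN htN, ← mul_assoc])

lemma measure_le_rpow (ht : 1 ≤ t) : μ {ω | ENNReal.ofReal (t * M) ≤ κ ω} ≤
    ENNReal.ofReal (1 / (8 * l) * t ^ (-(1 / 2 - 1 / (8 * l)))) := by
  refine (hκ t ht).trans (ENNReal.ofReal_le_ofReal ?_)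
  calc t ^ (-(1 / 2) : ℝ) * tailFactor m l N t / (8 * l)
      ≤ t ^ (-(1 / 2) : ℝ) * t ^ (1 / (8 * l)) / (8 * l) := by
        gcongr
        exact tailFactor_le_rpow hm (by linarith) hN ht
    _ = _ := by
        rw [← Real.rpow_add (by linarith), neg_sub', sub_neg_eq_add]
        ring

lemma ae_ne_top : ∀ᵐ ω ∂μ, κ ω ≠ ∞ := by
  refine ae_ne_top_of_tail (p := 1 / 2 - 1 / (8 * l)) ?_ fun t ht => hκ.measure_le_rpow hm hl hN ht
  have : 1 / (8 * l) ≤ 1 / 8 := one_div_le_one_div_of_le (by norm_num) (by linarith)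
  linarith

variable [IsProbabilityMeasure μ]

lemma scale_pos : 0 < M := by
  by_contra! hM
  have huniv : {ω | ENNReal.ofReal (1 * M) ≤ κ ω} = Set.univ :=
    Set.eq_univ_of_forall fun ω => by simp [ENNReal.ofReal_of_nonpos hM]
  have hone := hκ.measure_le_rpow hm hl hN le_rfl
  rw [huniv, measure_univ, Real.one_rpow, mul_one, ENNReal.one_le_ofReal,
    le_div_iff₀ (by positivity)] at hone
  linarith

lemma lintegral_rpow_rpow_one_div_le (hκ_meas : Measurable κ) {q : ℝ} (hq : 0 < q)
    (hql : q ≤ 1 / 2 - 1 / (4 * l)) :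
    (∫⁻ ω, κ ω ^ q ∂μ) ^ (1 / q) ≤ ENNReal.ofReal (M * Real.exp (1 / q)) := by
  have hhalf : 1 / (4 * l) = 1 / (8 * l) + 1 / (8 * l) := by
    field_simp
    norm_num
  have hβ : 0 < 1 / (8 * l) := by positivity
  exact lintegral_rpow_rpow_one_div_le_of_tail hκ_meas (hκ.scale_pos hm hl hN) hβ hq
    (by linarith) (by linarith) fun t ht => hκ.measure_le_rpow hm hl hN ht

lemma integrable_log_and_integral_log_le (hκ_meas : Measurable κ) {a : ℝ} (ha : 0 < a)
    (hκa : ∀ ω, ENNReal.ofReal a ≤ κ ω) :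
    Integrable (fun ω => Real.log (κ ω).toReal) μ ∧
      ∫ ω, Real.log (κ ω).toReal ∂μ ≤ 1 + Real.log M := by
  have hβ : 1 / (8 * l) ≤ 1 / 8 := one_div_le_one_div_of_le (by norm_num) (by linarith)
  exact integrable_log_and_integral_log_le_of_tail hκ_meas ha hκa (hκ.scale_pos hm hl hN)
    (by positivity) (by linarith) fun t ht => hκ.measure_le_rpow hm hl hN ht

end HasTailBound

end TailRegimes

lemma hasTailBound_kappa_randomForms {n d N : ℕ} {deg : Fin (n - 1) → ℕ} {Ω : Type*}
    [MeasurableSpace Ω] {μ : Measure Ω} [IsProbabilityMeasure μ]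
    {X : (i : Fin (n - 1)) → Ω → EuclideanSpace ℝ (MultiIndex n (deg i))} {K c₀ : ℝ}
    (hn : 3 ≤ n) (hdeg : ∀ i, 0 < deg i) (hd : 2 ≤ d) (hdegd : ∀ i, deg i ≤ d)
    (hX : ∀ i, Measurable (X i)) (hind : iIndepFun X μ) (hK : 0 < K) (hc₀ : 0 < c₀)
    (hsub : ∀ i, SubGaussianWith μ (X i) K) (hball : ∀ i, SmallBallWith μ (X i) c₀)
    (hN : N = ∑ i, (n + deg i - 1).choose (deg i))
    (hmN : (n - 1 : ℕ) * Real.log (Real.exp 1 * d) ≤ N) :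
    HasTailBound μ (fun ω => kappa deg (randomForms X ω)) (n - 1) (Real.log (Real.exp 1 * d)) N
      (√N * (K * c₀ * condConst) ^ (2 * (n - 1)) *
        (3 * (d : ℝ) ^ 2 * Real.log (Real.exp 1 * d)) ^ (2 * n - 3) * √n) := by
  obtain ⟨k, rfl⟩ := Nat.exists_eq_add_of_le' (show 2 ≤ n by omega)
  intro t ht
  have hF := one_le_tailFactor (show 0 < k + 2 - 1 by omega) (Real.log (Real.exp 1 * d)) N t
  have hl := one_le_log_exp_one_mul (show 0 < d by omega)
  refine (measure_le_kappa_randomForms_le (by omega) (by omega) hdeg hd hdegd hX hind hK hc₀ hsub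
    hball hN hmN (sqrt_mul_sq_condScale_le hn (by omega) _ _) ht).trans
      (ENNReal.ofReal_le_ofReal ?_)
  gcongr
  exact log_exp_one_mul_le (by omega)

end RandomSystem

theorem corollary3p8 :
    ∃ C : ℝ, 0 < C ∧
      ∀ (n : ℕ), 3 ≤ n →
      ∀ (deg : Fin (n - 1) → ℕ), (∀ i, 1 ≤ deg i) →
      ∀ (d : ℕ), d = Finset.univ.sup deg → 2 ≤ d →
      ∀ (Ω : Type*) [MeasurableSpace Ω] (μ : Measure Ω) [IsProbabilityMeasure μ]
        (X : (i : Fin (n - 1)) → Ω → EuclideanSpace ℝ (RandomSystem.MultiIndex n (deg i)))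
        (K c₀ : ℝ), 0 < K → 0 < c₀ →
      (∀ i, Measurable (X i)) →
      iIndepFun X μ →
      (∀ i, RandomSystem.SubGaussianWith μ (X i) K) →
      (∀ i, RandomSystem.SmallBallWith μ (X i) c₀) →
      ∀ (N : ℕ), N = ∑ i, (n + deg i - 1).choose (deg i) →
      ∀ (M : ℝ), M = √(N : ℝ) * (K * c₀ * C) ^ (2 * (n - 1)) *
          (3 * (d : ℝ) ^ 2 * Real.log (Real.exp 1 * d)) ^ (2 * n - 3) * √(n : ℝ) →
      ∀ (κ : Ω → ℝ≥0∞),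
        κ = (fun ω => RandomSystem.kappa deg fun i => RandomSystem.formOfCoeffs (X i ω)) →
      -- the tail bound, in three regimes
      (∀ t : ℝ, 1 ≤ t → t ≤ Real.exp (2 * ((n : ℝ) - 1) * Real.log (Real.exp 1 * d)) →
        μ.real {ω | ENNReal.ofReal (t * M) ≤ κ ω} ≤ 3 * t ^ (-(1 / 2) : ℝ)) ∧
      (∀ t : ℝ, Real.exp (2 * ((n : ℝ) - 1) * Real.log (Real.exp 1 * d)) ≤ t →
        t ≤ Real.exp (2 * (N : ℝ)) →
        μ.real {ω | ENNReal.ofReal (t * M) ≤ κ ω} ≤ 3 * t ^ (-(1 / 2) : ℝ) *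
          (Real.log t / (2 * ((n : ℝ) - 1) * Real.log (Real.exp 1 * d))) ^
            (((n : ℝ) - 3 / 2) / 2)) ∧
      (∀ t : ℝ, Real.exp (2 * (N : ℝ)) ≤ t →
        μ.real {ω | ENNReal.ofReal (t * M) ≤ κ ω} ≤ 3 * t ^ (-(1 / 2) : ℝ) *
          (Real.log t / (2 * (N : ℝ))) ^ (1 / 4 : ℝ) *
          (Real.log t / (2 * ((n : ℝ) - 1) * Real.log (Real.exp 1 * d))) ^
            (((n : ℝ) - 3 / 2) / 2)) ∧
      -- the moments
      (∀ q : ℝ, 0 < q → q ≤ 1 / 2 - 1 / (4 * Real.log (Real.exp 1 * d)) →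
        (∫⁻ ω, κ ω ^ q ∂μ) ^ (1 / q) ≤ ENNReal.ofReal (M * Real.exp (1 / q))) ∧
      -- the logarithm: almost surely a real number, integrable, with bounded expectation
      (∀ᵐ ω ∂μ, κ ω ≠ 0 ∧ κ ω ≠ ∞) ∧
      Integrable (fun ω => Real.log (κ ω).toReal) μ ∧
      ∫ ω, Real.log (κ ω).toReal ∂μ ≤ 1 + Real.log M := by
  refine ⟨RandomSystem.condConst, RandomSystem.condConst_pos, ?_⟩
  intro n hn deg hdeg d hd hd₂ Ω _ μ _ X K c₀ hK hc₀ hX hind hsub hball N hN M hM κ hκ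
  obtain ⟨k, rfl⟩ := Nat.exists_eq_add_of_le' (show 2 ≤ n by omega)
  obtain ⟨i, -, hi⟩ := Finset.exists_mem_eq_sup Finset.univ ⟨⟨0, by omega⟩, by simp⟩ deg
  have hdegd : ∀ i, deg i ≤ d := fun i => hd ▸ Finset.le_sup (Finset.mem_univ i)
  have hm : 0 < k + 2 - 1 := by omega
  have hl := RandomSystem.one_le_log_exp_one_mul (show 0 < d by omega)
  have hmN := hN ▸ RandomSystem.mul_log_le_sum_choose rfl (by omega) ⟨i, (hd.trans hi).symm⟩
  have htail : RandomSystem.HasTailBound μ κ _ _ _ M := hM ▸ hκ ▸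
    RandomSystem.hasTailBound_kappa_randomForms hn hdeg hd₂ hdegd hX hind hK hc₀ hsub hball hN hmN
  have hκ_meas : Measurable κ := hκ ▸
    (RandomSystem.measurable_kappa_forms hdeg).comp (measurable_pi_lambda _ hX)
  have hκ_lower : ∀ ω, ENNReal.ofReal (1 / (4 * d)) ≤ κ ω :=
    hκ ▸ fun ω => RandomSystem.le_kappa_forms hdeg (by omega) hdegd _
  have hn₁ : ((k + 2 : ℕ) : ℝ) - 1 = (k + 2 - 1 : ℕ) := by push_cast; ring
  have hn₂ : ((k + 2 : ℕ) : ℝ) - 3 / 2 = (k + 2 - 1 : ℕ) - 1 / 2 := by push_cast; ring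
  rw [hn₁, hn₂]
  exact ⟨fun _ => htail.measureReal_le_of_le_exp hm hl hmN,
    fun _ => htail.measureReal_le_of_exp_le_of_le_exp hm hl hmN,
    fun _ => htail.measureReal_le_of_exp_le hm hl hmN,
    fun _ => htail.lintegral_rpow_rpow_one_div_le hm hl hmN hκ_meas,
    (htail.ae_ne_top hm hl hmN).mono fun ω hω =>
      ⟨((ENNReal.ofReal_pos.2 (by positivity)).trans_le (hκ_lower ω)).ne', hω⟩,
    htail.integrable_log_and_integral_log_le hm hl hmN hκ_meas (by positivity) hκ_lower⟩
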